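/- A \emph{simple polygon} $\mathscr P$ with $n\ge 3$ pairwise distinct vertices $p_1,\dots,p_n$ in the plane is a closed polygonal path in which two different edges meet only in points that are endpoints of both; its interior is the bounded region enclosed by its boundary $\partial\mathscr P$, and $\mathscr P$ also denotes the closed region consisting of boundary and interior. For $x\in\mathscr P$ let $\mathsf{Vis}(x)=\{q\in\mathscr P : \overline{xq}\subseteq\mathscr P\}$. For a finite set $F\subset\mathscr P$, the visibility intersection graph $\mathsf{VIG}(F)$ has vertex set $F$, and two distinct points $a,b$ are adjacent iff $\mathsf{Vis}(a)\cap\mathsf{Vis}(b)\ne\emptyset$. For $\delta>0$, the inflated polygon $\mathsf{Inf}_\delta(\mathscr P)$ is obtained by moving each edge outwards, parallel to itself, by the distance $\delta$; its vertices are the points where the moved copies of consecutive edges meet (if two consecutive edges at $p$ are collinear, the new vertex is $p$ moved outwards by $\delta$ perpendicularly to them). A \emph{string} is a polygonal curve, with at least one edge, that does not intersect itself. For a set $\mathcal S$ of strings, the string intersection graph $\mathsf{SIG}(\mathcal S)$ has vertex set $\mathcal S$, and two distinct strings are adjacent iff they intersect. An \emph{outerstring graph} is the intersection graph of a family of simple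 curves contained in a closed disk, each of which meets the bounding circle in exactly one point, which is one of its endpoints. \textbf{Lemma.} Let $F$ be a finite set of points in a simple polygon $\mathscr P$. For every $\varepsilon>0$ there is $\delta_0>0$ such that for every $\delta\in(0,\delta_0)$ the inflated polygon $\mathsf{Inf}_\delta(\mathscr P)$ is a simple polygon that contains $\mathscr P$ in its interior, and there are strings $\mathsf{Str}(w)$, $w\in F$, with the following properties. (i) One endpoint of $\mathsf{Str}(w)$, its origin, lies on $\partial\,\mathsf{Inf}_\delta(\mathscr P)$, and all other points of $\mathsf{Str}(w)$ lie in the interior of $\mathsf{Inf}_\delta(\mathscr P)$; different points of $F$ have different origins. (ii) $\mathsf{Str}(w)$ follows the topological boundary $\partial\,\mathsf{Vis}(w)$ up to $\varepsilon$: every point of either set has distance less than $\varepsilon$ from some point of the other. (iii) For all $w,w'\in F$, $\mathsf{Str}(w)\cap\mathsf{Str}(w')\neq\emptyset$ if and only if $\mathsf{Vis}(w)\cap\mathsf{Vis}(w')\ne\emptyset$. (iv) With $\mathcal S=\{\mathsf{Str}(w) : w\in F\}$, the map $w\mapsto\mathsf{Str}(w)$ is a graph isomorphism from $\mathsf{VIG}(F)$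 to $\mathsf{SIG}(\mathcal S)$, and $\mathsf{SIG}(\mathcal S)$ is an outerstring graph. In particular, $\mathsf{VIG}(F)$ is an outerstring graph. -/

import Mathlib

open Set Filter Topology

noncomputable section

namespace PolygonVisibility

/-- The Euclidean plane. -/
abbrev Plane : Type := EuclideanSpace ℝ (Fin 2)

/-! ### Simple polygons -/

/-- A closed polygon (cyclic list of vertices, edge `i` joining vertex `i` to its cyclic successor)
is simple if it has at least three vertices, its vertices are pairwise distinct, and two different
edges meet only in points that are endpoints of both. -/
structure IsSimplePolygon {n : ℕ} (P : Polygon Plane n) : Prop where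
  three_le : 3 ≤ n
  injective : Function.Injective P.vertices
  edges_meet : ∀ i j : Fin n, i ≠ j → ∀ x ∈ P.edgeSet ℝ i ∩ P.edgeSet ℝ j,
    (x = P i ∨ x = P (finRotate n i)) ∧ (x = P j ∨ x = P (finRotate n j))

/-- The (open) region enclosed by the polygon: the points off the boundary whose connected
component in the complement of the boundary is bounded. -/
def polygonInterior {n : ℕ} (P : Polygon Plane n) : Set Plane :=
  {x | x ∉ P.boundary ℝ ∧
    Bornology.IsBounded (connectedComponentIn (P.boundary ℝ)ᶜ x)}

/-- The polygon as a closed planar region: its boundary together with its interior. -/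
def region {n : ℕ} (P : Polygon Plane n) : Set Plane :=
  P.boundary ℝ ∪ polygonInterior P

/-! ### Visibility -/

/-- The visibility region of `x`: all points `q` of the polygon such that the whole
segment from `x` to `q` lies in the polygon (boundary included). -/
def Vis {n : ℕ} (P : Polygon Plane n) (x : Plane) : Set Plane :=
  {q | q ∈ region P ∧ segment ℝ x q ⊆ region P}

/-- The visibility intersection graph of a set of points `F`: the vertices are the points of `F`,
two different points being adjacent iff their visibility regions intersect. -/
def VIG {n : ℕ} (P : Polygon Plane n) (F : Finset Plane) : SimpleGraph F where
  Adj a b := a ≠ b ∧ (Vis P a ∩ Vis P b).Nonempty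
  symm := ⟨fun _ _ h => ⟨h.1.symm, by rw [Set.inter_comm]; exact h.2⟩⟩
  loopless := ⟨fun _ h => h.1 rfl⟩

/-! ### Inflating a polygon -/

/-- The unit vector obtained from the direction of edge `i` by a clockwise quarter turn. -/
def edgeNormal {n : ℕ} (P : Polygon Plane n) (i : Fin n) : Plane :=
  let d : Plane := P (finRotate n i) - P i
  ‖d‖⁻¹ • !₂[d 1, -d 0]

open Classical in
/-- The unit normal of edge `i` that points to the outside of the polygon: of the two
unit normals, the one along which one leaves the polygon when starting at the midpoint of the
edge. -/
def outwardNormal {n : ℕ} (P : Polygon Plane n) (i : Fin n) : Plane :=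
  if ∀ᶠ t : ℝ in 𝓝[>] 0,
      midpoint ℝ (P i) (P (finRotate n i)) + t • edgeNormal P i ∉ region P
  then edgeNormal P i else -edgeNormal P i

/-- The polygon inflated by `δ`: every edge is moved outwards, parallel to itself, by the distance
`δ`, and new vertex `i` is the point where the two moved edges adjacent to it meet.
For outward unit normals `u`, `v` of the two edges at a vertex `p`, the meeting point of the lines
`⟪x - p, u⟫ = δ` and `⟪x - p, v⟫ = δ` is `p + (δ / (1 + ⟪u, v⟫)) • (u + v)`. If the two edges are
collinear (`u = v`), this is `p + δ • u`. -/
def inflate {n : ℕ} (P : Polygon Plane n) (δ : ℝ) : Polygon Plane n where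
  vertices i :=
    let u := outwardNormal P ((finRotate n).symm i)
    let v := outwardNormal P i
    P i + (δ / (1 + inner ℝ u v)) • (u + v)

/-! ### Strings -/

/-- A string: a polygonal curve, with at least one edge, that does not meet itself. Consecutive
edges share only their common vertex, and all other pairs of edges are disjoint. -/
structure PolygonalString where
  /-- the number of edges -/
  numEdges : ℕ
  numEdges_pos : 0 < numEdges
  /-- the vertices, in order along the curve -/
  vertices : Fin (numEdges + 1) → Plane
  injective : Function.Injective vertices
  edges_meet : ∀ i j : Fin numEdges, i < j →
    ∀ x ∈ segment ℝ (vertices i.castSucc) (vertices i.succ) ∩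
        segment ℝ (vertices j.castSucc) (vertices j.succ),
      i.val + 1 = j.val ∧ x = vertices i.succ

namespace PolygonalString

/-- The set of points of the string. -/
def carrier (s : PolygonalString) : Set Plane :=
  ⋃ i : Fin s.numEdges, segment ℝ (s.vertices i.castSucc) (s.vertices i.succ)

/-- The first endpoint of the string. -/
def origin (s : PolygonalString) : Plane := s.vertices 0

end PolygonalString

/-- The string intersection graph of a set of strings: two different strings are adjacent iff they
intersect. -/
def SIG (S : Set PolygonalString) : SimpleGraph S where
  Adj s t := s ≠ t ∧ (s.1.carrier ∩ t.1.carrier).Nonempty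
  symm := ⟨fun _ _ h => ⟨h.1.symm, by rw [Set.inter_comm]; exact h.2⟩⟩
  loopless := ⟨fun _ h => h.1 rfl⟩

/-- A graph is an outerstring graph if it is the intersection graph of simple curves that lie inside
a circle, each of which meets the circle in exactly one point, which is one of its endpoints. -/
def IsOuterstring {V : Type*} (G : SimpleGraph V) : Prop :=
  ∃ γ : V → C(unitInterval, Plane),
    (∀ v, Function.Injective (γ v) ∧ γ v 0 ∈ Metric.sphere (0 : Plane) 1 ∧
      ∀ t, t ≠ 0 → γ v t ∈ Metric.ball (0 : Plane) 1) ∧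
    ∀ u v, u ≠ v → (G.Adj u v ↔ (range (γ u) ∩ range (γ v)).Nonempty)

end PolygonVisibility

end

open PolygonVisibility

/-! The plan is to build everything from an explicit collar of the boundary and from winding
numbers, without a general Jordan or Schoenflies theorem.

Collar. Let every edge move with unit speed along its normal, so that vertex `i` moves with velocity
`mitre P i`. For small times the moved edges are pairwise disjoint at different times
(`IsCollarWidth.collar_inj`) and sweep out a neighbourhood of the boundary
(`IsCollarWidth.collar_mem_nhds`). The times of one sign form a connected strip off the boundary, so
the winding number is constant on each of the two strips, and the two values differ by one
(`IsCollarWidth.wind_jump`). The strip that can be joined to a point far away has winding number 0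
and is the outer one, and the interior is exactly the set of points with nonzero winding number
(`IsSimplePolygon.exists_outerSide`). Inflating is moving the edges towards the outer strip, which
gives simplicity and the inclusion of the polygon.

One string. `K = Vis(w)` is compact and star-shaped about `w`, so the distance from `K` increases
strictly along rays from `w` once it is positive. A level set of the distance is therefore a closed
curve around `w`, and it carries the vertices of a fine star-shaped polygon. The string enters along
a collar fibre, the tail, that leads to a boundary point of the polygon visible from `w`. It stops
just before `K` and then runs along the star-shaped polygon, leaving out the last edge. The gap lies
close to the tail and away from the polygon `P` and all other tails. Hence a connected set that
stays near `P` and the other tails, comes close to `K` and also leaves the neighbourhood of `K`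
cannot slip through the gap, and must meet the string (`exists_string`).

All strings. They are chosen one after the other, each so fine that the traps set by the previous
ones work on it (`exists_sequential_choice`). If two visibility regions meet, so do their frontiers
(`IsOuterSide.frontier_inter_nonempty`). The later string then comes close to the earlier region,
while its origin is far from it, and the trap applies. If two regions are disjoint, so are the
regions together with their tails, and a small scale keeps the strings apart.

Outerstrings. Some part of an edge can be left along parallel rays to infinity
(`IsOuterSide.exists_exit_window`). In the outer collar the origins are transported to this window
along disjoint curves that rise in height while their positions are compressed. The rays then lead
on to a large circle. -/

noncomputable section
namespace PolygonVisibility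

/-! ### The cross product of the plane -/

/-- The cross product (determinant) of two vectors of the plane. -/
def cross (x y : Plane) : ℝ := x 0 * y 1 - x 1 * y 0

theorem cross_add_left (x y z : Plane) : cross (x + y) z = cross x z + cross y z := by
  simp [cross]; ring

theorem cross_add_right (x y z : Plane) : cross x (y + z) = cross x y + cross x z := by
  simp [cross]; ring

theorem cross_sub_left (x y z : Plane) : cross (x - y) z = cross x z - cross y z := by
  simp [cross]; ring

theorem cross_sub_right (x y z : Plane) : cross x (y - z) = cross x y - cross x z := by
  simp [cross]; ring

theorem cross_smul_left (a : ℝ) (x y : Plane) : cross (a • x) y = a * cross x y := by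
  simp [cross]; ring

theorem cross_smul_right (a : ℝ) (x y : Plane) : cross x (a • y) = a * cross x y := by
  simp [cross]; ring

theorem cross_neg_left (x y : Plane) : cross (-x) y = -cross x y := by
  simp [cross]; ring

theorem cross_self (x : Plane) : cross x x = 0 := by
  simp [cross]; ring

theorem cross_swap (x y : Plane) : cross x y = -cross y x := by
  simp [cross]; ring

theorem plane_norm_sq (x : Plane) : ‖x‖ ^ 2 = x 0 ^ 2 + x 1 ^ 2 := by
  simp [EuclideanSpace.norm_sq_eq]

theorem plane_inner (x y : Plane) : inner ℝ x y = x 0 * y 0 + x 1 * y 1 := by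
  simp [PiLp.inner_apply, Fin.sum_univ_two]; ring

theorem continuous_cross_left (y : Plane) : Continuous fun x => cross x y := by
  unfold cross; fun_prop

theorem continuous_cross_right (y : Plane) : Continuous fun x => cross y x := by
  unfold cross; fun_prop

/-- A vector with vanishing cross product with `d ≠ 0` is a multiple of `d`. -/
theorem eq_smul_of_cross_eq_zero {x d : Plane} (hd : d ≠ 0) (h : cross x d = 0) :
    x = ((inner ℝ x d : ℝ) / ‖d‖ ^ 2) • d := by
  have hn : ‖d‖ ^ 2 ≠ 0 := by positivity
  have h0 : d 0 ^ 2 + d 1 ^ 2 ≠ 0 := by rw [← plane_norm_sq]; exact hn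
  rw [plane_inner, plane_norm_sq]
  rw [cross] at h
  ext k
  fin_cases k
  · simp
    field_simp
    linear_combination (d 1) * h
  · simp
    field_simp
    linear_combination (-d 0) * h

/-! ### Piecewise linear interpolation -/

section Interp
variable {E : Type*} [NormedAddCommGroup E] [NormedSpace ℝ E]

/-- The piecewise linear curve through the points `q k` at the integer times `k`. -/
def plInterp (q : ℤ → E) (u : ℝ) : E :=
  (1 - Int.fract u) • q ⌊u⌋ + Int.fract u • q (⌊u⌋ + 1)

theorem plInterp_of_mem (q : ℤ → E) (k : ℤ) {u : ℝ} (h : u ∈ Icc (k : ℝ) (k + 1)) :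
    plInterp q u = (1 - (u - k)) • q k + (u - k) • q (k + 1) := by
  rcases eq_or_lt_of_le h.2 with h2 | h2
  · have hf : ⌊u⌋ = k + 1 := by rw [h2]; exact_mod_cast Int.floor_intCast (k + 1)
    have hfr : Int.fract u = 0 := by rw [Int.fract, hf, h2]; push_cast; ring
    rw [plInterp, hfr, hf, h2]; simp
  · have hf : ⌊u⌋ = k := by rw [Int.floor_eq_iff]; exact ⟨h.1, h2⟩
    rw [plInterp, Int.fract, hf]

theorem plInterp_intCast_add (q : ℤ → E) (k : ℤ) {s : ℝ} (h : s ∈ Icc (0 : ℝ) 1) :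
    plInterp q (k + s) = (1 - s) • q k + s • q (k + 1) := by
  rw [plInterp_of_mem q k ⟨by linarith [h.1], by linarith [h.2]⟩]; simp

theorem plInterp_intCast (q : ℤ → E) (k : ℤ) : plInterp q k = q k := by
  simp [plInterp]

theorem continuous_plInterp (q : ℤ → E) : Continuous (plInterp q) := by
  rw [continuous_iff_continuousAt]
  intro u₀
  set k := ⌊u₀⌋ with hk
  have h1 : (k : ℝ) ≤ u₀ := Int.floor_le u₀
  have h2 : u₀ < k + 1 := Int.lt_floor_add_one u₀
  -- On `(k - 1, k + 1)` only the node `k` is passed. Positive and negative parts of `u - k` merge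
  -- the two linear pieces into one visibly continuous formula.
  have hev : plInterp q =ᶠ[𝓝 u₀] fun u =>
      q k + max (u - k) 0 • (q (k + 1) - q k) + min (u - k) 0 • (q k - q (k - 1)) := by
    have : Ioo ((k : ℝ) - 1) (k + 1) ∈ 𝓝 u₀ := Ioo_mem_nhds (by linarith) h2
    filter_upwards [this] with u hu
    rcases le_total (k : ℝ) u with h | h
    · rw [plInterp_of_mem q k ⟨h, hu.2.le⟩, max_eq_left (by linarith), min_eq_right (by linarith)]
      module
    · rw [plInterp_of_mem q (k - 1) ⟨by push_cast; linarith [hu.1], by push_cast; linarith⟩,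
        max_eq_right (by linarith), min_eq_left (by linarith)]
      push_cast
      rw [sub_add_cancel]
      module
  refine ContinuousAt.congr ?_ hev.symm
  fun_prop

end Interp

/-! ### Curves carried by strings -/

namespace PolygonalString

/-- The vertices of a string, extended to all integers. -/
def vertexZ (s : PolygonalString) (k : ℤ) : Plane :=
  s.vertices ⟨min k.toNat s.numEdges, by omega⟩

theorem vertexZ_natCast (s : PolygonalString) (i : Fin s.numEdges) :
    s.vertexZ (i.val : ℤ) = s.vertices i.castSucc ∧
      s.vertexZ ((i.val : ℤ) + 1) = s.vertices i.succ := by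
  constructor
  · unfold vertexZ; congr 1; ext; simp
  · unfold vertexZ; congr 1; ext; simp

theorem plInterp_mem_edge (s : PolygonalString) (i : Fin s.numEdges) {u : ℝ}
    (hu : u ∈ Icc ((i.val : ℤ) : ℝ) ((i.val : ℤ) + 1)) :
    plInterp s.vertexZ u ∈ segment ℝ (s.vertices i.castSucc) (s.vertices i.succ) := by
  rw [plInterp_of_mem _ _ hu, (s.vertexZ_natCast i).1, (s.vertexZ_natCast i).2]
  exact ⟨1 - (u - (i.val : ℤ)), u - (i.val : ℤ), by linarith [hu.2], by linarith [hu.1], by ring, rfl⟩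

/-- At the time of an inner vertex two edges qualify. The last clause selects the one that starts
there, so that a time before the end of the string is never the final time of its edge. -/
theorem exists_edge_of_mem (s : PolygonalString) {u : ℝ} (hu : u ∈ Icc (0 : ℝ) s.numEdges) :
    ∃ i : Fin s.numEdges, u ∈ Icc ((i.val : ℤ) : ℝ) ((i.val : ℤ) + 1) ∧
      (u < s.numEdges → u < (i.val : ℤ) + 1) := by
  rcases eq_or_lt_of_le hu.2 with h | h
  · have := s.numEdges_pos
    refine ⟨⟨s.numEdges - 1, by omega⟩, ?_, fun h' => absurd h h'.ne⟩
    have e : (((s.numEdges - 1 : ℕ) : ℤ) : ℝ) = s.numEdges - 1 := by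
      push_cast [Nat.cast_sub (show 1 ≤ s.numEdges from this)]; ring
    simp only [e, h]
    constructor <;> linarith
  · have h0 : 0 ≤ ⌊u⌋ := Int.floor_nonneg.2 hu.1
    have h1 : ⌊u⌋ < s.numEdges := by rw [Int.floor_lt]; exact_mod_cast h
    refine ⟨⟨⌊u⌋.toNat, by omega⟩, ?_⟩
    simp only [Int.toNat_of_nonneg h0]
    exact ⟨⟨Int.floor_le u, (Int.lt_floor_add_one u).le⟩, fun _ => Int.lt_floor_add_one u⟩

theorem image_plInterp (s : PolygonalString) :
    plInterp s.vertexZ '' Icc (0 : ℝ) s.numEdges = s.carrier := by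
  ext x
  simp only [carrier, mem_iUnion, mem_image]
  constructor
  · rintro ⟨u, hu, rfl⟩
    obtain ⟨i, hi, -⟩ := s.exists_edge_of_mem hu
    exact ⟨i, s.plInterp_mem_edge i hi⟩
  · rintro ⟨i, a, b, ha, hb, hab, rfl⟩
    refine ⟨((i.val : ℤ) : ℝ) + b, ⟨by positivity, ?_⟩, ?_⟩
    · have : ((i.val : ℤ) : ℝ) + 1 ≤ s.numEdges := by exact_mod_cast i.2
      linarith
    · rw [plInterp_intCast_add _ _ ⟨hb, by linarith⟩, (s.vertexZ_natCast i).1,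
        (s.vertexZ_natCast i).2]
      rw [← hab]; simp

theorem injOn_plInterp (s : PolygonalString) :
    InjOn (plInterp s.vertexZ) (Icc (0 : ℝ) s.numEdges) := by
  have key : ∀ u ∈ Icc (0 : ℝ) s.numEdges, ∀ u' ∈ Icc (0 : ℝ) s.numEdges, u < u' →
      plInterp s.vertexZ u ≠ plInterp s.vertexZ u' := by
    intro u hu u' hu' hlt heq
    obtain ⟨i, hi, hi'⟩ := s.exists_edge_of_mem hu
    obtain ⟨j, hj, hj'⟩ := s.exists_edge_of_mem hu'
    have hui := hi' (hlt.trans_le hu'.2)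
    have hij : i ≤ j := by
      by_contra hc
      have : (j.val : ℤ) + 1 ≤ i.val := by have : j.val < i.val := by omega
                                           omega
      have : ((j.val : ℤ) : ℝ) + 1 ≤ (i.val : ℤ) := by exact_mod_cast this
      linarith [hj.2, hi.1]
    rcases eq_or_lt_of_le hij with rfl | hlt'
    · rw [plInterp_of_mem _ _ hi, plInterp_of_mem _ _ hj] at heq
      have h0 : (u' - u) • (s.vertexZ ((i.val : ℤ) + 1) - s.vertexZ (i.val : ℤ)) = 0 := by
        rw [← sub_eq_zero] at heq
        rw [← neg_eq_zero, ← heq]; module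
      rcases smul_eq_zero.1 h0 with h | h
      · linarith
      · rw [(s.vertexZ_natCast i).1, (s.vertexZ_natCast i).2, sub_eq_zero] at h
        have := s.injective h
        simp [Fin.ext_iff] at this
    -- The only point that two edges may share is the end of the earlier one, and `hui` says that
    -- `u` lies strictly before that end.
    · obtain ⟨h1, h2⟩ := s.edges_meet i j hlt' (plInterp s.vertexZ u)
        ⟨s.plInterp_mem_edge i hi, heq ▸ s.plInterp_mem_edge j hj⟩
      rw [plInterp_of_mem _ _ hi, (s.vertexZ_natCast i).1, (s.vertexZ_natCast i).2] at h2
      have h0 : (1 - (u - ((i.val : ℤ) : ℝ))) • (s.vertices i.castSucc - s.vertices i.succ) = 0 := by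
        rw [← sub_eq_zero] at h2
        rw [← h2]; module
      rcases smul_eq_zero.1 h0 with h | h
      · linarith
      · rw [sub_eq_zero] at h
        have := s.injective h
        simp [Fin.ext_iff] at this
  intro u hu u' hu' heq
  rcases lt_trichotomy u u' with h | h | h
  · exact absurd heq (key u hu u' hu' h)
  · exact h
  · exact absurd heq.symm (key u' hu' u hu h)

/-- A string is the range of an injective curve that starts in its origin. -/
theorem exists_path (s : PolygonalString) : ∃ γ : C(unitInterval, Plane),
    Function.Injective γ ∧ γ 0 = s.origin ∧ range γ = s.carrier := by
  have hN : (0 : ℝ) < s.numEdges := by exact_mod_cast s.numEdges_pos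
  have hm : ∀ t : unitInterval, (s.numEdges : ℝ) * t ∈ Icc (0 : ℝ) s.numEdges := fun t =>
    ⟨mul_nonneg hN.le t.2.1, mul_le_of_le_one_right hN.le t.2.2⟩
  refine ⟨⟨fun t => plInterp s.vertexZ (s.numEdges * t),
    (continuous_plInterp _).comp (by fun_prop)⟩, ?_, ?_, ?_⟩
  · intro t t' h
    have := s.injOn_plInterp (hm t) (hm t') h
    exact Subtype.ext (mul_left_cancel₀ hN.ne' this)
  · have := plInterp_intCast s.vertexZ 0
    simp only [Int.cast_zero] at this
    simp [this, origin, vertexZ]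
  · rw [← image_plInterp]
    ext x
    constructor
    · rintro ⟨t, rfl⟩
      exact ⟨_, hm t, rfl⟩
    · rintro ⟨u, hu, rfl⟩
      refine ⟨⟨u / s.numEdges, div_nonneg hu.1 hN.le, (div_le_one hN).2 hu.2⟩, ?_⟩
      simp only [ContinuousMap.coe_mk]
      congr 1
      field_simp

theorem isPreconnected_carrier (s : PolygonalString) : IsPreconnected s.carrier := by
  obtain ⟨γ, -, -, h⟩ := s.exists_path
  rw [← h]; exact isPreconnected_range γ.continuous

theorem isCompact_carrier (s : PolygonalString) : IsCompact s.carrier := by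
  obtain ⟨γ, -, -, h⟩ := s.exists_path
  rw [← h]; exact isCompact_range γ.continuous

theorem origin_mem_carrier (s : PolygonalString) : s.origin ∈ s.carrier := by
  obtain ⟨γ, -, h0, h⟩ := s.exists_path
  rw [← h, ← h0]; exact mem_range_self 0

end PolygonalString

/-- Injective curves that share only the end of the first and the start of the second can be
concatenated. -/
theorem exists_concat (f g : C(unitInterval, Plane)) (hf : Function.Injective f)
    (hg : Function.Injective g) (hfg : f 1 = g 0) (hint : range f ∩ range g ⊆ {f 1}) :
    ∃ h : C(unitInterval, Plane), Function.Injective h ∧ h 0 = f 0 ∧ h 1 = g 1 ∧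
      range h = range f ∪ range g := by
  let p : Path (f 0) (f 1) := ⟨f, rfl, rfl⟩
  let q : Path (f 1) (g 1) := ⟨g, hfg.symm, rfl⟩
  refine ⟨(p.trans q).toContinuousMap, ?_, (p.trans q).source, (p.trans q).target,
    Path.trans_range p q⟩
  have key : ∀ s t : unitInterval, (s : ℝ) ≤ 1 / 2 → ¬ (t : ℝ) ≤ 1 / 2 →
      (p.trans q) s ≠ (p.trans q) t := by
    intro s t hs ht h
    rw [Path.trans_apply, Path.trans_apply, dif_pos hs, dif_neg ht] at h
    have h1 : f ⟨2 * s, (unitInterval.mul_pos_mem_iff zero_lt_two).2 ⟨s.2.1, hs⟩⟩ ∈ ({f 1} : Set Plane) :=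
      hint ⟨mem_range_self _, h ▸ mem_range_self _⟩
    have h2 : g ⟨2 * t - 1, unitInterval.two_mul_sub_one_mem_iff.2 ⟨(not_le.1 ht).le, t.2.2⟩⟩ = g 0 := by
      rw [← hfg]
      exact h.symm.trans h1
    have h3 := congrArg Subtype.val (hg h2)
    simp at h3
    apply ht; linarith
  intro s t h
  change (p.trans q) s = (p.trans q) t at h
  by_cases hs : (s : ℝ) ≤ 1 / 2 <;> by_cases ht : (t : ℝ) ≤ 1 / 2
  · rw [Path.trans_apply, Path.trans_apply, dif_pos hs, dif_pos ht] at h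
    have := congrArg Subtype.val (hf h)
    simp at this
    exact Subtype.ext this
  · exact absurd h (key s t hs ht)
  · exact absurd h.symm (key t s ht hs)
  · rw [Path.trans_apply, Path.trans_apply, dif_neg hs, dif_neg ht] at h
    have := congrArg Subtype.val (hg h)
    simp at this
    exact Subtype.ext (by linarith)

theorem IsOuterstring.of_iso {V W : Type*} {G : SimpleGraph V} {H : SimpleGraph W} (e : G ≃g H)
    (h : IsOuterstring H) : IsOuterstring G := by
  obtain ⟨γ, h1, h2⟩ := h
  exact ⟨fun v => γ (e v), fun v => h1 (e v), fun u v huv => by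
    rw [← h2 _ _ (e.injective.ne huv), e.map_adj_iff]⟩

theorem exists_pos_forall_le_dist {s t : Set Plane} (hs : IsCompact s) (ht : IsClosed t)
    (h : Disjoint s t) : ∃ r : ℝ, 0 < r ∧ ∀ x ∈ s, ∀ y ∈ t, r < dist x y := by
  obtain ⟨r, hr, h'⟩ := Metric.exists_pos_forall_lt_edist hs ht h
  refine ⟨r, by exact_mod_cast hr, fun x hx y hy => ?_⟩
  have := h' x hx y hy
  rw [edist_nndist] at this
  rw [dist_nndist]
  exact_mod_cast this

theorem isCompact_segment (a b : Plane) : IsCompact (segment ℝ a b) := by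
  rw [segment_eq_image_lineMap]
  exact isCompact_Icc.image (by fun_prop)

theorem eventually_mul_lt (K : ℝ) {L : ℝ} (hL : 0 < L) : ∀ᶠ η : ℝ in 𝓝[>] 0, η * K < L := by
  have : Tendsto (fun η : ℝ => η * K) (𝓝[>] 0) (𝓝 (0 * K)) :=
    (continuous_id.mul continuous_const).continuousWithinAt.tendsto
  rw [zero_mul] at this
  exact this.eventually (gt_mem_nhds hL)

/-! ### The collar of a simple polygon: moving all edges in parallel -/

section Collar
variable {n : ℕ} (P : Polygon Plane n)

/-- The vector along edge `i`. -/
def edgeVec (i : Fin n) : Plane := P (finRotate n i) - P i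

/-- The velocity of vertex `i` when every edge moves with unit speed in direction `edgeNormal`. -/
def mitre (i : Fin n) : Plane :=
  (1 + inner ℝ (edgeNormal P ((finRotate n).symm i)) (edgeNormal P i) : ℝ)⁻¹ •
    (edgeNormal P ((finRotate n).symm i) + edgeNormal P i)

/-- The point with parameter `s` on edge `i` after moving all edges by `t`. -/
def collar (i : Fin n) (s t : ℝ) : Plane :=
  P i + s • edgeVec P i + t • ((1 - s) • mitre P i + s • mitre P (finRotate n i))

/-- The polygon obtained by moving every edge by `t` in direction `edgeNormal`. -/
def offset (t : ℝ) : Polygon Plane n where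
  vertices i := P i + t • mitre P i

theorem mem_edgeSet_iff (i : Fin n) (x : Plane) :
    x ∈ P.edgeSet ℝ i ↔ ∃ s ∈ Icc (0 : ℝ) 1, P i + s • edgeVec P i = x := by
  simp only [Polygon.edgeSet, affineSegment, mem_image, AffineMap.lineMap_apply, vsub_eq_sub,
    vadd_eq_add, edgeVec]
  simp only [add_comm]

theorem edgeSet_eq_segment (i : Fin n) :
    P.edgeSet ℝ i = segment ℝ (P i) (P (finRotate n i)) :=
  affineSegment_eq_segment ℝ _ _

theorem isCompact_edgeSet (i : Fin n) : IsCompact (P.edgeSet ℝ i) := by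
  rw [edgeSet_eq_segment]
  exact isCompact_segment _ _

theorem isCompact_boundary : IsCompact (P.boundary ℝ) :=
  isCompact_iUnion fun i => isCompact_edgeSet P i

theorem mem_boundary_iff (x : Plane) :
    x ∈ P.boundary ℝ ↔ ∃ i, ∃ s ∈ Icc (0 : ℝ) 1, P i + s • edgeVec P i = x := by
  simp only [Polygon.boundary, mem_iUnion, mem_edgeSet_iff]

theorem collar_zero (i : Fin n) (s : ℝ) : collar P i s 0 = P i + s • edgeVec P i := by
  simp [collar]

theorem collar_offset (i : Fin n) (s t : ℝ) :
    offset P t i + s • edgeVec (offset P t) i = collar P i s t := by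
  simp only [offset, edgeVec, collar]; module

theorem collar_one (i : Fin n) (t : ℝ) : collar P i 1 t = collar P (finRotate n i) 0 t := by
  simp only [edgeVec, collar]; module

theorem mem_boundary_offset_iff (t : ℝ) (x : Plane) :
    x ∈ (offset P t).boundary ℝ ↔ ∃ i, ∃ s ∈ Icc (0 : ℝ) 1, collar P i s t = x := by
  simp only [mem_boundary_iff, collar_offset]

/-- The normal is the edge vector turned clockwise and normalized. The cross product with the edge
vector thus measures the height over the edge, positive on the side of `edgeNormal`; all statements
about sides use it. -/
theorem cross_edgeVec (i : Fin n) (x : Plane) :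
    cross x (edgeVec P i) = ‖edgeVec P i‖ * inner ℝ x (edgeNormal P i) := by
  rcases eq_or_ne (edgeVec P i) 0 with h | h
  · simp [h, cross]
  · have h' : ‖edgeVec P i‖ ≠ 0 := norm_ne_zero_iff.2 h
    have : edgeNormal P i = ‖edgeVec P i‖⁻¹ • !₂[edgeVec P i 1, -edgeVec P i 0] := rfl
    rw [this, inner_smul_right, mul_inv_cancel_left₀ h', plane_inner, cross]
    simp; ring

variable {P}

theorem IsSimplePolygon.rotate_ne (hP : IsSimplePolygon P) (i : Fin n) : finRotate n i ≠ i := by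
  have h : i ∈ (finRotate n).support := by
    rw [support_finRotate_of_le (by linarith [hP.three_le])]; exact Finset.mem_univ _
  exact Equiv.Perm.mem_support.1 h

theorem IsSimplePolygon.edgeVec_ne_zero (hP : IsSimplePolygon P) (i : Fin n) :
    edgeVec P i ≠ 0 := by
  rw [edgeVec, sub_ne_zero]
  exact fun h => hP.rotate_ne i (hP.injective h)

theorem IsSimplePolygon.edgeVec_norm_pos (hP : IsSimplePolygon P) (i : Fin n) :
    0 < ‖edgeVec P i‖ := norm_pos_iff.2 (hP.edgeVec_ne_zero i)

theorem IsSimplePolygon.norm_edgeNormal (hP : IsSimplePolygon P) (i : Fin n) :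
    ‖edgeNormal P i‖ = 1 := by
  have h' := hP.edgeVec_norm_pos i
  have : edgeNormal P i = ‖edgeVec P i‖⁻¹ • !₂[edgeVec P i 1, -edgeVec P i 0] := rfl
  have h2 : ‖(!₂[edgeVec P i 1, -edgeVec P i 0] : Plane)‖ = ‖edgeVec P i‖ := by
    rw [← sq_eq_sq₀ (norm_nonneg _) (norm_nonneg _), plane_norm_sq, plane_norm_sq]
    simp; ring
  rw [this, norm_smul, h2, norm_inv, norm_norm, inv_mul_cancel₀ h'.ne']

/-- Otherwise the two unit normals are opposite, so edge `j` folds back onto edge `i` and the two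
share points that are not endpoints. This makes the denominator of `mitre` legitimate. -/
theorem IsSimplePolygon.one_add_inner_ne_zero (hP : IsSimplePolygon P) (i : Fin n) :
    1 + (inner ℝ (edgeNormal P i) (edgeNormal P (finRotate n i)) : ℝ) ≠ 0 := by
  intro h
  set j := finRotate n i
  have hi := hP.edgeVec_norm_pos i
  have hj := hP.edgeVec_norm_pos j
  have h0 : edgeNormal P i + edgeNormal P j = 0 := by
    rw [← norm_eq_zero, ← sq_eq_zero_iff, norm_add_sq_real, hP.norm_edgeNormal,
      hP.norm_edgeNormal]
    linarith
  have hd : ‖edgeVec P i‖⁻¹ • edgeVec P i + ‖edgeVec P j‖⁻¹ • edgeVec P j = 0 := by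
    have e : ∀ k, edgeNormal P k = ‖edgeVec P k‖⁻¹ • !₂[edgeVec P k 1, -edgeVec P k 0] :=
      fun k => rfl
    rw [e, e] at h0
    ext k
    fin_cases k
    · have := congrArg (fun v : Plane => v 1) h0
      simp at this ⊢
      linarith
    · have := congrArg (fun v : Plane => v 0) h0
      simpa using this
  -- At distance `a`, half the shorter length, from the common vertex lies a point in the relative
  -- interior of both edges.
  set a := min (‖edgeVec P i‖) (‖edgeVec P j‖) / 2 with ha
  have ha0 : 0 < a := by positivity
  have hai : a < ‖edgeVec P i‖ := by
    have := min_le_left (‖edgeVec P i‖) (‖edgeVec P j‖); linarith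
  have haj : a < ‖edgeVec P j‖ := by
    have := min_le_right (‖edgeVec P i‖) (‖edgeVec P j‖); linarith
  have hx : P i + (1 - a / ‖edgeVec P i‖) • edgeVec P i =
      P j + (a / ‖edgeVec P j‖) • edgeVec P j := by
    have e : P j = P i + edgeVec P i := by simp [edgeVec, j]
    rw [e, ← sub_eq_zero]
    trans (-a) • (‖edgeVec P i‖⁻¹ • edgeVec P i + ‖edgeVec P j‖⁻¹ • edgeVec P j)
    · simp only [div_eq_mul_inv]; module
    · rw [hd, smul_zero]
  have hq : 0 < a / ‖edgeVec P i‖ ∧ a / ‖edgeVec P i‖ < 1 := ⟨by positivity, (div_lt_one hi).2 hai⟩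
  have hq' : 0 < a / ‖edgeVec P j‖ ∧ a / ‖edgeVec P j‖ < 1 := ⟨by positivity, (div_lt_one hj).2 haj⟩
  have := (hP.edges_meet i j (hP.rotate_ne i).symm _
    ⟨(mem_edgeSet_iff P i _).2 ⟨_, ⟨by linarith [hq.2], by linarith [hq.1]⟩, rfl⟩,
      (mem_edgeSet_iff P j _).2 ⟨_, ⟨hq'.1.le, hq'.2.le⟩, hx.symm⟩⟩).1
  rcases this with h1 | h1
  · rw [add_eq_left, smul_eq_zero] at h1
    rcases h1 with h1 | h1
    · linarith
    · exact hP.edgeVec_ne_zero i h1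
  · rw [hx, add_eq_left, smul_eq_zero] at h1
    rcases h1 with h1 | h1
    · linarith
    · exact hP.edgeVec_ne_zero j h1

/-- For unit vectors `u`, `v` the vector `(u + v) / (1 + ⟪u, v⟫)` has inner product 1 with both. A
vertex therefore moves with unit normal speed relative to each of its two edges. -/
theorem IsSimplePolygon.cross_mitre_rotate (hP : IsSimplePolygon P) (i : Fin n) :
    cross (mitre P (finRotate n i)) (edgeVec P i) = ‖edgeVec P i‖ := by
  rw [cross_edgeVec, mitre, inner_smul_left, inner_add_left, Equiv.symm_apply_apply,
    real_inner_self_eq_norm_sq, hP.norm_edgeNormal, real_inner_comm]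
  have := hP.one_add_inner_ne_zero i
  rw [real_inner_comm] at this
  simp only [RCLike.conj_to_real]
  field_simp

theorem IsSimplePolygon.cross_mitre (hP : IsSimplePolygon P) (i : Fin n) :
    cross (mitre P i) (edgeVec P i) = ‖edgeVec P i‖ := by
  rw [cross_edgeVec, mitre, inner_smul_left, inner_add_left,
    real_inner_self_eq_norm_sq, hP.norm_edgeNormal]
  have := hP.one_add_inner_ne_zero ((finRotate n).symm i)
  rw [Equiv.apply_symm_apply] at this
  simp only [RCLike.conj_to_real]
  field_simp
  ring

/-- The height of a point of the collar over the line of its edge. -/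
theorem IsSimplePolygon.cross_collar (hP : IsSimplePolygon P) (i : Fin n) (s t : ℝ) :
    cross (collar P i s t - P i) (edgeVec P i) = t * ‖edgeVec P i‖ := by
  rw [collar, add_assoc, add_sub_cancel_left, cross_add_left, cross_smul_left, cross_self,
    cross_smul_left, cross_add_left, cross_smul_left, cross_smul_left, hP.cross_mitre,
    hP.cross_mitre_rotate]
  ring

/-- The line through a vertex in the direction of its mitre separates the collars of the two
adjacent edges. This formula and `cross_mitre_collar` tell the side; the second factor is positive
for small `t` (`IsCollarWidth.cross_pos`), so the sign is decided by the edge parameter. -/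
theorem cross_mitre_collar_rotate (hP : IsSimplePolygon P) (i : Fin n) (s t : ℝ) :
    cross (mitre P (finRotate n i)) (collar P i s t - P (finRotate n i)) =
      -(1 - s) * (‖edgeVec P i‖ - t * cross (mitre P (finRotate n i)) (mitre P i)) := by
  have e : collar P i s t - P (finRotate n i) =
      (-(1 - s)) • edgeVec P i + t • ((1 - s) • mitre P i + s • mitre P (finRotate n i)) := by
    simp only [collar, edgeVec]; module
  rw [e, cross_add_right, cross_smul_right, cross_smul_right, cross_add_right, cross_smul_right,
    cross_smul_right, cross_self, hP.cross_mitre_rotate]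
  ring

theorem cross_mitre_collar (hP : IsSimplePolygon P) (i : Fin n) (s t : ℝ) :
    cross (mitre P i) (collar P i s t - P i) =
      s * (‖edgeVec P i‖ + t * cross (mitre P i) (mitre P (finRotate n i))) := by
  rw [collar, add_assoc, add_sub_cancel_left, cross_add_right, cross_smul_right, cross_smul_right,
    cross_add_right, cross_smul_right, cross_smul_right, cross_self, hP.cross_mitre]
  ring

variable (P) in
/-- A bound for the speed of the vertices. -/
def mitreBound : ℝ := ∑ i, ‖mitre P i‖

variable (P) in
theorem norm_mitre_le (i : Fin n) : ‖mitre P i‖ ≤ mitreBound P :=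
  Finset.single_le_sum (f := fun i => ‖mitre P i‖) (fun _ _ => norm_nonneg _) (Finset.mem_univ i)

variable (P) in
theorem mitreBound_nonneg : 0 ≤ mitreBound P := Finset.sum_nonneg fun _ _ => norm_nonneg _

variable (P) in
theorem norm_interp_mitre_le (i j : Fin n) {s : ℝ} (hs : s ∈ Icc (0 : ℝ) 1) :
    ‖(1 - s) • mitre P i + s • mitre P j‖ ≤ mitreBound P := by
  have hi := norm_mitre_le P i
  have hj := norm_mitre_le P j
  calc _ ≤ ‖(1 - s) • mitre P i‖ + ‖s • mitre P j‖ := norm_add_le _ _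
    _ = (1 - s) * ‖mitre P i‖ + s * ‖mitre P j‖ := by
      rw [norm_smul, norm_smul, Real.norm_of_nonneg hs.1, Real.norm_of_nonneg (by linarith [hs.2])]
    _ ≤ (1 - s) * mitreBound P + s * mitreBound P :=
      add_le_add (mul_le_mul_of_nonneg_left hi (by linarith [hs.2]))
        (mul_le_mul_of_nonneg_left hj hs.1)
    _ = _ := by ring

variable (P) in
theorem dist_collar_le (i : Fin n) {s : ℝ} (hs : s ∈ Icc (0 : ℝ) 1) (t t' : ℝ) :
    dist (collar P i s t) (collar P i s t') ≤ |t - t'| * mitreBound P := by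
  have e : collar P i s t - collar P i s t' =
      (t - t') • ((1 - s) • mitre P i + s • mitre P (finRotate n i)) := by
    simp only [collar]; module
  rw [dist_eq_norm, e, norm_smul, Real.norm_eq_abs]
  gcongr
  exact norm_interp_mitre_le P _ _ hs

variable (P) in
/-- Widths for which the collar is embedded. -/
structure IsCollarWidth (η : ℝ) : Prop where
  pos : 0 < η
  mitre_sub : ∀ i, η * ‖mitre P (finRotate n i) - mitre P i‖ < ‖edgeVec P i‖
  cross_mitre : ∀ i, η * |cross (mitre P i) (mitre P (finRotate n i))| < ‖edgeVec P i‖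
  far : ∀ i j, i ≠ j → j ≠ finRotate n i → i ≠ finRotate n j →
    ∀ x ∈ P.edgeSet ℝ i, ∀ y ∈ P.edgeSet ℝ j, η * (2 * mitreBound P) < dist x y

/-- Each condition bounds a multiple of `η` by a positive number, so finitely many of them hold
together for small `η`. They exclude, in turn, that a moved edge collapses, that collars of
consecutive edges cross their mitre line, and that collars of other pairs of edges meet. -/
theorem IsSimplePolygon.exists_collarWidth (hP : IsSimplePolygon P) :
    ∃ η, IsCollarWidth P η := by
  have h1 : ∀ᶠ η : ℝ in 𝓝[>] 0, ∀ i, η * ‖mitre P (finRotate n i) - mitre P i‖ < ‖edgeVec P i‖ :=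
    eventually_all.2 fun i => eventually_mul_lt _ (hP.edgeVec_norm_pos i)
  have h2 : ∀ᶠ η : ℝ in 𝓝[>] 0, ∀ i,
      η * |cross (mitre P i) (mitre P (finRotate n i))| < ‖edgeVec P i‖ :=
    eventually_all.2 fun i => eventually_mul_lt _ (hP.edgeVec_norm_pos i)
  have h3 : ∀ᶠ η : ℝ in 𝓝[>] 0, ∀ i j, i ≠ j → j ≠ finRotate n i → i ≠ finRotate n j →
      ∀ x ∈ P.edgeSet ℝ i, ∀ y ∈ P.edgeSet ℝ j, η * (2 * mitreBound P) < dist x y := by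
    refine eventually_all.2 fun i => eventually_all.2 fun j => ?_
    by_cases h : i ≠ j ∧ j ≠ finRotate n i ∧ i ≠ finRotate n j
    · have hd : Disjoint (P.edgeSet ℝ i) (P.edgeSet ℝ j) := by
        rw [Set.disjoint_left]
        intro x hx hy
        obtain ⟨a | a, b | b⟩ := hP.edges_meet i j h.1 x ⟨hx, hy⟩
        · exact h.1 (hP.injective (a.symm.trans b))
        · exact h.2.2 (hP.injective (a.symm.trans b))
        · exact h.2.1 (hP.injective (b.symm.trans a))
        · exact h.1 ((finRotate n).injective (hP.injective (a.symm.trans b)))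
      obtain ⟨r, hr, hr'⟩ := exists_pos_forall_le_dist (isCompact_edgeSet P i)
        (isCompact_edgeSet P j).isClosed hd
      filter_upwards [eventually_mul_lt (2 * mitreBound P) hr] with η hη _ _ _ x hx y hy
      exact hη.trans (hr' x hx y hy)
    · filter_upwards with η a b c
      exact absurd ⟨a, b, c⟩ h
  obtain ⟨η, h1, h2, h3, h4⟩ := (h1.and (h2.and (h3.and self_mem_nhdsWithin))).exists
  exact ⟨η, h4, h1, h2, h3⟩

theorem IsCollarWidth.cross_pos {η t : ℝ} (h : IsCollarWidth P η) (ht : |t| < η) (i : Fin n) :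
    0 < ‖edgeVec P i‖ + t * cross (mitre P i) (mitre P (finRotate n i)) := by
  have h1 := h.cross_mitre i
  have h2 : |t * cross (mitre P i) (mitre P (finRotate n i))| ≤
      η * |cross (mitre P i) (mitre P (finRotate n i))| := by
    rw [abs_mul]; gcongr
  linarith [neg_abs_le (t * cross (mitre P i) (mitre P (finRotate n i)))]

theorem IsCollarWidth.speed_ne_zero {η t : ℝ} (h : IsCollarWidth P η) (ht : |t| < η) (i : Fin n) :
    edgeVec P i + t • (mitre P (finRotate n i) - mitre P i) ≠ 0 := by
  intro h0
  have h1 := h.mitre_sub i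
  have h2 : ‖edgeVec P i‖ = |t| * ‖mitre P (finRotate n i) - mitre P i‖ := by
    rw [eq_neg_of_add_eq_zero_left h0, norm_neg, norm_smul, Real.norm_eq_abs]
  have h3 : |t| * ‖mitre P (finRotate n i) - mitre P i‖ ≤
      η * ‖mitre P (finRotate n i) - mitre P i‖ := by gcongr
  linarith

/-- The collar of a simple polygon is embedded. -/
theorem IsCollarWidth.collar_inj {η : ℝ} (h : IsCollarWidth P η) (hP : IsSimplePolygon P)
    {i j : Fin n} {s s' t t' : ℝ} (hs : s ∈ Icc (0 : ℝ) 1) (hs' : s' ∈ Icc (0 : ℝ) 1)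
    (ht : |t| < η) (ht' : |t'| < η) (heq : collar P i s t = collar P j s' t') :
    t = t' ∧ (i = j ∧ s = s' ∨ j = finRotate n i ∧ s = 1 ∧ s' = 0 ∨
      i = finRotate n j ∧ s' = 1 ∧ s = 0) := by
  -- Consecutive edges: the common point lies weakly on both sides of the mitre line, hence on it.
  -- This forces `s = 1` and `s' = 0`, and then comparing heights over edge `i` gives `t = t'`.
  have adj : ∀ {i : Fin n} {s s' t t' : ℝ}, s ∈ Icc (0 : ℝ) 1 → s' ∈ Icc (0 : ℝ) 1 →
      |t| < η → |t'| < η → collar P i s t = collar P (finRotate n i) s' t' →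
      t = t' ∧ s = 1 ∧ s' = 0 := by
    intro i s s' t t' hs hs' ht ht' heq
    have e1 := cross_mitre_collar_rotate hP i s t
    have e2 := cross_mitre_collar hP (finRotate n i) s' t'
    rw [heq, e2, cross_swap _ (mitre P i)] at e1
    have p1 := h.cross_pos ht i
    have p2 := h.cross_pos ht' (finRotate n i)
    set A := ‖edgeVec P (finRotate n i)‖ + t' * cross (mitre P (finRotate n i))
      (mitre P (finRotate n (finRotate n i)))
    have hB : ‖edgeVec P i‖ - t * -cross (mitre P i) (mitre P (finRotate n i)) =
      ‖edgeVec P i‖ + t * cross (mitre P i) (mitre P (finRotate n i)) := by ring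
    rw [hB] at e1
    set B := ‖edgeVec P i‖ + t * cross (mitre P i) (mitre P (finRotate n i))
    have q1 : 0 ≤ s' * A := mul_nonneg hs'.1 p2.le
    have q2 : 0 ≤ (1 - s) * B := mul_nonneg (by linarith [hs.2]) p1.le
    have z1 : s' * A = 0 := by linarith
    have z2 : (1 - s) * B = 0 := by linarith
    have y1 : s' = 0 := (mul_eq_zero.1 z1).resolve_right p2.ne'
    have y2 : s = 1 := by linarith [(mul_eq_zero.1 z2).resolve_right p1.ne']
    refine ⟨?_, y2, y1⟩
    have c1 := hP.cross_collar i s t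
    have c2 := hP.cross_collar i 1 t'
    rw [collar_one, ← y1, ← heq, c1] at c2
    exact mul_right_cancel₀ (hP.edgeVec_norm_pos i).ne' c2
  rcases eq_or_ne i j with rfl | hij
  · have c1 := hP.cross_collar i s t
    have c2 := hP.cross_collar i s' t'
    rw [heq, c2] at c1
    have htt : t = t' := (mul_right_cancel₀ (hP.edgeVec_norm_pos i).ne' c1).symm
    refine ⟨htt, Or.inl ⟨rfl, ?_⟩⟩
    subst htt
    have : (s - s') • (edgeVec P i + t • (mitre P (finRotate n i) - mitre P i)) = 0 := by
      rw [← sub_eq_zero] at heq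
      rw [← heq]; simp only [collar]; module
    exact sub_eq_zero.1 ((smul_eq_zero.1 this).resolve_right (h.speed_ne_zero ht i))
  · by_cases h1 : j = finRotate n i
    · subst h1
      obtain ⟨a, b, c⟩ := adj hs hs' ht ht' heq
      exact ⟨a, Or.inr (Or.inl ⟨rfl, b, c⟩)⟩
    · by_cases h2 : i = finRotate n j
      · subst h2
        obtain ⟨a, b, c⟩ := adj hs' hs ht' ht heq.symm
        exact ⟨a.symm, Or.inr (Or.inr ⟨rfl, b, c⟩)⟩
      · exfalso
        -- Edges without a common vertex: both base points are within `η * mitreBound P` of the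
        -- common point, against `far`.
        have hf := h.far i j hij h1 h2 _ ((mem_edgeSet_iff P i _).2 ⟨s, hs, rfl⟩) _
          ((mem_edgeSet_iff P j _).2 ⟨s', hs', rfl⟩)
        rw [← collar_zero, ← collar_zero] at hf
        have d1 := dist_collar_le P i hs 0 t
        have d2 := dist_collar_le P j hs' t' 0
        have d3 := dist_triangle4 (collar P i s 0) (collar P i s t) (collar P j s' t')
          (collar P j s' 0)
        rw [heq, dist_self] at d3
        rw [heq] at d1
        simp only [zero_sub, abs_neg, sub_zero] at d1 d2
        have hM := mitreBound_nonneg P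
        have g1 : |t| * mitreBound P ≤ η * mitreBound P := by gcongr
        have g2 : |t'| * mitreBound P ≤ η * mitreBound P := by gcongr
        linarith

theorem IsCollarWidth.isSimplePolygon_offset {η t : ℝ} (h : IsCollarWidth P η)
    (hP : IsSimplePolygon P) (ht : |t| < η) : IsSimplePolygon (offset P t) where
  three_le := hP.three_le
  injective i j hij := by
    have e : ∀ i, (offset P t).vertices i = collar P i 0 t := by
      intro i; simp [offset, collar]
    rw [e, e] at hij
    rcases (h.collar_inj hP (by simp) (by simp) ht ht hij).2 with h | h | h
    · exact h.1
    · exact absurd h.2.1 (by norm_num)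
    · exact absurd h.2.1 (by norm_num)
  edges_meet i j hij x hx := by
    obtain ⟨⟨s, hs, rfl⟩, s', hs', heq⟩ := And.imp (mem_edgeSet_iff _ i x).1
      (mem_edgeSet_iff _ j x).1 hx
    rw [collar_offset] at heq ⊢
    rw [collar_offset] at heq
    have e : ∀ i, (offset P t).vertices i = collar P i 0 t := by
      intro i; simp [offset, collar]
    rw [e, e, e, e]
    rcases (h.collar_inj hP hs hs' ht ht heq.symm).2 with h | h | h
    · exact absurd h.1 hij
    · obtain ⟨rfl, rfl, rfl⟩ := h
      rw [collar_one]
      simp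
    · obtain ⟨rfl, rfl, rfl⟩ := h
      simp

/-- Every boundary point has a neighbourhood inside the collar. -/
theorem IsCollarWidth.collar_mem_nhds {η : ℝ} (h : IsCollarWidth P η) (hP : IsSimplePolygon P)
    {y : Plane} (hy : y ∈ P.boundary ℝ) :
    ∀ᶠ x in 𝓝 y, ∃ i, ∃ s ∈ Icc (0 : ℝ) 1, ∃ t, |t| < η ∧ collar P i s t = x := by
  -- The collar map of one edge is inverted explicitly. The height `τ x` is the time, and the moved
  -- edge `g x` at that time is still parallel to `d`, so the edge parameter `σ x` is a quotient of
  -- inner products with `d`. Both depend continuously on `x` near the edge point. Here `s₀` may be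
  -- an endpoint and the interval may stick out of `[0, 1]`.
  have key : ∀ i, ∀ s₀ : ℝ, ∀ a b : ℝ, a < s₀ → s₀ < b →
      ∀ᶠ x in 𝓝 (P i + s₀ • edgeVec P i), ∃ s ∈ Ioo a b, ∃ t, |t| < η ∧ collar P i s t = x := by
    intro i s₀ a b ha hb
    set d := edgeVec P i with hd
    have hd0 : d ≠ 0 := hP.edgeVec_ne_zero i
    let τ : Plane → ℝ := fun x => cross (x - P i) d / ‖d‖
    let g : Plane → Plane := fun x => d + τ x • (mitre P (finRotate n i) - mitre P i)
    let σ : Plane → ℝ := fun x => (inner ℝ (x - P i - τ x • mitre P i) d : ℝ) / inner ℝ (g x) d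
    have hτc : Continuous τ :=
      ((continuous_cross_left d).comp (continuous_id.sub continuous_const)).div_const _
    have hgc : Continuous g := by fun_prop
    set y := P i + s₀ • d
    have hτy : τ y = 0 := by
      simp only [τ, y, add_sub_cancel_left, cross_smul_left, cross_self, mul_zero, zero_div]
    have hgy : g y = d := by simp [g, hτy]
    have hdd : (inner ℝ d d : ℝ) ≠ 0 := inner_self_ne_zero.2 hd0
    have hσy : σ y = s₀ := by
      simp only [σ, hgy, hτy, y, add_sub_cancel_left, zero_smul, sub_zero, inner_smul_left,
        RCLike.conj_to_real]
      field_simp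
    have hσc : ContinuousAt σ y := by
      refine ContinuousAt.div ?_ ?_ (by rw [hgy]; exact hdd)
      · fun_prop
      · fun_prop
    have e1 : ∀ᶠ x in 𝓝 y, σ x ∈ Ioo a b :=
      hσc.eventually (by rw [hσy]; exact Ioo_mem_nhds ha hb)
    have e2 : ∀ᶠ x in 𝓝 y, |τ x| < η :=
      hτc.abs.continuousAt.eventually_lt continuousAt_const (by rw [hτy, abs_zero]; exact h.pos)
    have e3 : ∀ᶠ x in 𝓝 y, (inner ℝ (g x) d : ℝ) ≠ 0 :=
      (by fun_prop : Continuous fun x => (inner ℝ (g x) d : ℝ)).continuousAt.eventually_ne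
        (by rw [hgy]; exact hdd)
    filter_upwards [e1, e2, e3] with x h1 h2 h3
    refine ⟨σ x, h1, τ x, h2, ?_⟩
    have hl : ‖d‖ ≠ 0 := norm_ne_zero_iff.2 hd0
    have hgd : cross (g x) d = 0 := by
      simp only [g, cross_add_left, cross_smul_left, cross_sub_left, cross_self]
      rw [hP.cross_mitre, hP.cross_mitre_rotate]; ring
    have hxd : cross (x - P i - τ x • mitre P i) d = 0 := by
      rw [cross_sub_left, cross_smul_left, hP.cross_mitre]
      simp only [τ]; field_simp; ring
    have q1 := eq_smul_of_cross_eq_zero hd0 hgd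
    have q2 := eq_smul_of_cross_eq_zero hd0 hxd
    have q3 : x - P i - τ x • mitre P i = σ x • g x := by
      rw [q1, q2, smul_smul, ← mul_div_assoc]
      congr 2
      simp only [σ]
      field_simp
    have : collar P i (σ x) (τ x) = P i + τ x • mitre P i + σ x • g x := by
      simp only [collar, g, ← hd]; module
    rw [this, ← q3]; abel
  obtain ⟨i, s₀, hs₀, rfl⟩ := (mem_boundary_iff P y).1 hy
  -- Near a vertex both charts apply, possibly with parameters beyond the edge. If `s ≥ 1` in the
  -- first chart, the mitre line shows `s' ≥ 0` in the second, so one of the charts gives a point of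
  -- the collar.
  have vertex : ∀ i, ∀ᶠ x in 𝓝 (P (finRotate n i)),
      ∃ i, ∃ s ∈ Icc (0 : ℝ) 1, ∃ t, |t| < η ∧ collar P i s t = x := by
    intro i
    have k1 := key i 1 0 2 (by norm_num) (by norm_num)
    have k2 := key (finRotate n i) 0 (-1) 1 (by norm_num) (by norm_num)
    rw [one_smul, edgeVec, add_sub_cancel] at k1
    rw [zero_smul, add_zero] at k2
    filter_upwards [k1, k2] with x ⟨s, hs, t, ht, hx⟩ ⟨s', hs', t', ht', hx'⟩
    rcases le_total s 1 with h1 | h1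
    · exact ⟨i, s, ⟨hs.1.le, h1⟩, t, ht, hx⟩
    · refine ⟨finRotate n i, s', ⟨?_, hs'.2.le⟩, t', ht', hx'⟩
      have e1 := cross_mitre_collar_rotate hP i s t
      have e2 := cross_mitre_collar hP (finRotate n i) s' t'
      have p1 := h.cross_pos ht i
      have p2 := h.cross_pos ht' (finRotate n i)
      rw [cross_swap _ (mitre P i), hx] at e1
      rw [hx', e1] at e2
      by_contra hneg
      have := mul_neg_of_neg_of_pos (not_le.1 hneg) p2
      have : 0 ≤ (s - 1) * (‖edgeVec P i‖ + t * cross (mitre P i) (mitre P (finRotate n i))) :=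
        mul_nonneg (by linarith) p1.le
      linarith
  rcases eq_or_lt_of_le hs₀.1 with h0 | h0
  · have := vertex ((finRotate n).symm i)
    rw [Equiv.apply_symm_apply] at this
    simpa [← h0] using this
  rcases eq_or_lt_of_le hs₀.2 with h1 | h1
  · have := vertex i
    rw [h1, one_smul, edgeVec, add_sub_cancel]
    exact this
  filter_upwards [key i s₀ 0 1 h0 h1] with x ⟨s, hs, t, ht, hx⟩
  exact ⟨i, s, ⟨hs.1.le, hs.2.le⟩, t, ht, hx⟩

end Collar

/-! ### The collar as a closed strip -/

section Strip
variable {n : ℕ} (P : Polygon Plane n)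

/-- The edges in cyclic order, starting with `i₀`. -/
def cyc (i₀ : Fin n) (k : ℤ) : Fin n := (finRotate n ^ k) i₀

theorem cyc_add_one (i₀ : Fin n) (k : ℤ) : cyc i₀ (k + 1) = finRotate n (cyc i₀ k) := by
  rw [cyc, cyc, add_comm, zpow_add, zpow_one, Equiv.Perm.mul_apply]

theorem cyc_zero (i₀ : Fin n) : cyc i₀ 0 = i₀ := by simp [cyc]

theorem exists_cyc_eq (hn : 3 ≤ n) (i₀ i : Fin n) : ∃ k, cyc i₀ k = i := by
  have hs : ∀ j : Fin n, finRotate n j ≠ j := fun j => by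
    rw [← Equiv.Perm.mem_support, support_finRotate_of_le (by linarith)]
    exact Finset.mem_univ _
  exact (isCycle_finRotate_of_le (by linarith)).sameCycle (hs i₀) (hs i)

/-- The collar, parametrized along the whole boundary. -/
def collarCurve (i₀ : Fin n) (u t : ℝ) : Plane :=
  plInterp (fun k => P (cyc i₀ k)) u + t • plInterp (fun k => mitre P (cyc i₀ k)) u

theorem collarCurve_add (i₀ : Fin n) (k : ℤ) {s : ℝ} (hs : s ∈ Icc (0 : ℝ) 1) (t : ℝ) :
    collarCurve P i₀ (k + s) t = collar P (cyc i₀ k) s t := by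
  rw [collarCurve, plInterp_intCast_add _ _ hs, plInterp_intCast_add _ _ hs, cyc_add_one, collar,
    edgeVec]
  module

theorem continuous_collarCurve (i₀ : Fin n) :
    Continuous fun p : ℝ × ℝ => collarCurve P i₀ p.1 p.2 :=
  ((continuous_plInterp _).comp continuous_fst).add
    (continuous_snd.smul ((continuous_plInterp _).comp continuous_fst))

/-- The part of the collar with heights in `T`. -/
def strip (T : Set ℝ) : Set Plane :=
  {x | ∃ i, ∃ s ∈ Icc (0 : ℝ) 1, ∃ t ∈ T, collar P i s t = x}

theorem collarCurve_eq (i₀ : Fin n) (u t : ℝ) :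
    collarCurve P i₀ u t = collar P (cyc i₀ ⌊u⌋) (Int.fract u) t := by
  rw [← collarCurve_add P i₀ ⌊u⌋ ⟨Int.fract_nonneg u, (Int.fract_lt_one u).le⟩,
    Int.floor_add_fract]

theorem collarCurve_mem_strip (i₀ : Fin n) (u : ℝ) {t : ℝ} {T : Set ℝ} (ht : t ∈ T) :
    collarCurve P i₀ u t ∈ strip P T :=
  ⟨_, _, ⟨Int.fract_nonneg u, (Int.fract_lt_one u).le⟩, t, ht, (collarCurve_eq P i₀ u t).symm⟩

/-- The strip is the continuous image of `ℝ × T` under `collarCurve`, because `finRotate` has a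
single cycle that visits all edges. -/
theorem isPreconnected_strip (hn : 3 ≤ n) {T : Set ℝ} (hT : IsPreconnected T) :
    IsPreconnected (strip P T) := by
  let i₀ : Fin n := ⟨0, by omega⟩
  have : strip P T = (fun p : ℝ × ℝ => collarCurve P i₀ p.1 p.2) '' (univ ×ˢ T) := by
    ext x
    constructor
    · rintro ⟨i, s, hs, t, ht, rfl⟩
      obtain ⟨k, rfl⟩ := exists_cyc_eq hn i₀ i
      exact ⟨(k + s, t), ⟨mem_univ _, ht⟩, collarCurve_add P i₀ k hs t⟩
    · rintro ⟨⟨u, t⟩, ⟨-, ht⟩, rfl⟩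
      exact collarCurve_mem_strip P i₀ u ht
  rw [this]
  exact (isPreconnected_univ.prod hT).image _ (continuous_collarCurve P i₀).continuousOn

variable {P}

theorem IsCollarWidth.collar_notMem_offset {η : ℝ} (h : IsCollarWidth P η) (hP : IsSimplePolygon P)
    {i : Fin n} {s t t' : ℝ} (hs : s ∈ Icc (0 : ℝ) 1) (ht : |t| < η) (ht' : |t'| < η)
    (hne : t ≠ t') : collar P i s t ∉ (offset P t').boundary ℝ := by
  rw [mem_boundary_offset_iff]
  rintro ⟨j, s', hs', heq⟩
  exact hne (h.collar_inj hP hs' hs ht' ht heq).1.symm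

theorem offset_zero : offset P 0 = P := by
  cases P; simp [offset]

theorem IsCollarWidth.collar_notMem_boundary {η : ℝ} (h : IsCollarWidth P η)
    (hP : IsSimplePolygon P) {i : Fin n} {s t : ℝ} (hs : s ∈ Icc (0 : ℝ) 1) (ht : |t| < η)
    (hne : t ≠ 0) : collar P i s t ∉ P.boundary ℝ := by
  have := h.collar_notMem_offset hP (i := i) hs ht (t' := 0) (by simpa using h.pos) hne
  rwa [offset_zero] at this

end Strip

/-! ### Winding numbers -/

/-- A vector of the plane as a complex number. -/
def toC (x : Plane) : ℂ := ⟨x 0, x 1⟩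

theorem toC_smul (r : ℝ) (x : Plane) : toC (r • x) = r * toC x := by
  apply Complex.ext <;> simp [toC]

theorem toC_eq_zero {x : Plane} : toC x = 0 ↔ x = 0 := by
  constructor
  · intro h
    have h0 := congrArg Complex.re h
    have h1 := congrArg Complex.im h
    ext k
    fin_cases k
    · exact h0
    · exact h1
  · rintro rfl
    apply Complex.ext <;> simp [toC]

theorem toC_injective : Function.Injective toC := by
  intro x y h
  have h0 := congrArg Complex.re h
  have h1 := congrArg Complex.im h
  ext k
  fin_cases k
  · exact h0
  · exact h1

theorem continuous_toC : Continuous toC := by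
  have : toC = fun x : Plane => ((x 0 : ℝ) : ℂ) + (x 1 : ℝ) * Complex.I := by
    ext x; apply Complex.ext <;> simp [toC]
  rw [this]; fun_prop

/-- The signed angle from `a` to `b`. -/
def viewAngle (a b : Plane) : ℝ := Complex.arg (toC b / toC a)

theorem toC_div_im (a b : Plane) : (toC b / toC a).im = cross a b / Complex.normSq (toC a) := by
  rw [Complex.div_im, cross]; simp only [toC]; ring

/-- If the quotient were a nonpositive real, `b` would be a nonpositive multiple of `a` and the
origin would lie between them. So the view angle of an edge is continuous off that edge. -/
theorem toC_div_mem_slitPlane {a b : Plane} (h : (0 : Plane) ∉ segment ℝ a b) :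
    toC b / toC a ∈ Complex.slitPlane := by
  have ha : toC a ≠ 0 := fun h0 => h (by rw [toC_eq_zero] at h0; subst h0; exact left_mem_segment _ _ _)
  rw [Complex.mem_slitPlane_iff]
  by_contra! hc
  obtain ⟨h1, h2⟩ := hc
  set r := (toC b / toC a).re
  have hb : b = r • a := by
    apply toC_injective
    rw [toC_smul]
    have : toC b / toC a = (r : ℂ) := Complex.ext (by simp [r]) (by simpa using h2)
    rw [← this, div_mul_cancel₀ _ ha]
  apply h
  have hr : 0 < 1 - r := by linarith
  refine ⟨-r / (1 - r), 1 / (1 - r), div_nonneg (by linarith) hr.le, by positivity, ?_, ?_⟩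
  · field_simp; ring
  · rw [hb, smul_smul, ← add_smul]
    convert zero_smul ℝ a
    field_simp; ring

section Winding
variable {n : ℕ}

/-- The winding number of a closed polygon around a point off the polygon. -/
def wind (Q : Polygon Plane n) (x : Plane) : ℝ :=
  (∑ i, viewAngle (Q i - x) (Q (finRotate n i) - x)) / (2 * Real.pi)

theorem zero_notMem_segment_sub {Q : Polygon Plane n} {x : Plane} (i : Fin n)
    (hx : x ∉ Q.edgeSet ℝ i) : (0 : Plane) ∉ segment ℝ (Q i - x) (Q (finRotate n i) - x) := by
  rintro ⟨a, b, ha, hb, hab, h⟩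
  apply hx
  rw [edgeSet_eq_segment]
  refine ⟨a, b, ha, hb, hab, ?_⟩
  rw [← sub_eq_zero, ← h]
  calc _ = a • Q i + b • Q (finRotate n i) - (1 : ℝ) • x := by rw [one_smul]
    _ = _ := by rw [← hab]; module

/-- The quotients of successive view vectors multiply to 1 around the cycle, so the sum of their
arguments is a multiple of `2π`. -/
theorem exists_wind_eq_intCast {Q : Polygon Plane n} {x : Plane} (hx : x ∉ Q.boundary ℝ) :
    ∃ k : ℤ, wind Q x = k := by
  have hz : ∀ i, toC (Q i - x) ≠ 0 := by
    intro i h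
    rw [toC_eq_zero, sub_eq_zero] at h
    exact hx ((mem_boundary_iff Q x).2 ⟨i, 0, by simp, by simp [h]⟩)
  have h1 : ∏ i, toC (Q (finRotate n i) - x) / toC (Q i - x) = 1 := by
    rw [Finset.prod_div_distrib, Equiv.prod_comp (finRotate n) fun i => toC (Q i - x)]
    exact div_self (Finset.prod_ne_zero_iff.2 fun i _ => hz i)
  have h2 : Complex.exp ((∑ i, viewAngle (Q i - x) (Q (finRotate n i) - x) : ℝ) * Complex.I) =
      1 := by
    rw [Complex.ofReal_sum, Finset.sum_mul, Complex.exp_sum]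
    have e : ∀ i, Complex.exp ((viewAngle (Q i - x) (Q (finRotate n i) - x) : ℝ) * Complex.I) =
        (toC (Q (finRotate n i) - x) / toC (Q i - x)) /
          ‖toC (Q (finRotate n i) - x) / toC (Q i - x)‖ := by
      intro i
      rw [eq_div_iff (by simpa using ⟨hz _, hz _⟩), mul_comm]
      exact Complex.norm_mul_exp_arg_mul_I _
    simp only [e]
    rw [Finset.prod_div_distrib, h1, ← Complex.ofReal_prod, ← norm_prod, h1]
    simp
  obtain ⟨k, hk⟩ := Complex.exp_eq_one_iff.1 h2
  refine ⟨k, ?_⟩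
  have : ((∑ i, viewAngle (Q i - x) (Q (finRotate n i) - x) : ℝ) : ℂ) = (k * (2 * Real.pi) : ℝ) := by
    apply mul_right_cancel₀ Complex.I_ne_zero
    rw [hk]; push_cast; ring
  rw [wind, Complex.ofReal_injective this]
  field_simp

theorem continuousAt_viewAngle {α : Type*} [TopologicalSpace α] {f g : α → Plane} {a : α}
    (hf : ContinuousAt f a) (hg : ContinuousAt g a) (h : (0 : Plane) ∉ segment ℝ (f a) (g a)) :
    ContinuousAt (fun x => viewAngle (f x) (g x)) a := by
  have ha : toC (f a) ≠ 0 := fun h0 =>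
    h (by rw [toC_eq_zero] at h0; rw [h0]; exact left_mem_segment _ _ _)
  exact (Complex.continuousAt_arg (toC_div_mem_slitPlane h)).comp
    (f := fun x => toC (g x) / toC (f x))
    ((continuous_toC.continuousAt.comp hg).div (continuous_toC.continuousAt.comp hf) ha)

/-- The winding number is constant in connected families that avoid the boundary. -/
theorem wind_eq_of_isPreconnected {α : Type*} [TopologicalSpace α] {S : Set α}
    (hS : IsPreconnected S) {Q : α → Polygon Plane n} {x : α → Plane}
    (hQ : ∀ i, Continuous fun a => Q a i) (hx : Continuous x)
    (hoff : ∀ a ∈ S, x a ∉ (Q a).boundary ℝ) {a b : α} (ha : a ∈ S) (hb : b ∈ S) :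
    wind (Q a) (x a) = wind (Q b) (x b) := by
  have hc : ContinuousOn (fun a => wind (Q a) (x a)) S := by
    intro a ha
    refine ContinuousAt.continuousWithinAt ?_
    refine ContinuousAt.div_const (tendsto_finsetSum _ fun i _ => ?_) _
    refine continuousAt_viewAngle ((hQ _).continuousAt.sub hx.continuousAt)
      ((hQ _).continuousAt.sub hx.continuousAt) (zero_notMem_segment_sub i fun h => ?_)
    exact hoff a ha (mem_iUnion.2 ⟨i, h⟩)
  have key : ∀ a ∈ S, ∀ b ∈ S, ¬ wind (Q a) (x a) < wind (Q b) (x b) := by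
    intro a ha b hb hlt
    obtain ⟨k, hk⟩ := exists_wind_eq_intCast (hoff a ha)
    obtain ⟨l, hl⟩ := exists_wind_eq_intCast (hoff b hb)
    have hkl : k < l := by rw [hk, hl] at hlt; exact_mod_cast hlt
    have hkl' : (k : ℝ) + 1 ≤ l := by exact_mod_cast hkl
    -- Two different integer values would force the non-integer value `k + 1/2` in between.
    obtain ⟨c, hc, hc'⟩ := hS.intermediate_value ha hb hc
      (show (k : ℝ) + 1 / 2 ∈ Icc _ _ from ⟨by rw [hk]; linarith, by rw [hl]; linarith⟩)
    obtain ⟨m, hm⟩ := exists_wind_eq_intCast (hoff c hc)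
    simp only [hm] at hc'
    have h1 : (k : ℝ) < m := by linarith
    have h2 : (m : ℝ) < k + 1 := by linarith
    have h1' : k < m := by exact_mod_cast h1
    have h2' : m < k + 1 := by exact_mod_cast h2
    omega
  exact le_antisymm (not_lt.1 (key b hb a ha)) (not_lt.1 (key a ha b hb))

theorem wind_eq_of_mem {Q : Polygon Plane n} {S : Set Plane} (hS : IsPreconnected S)
    (hoff : S ⊆ (Q.boundary ℝ)ᶜ) {x y : Plane} (hx : x ∈ S) (hy : y ∈ S) :
    wind Q x = wind Q y :=
  wind_eq_of_isPreconnected (Q := fun _ => Q) (x := id) hS (fun _ => continuous_const)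
    continuous_id hoff hx hy

theorem arg_div_of_re_pos {u v : ℂ} (hu : 0 < u.re) (hv : 0 < v.re) :
    Complex.arg (u / v) = Complex.arg u - Complex.arg v := by
  have hu' := abs_lt.1 (Complex.abs_arg_lt_pi_div_two_iff.2 (Or.inl hu))
  have hv' := abs_lt.1 (Complex.abs_arg_lt_pi_div_two_iff.2 (Or.inl hv))
  have hu0 : u ≠ 0 := by rintro rfl; simp at hu
  have hv0 : v ≠ 0 := by rintro rfl; simp at hv
  have hi : Complex.arg v⁻¹ = -Complex.arg v := by
    rw [Complex.arg_inv, if_neg]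
    have := Real.pi_pos
    intro h; linarith
  rw [div_eq_mul_inv, (Complex.arg_mul_eq_add_arg_iff hu0 (inv_ne_zero hv0)).2, hi, sub_eq_add_neg]
  rw [hi]
  constructor <;> linarith

/-- From `x` all vertices are seen within the open half-plane around the direction `-x`. Multiplying
by the conjugate of `-x` turns it into the right half-plane, where the argument has no jump and the
sum telescopes. -/
theorem wind_eq_zero_of_norm_lt {Q : Polygon Plane n} {x : Plane} (h : ∀ i, ‖Q i‖ < ‖x‖) :
    wind Q x = 0 := by
  let u : Fin n → ℂ := fun i => toC (Q i - x) * (starRingEnd ℂ) (toC (-x))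
  have hu : ∀ i, 0 < (u i).re := by
    intro i
    have h1 : (u i).re = ‖x‖ ^ 2 - inner ℝ (Q i) x := by
      rw [plane_norm_sq, plane_inner]
      simp [u, toC]; ring
    rw [h1]
    have := real_inner_le_norm (Q i) x
    nlinarith [h i, norm_nonneg (Q i)]
  have hx : (starRingEnd ℂ) (toC (-x)) ≠ 0 ∨ IsEmpty (Fin n) := by
    rcases isEmpty_or_nonempty (Fin n) with he | ⟨⟨i⟩⟩
    · exact Or.inr he
    · left
      intro h0
      have := hu i
      simp [u, h0] at this
  rcases hx with hx | he
  · have e : ∀ i, viewAngle (Q i - x) (Q (finRotate n i) - x) =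
        Complex.arg (u (finRotate n i)) - Complex.arg (u i) := by
      intro i
      rw [← arg_div_of_re_pos (hu _) (hu _), mul_div_mul_right _ _ hx, viewAngle]
    rw [wind]
    simp only [e]
    rw [Finset.sum_sub_distrib, Equiv.sum_comp (finRotate n) fun i => Complex.arg (u i)]
    simp
  · simp [wind]

/-- A radius beyond which winding numbers vanish. -/
def farRadius (Q : Polygon Plane n) : ℝ := ∑ i, ‖Q i‖

theorem norm_vertex_le_farRadius (Q : Polygon Plane n) (i : Fin n) : ‖Q i‖ ≤ farRadius Q :=
  Finset.single_le_sum (f := fun i => ‖Q i‖) (fun _ _ => norm_nonneg _) (Finset.mem_univ i)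

theorem norm_le_farRadius {Q : Polygon Plane n} {x : Plane} (hx : x ∈ Q.boundary ℝ) :
    ‖x‖ ≤ farRadius Q := by
  obtain ⟨i, hi⟩ := mem_iUnion.1 hx
  rw [edgeSet_eq_segment] at hi
  have := (convex_closedBall (0 : Plane) (farRadius Q)).segment_subset
    (mem_closedBall_zero_iff.2 (norm_vertex_le_farRadius Q i))
    (mem_closedBall_zero_iff.2 (norm_vertex_le_farRadius Q (finRotate n i))) hi
  exact mem_closedBall_zero_iff.1 this

theorem wind_eq_zero_of_far {Q : Polygon Plane n} {x : Plane} (h : farRadius Q < ‖x‖) :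
    wind Q x = 0 :=
  wind_eq_zero_of_norm_lt fun i => (norm_vertex_le_farRadius Q i).trans_lt h

/-- The winding number is constant on the component of `x` and vanishes beyond `farRadius Q`, so
this component is bounded. The converse needs simplicity and is part of
`IsSimplePolygon.exists_outerSide`. -/
theorem mem_polygonInterior_of_wind_ne_zero {Q : Polygon Plane n} {x : Plane}
    (hx : x ∉ Q.boundary ℝ) (h : wind Q x ≠ 0) : x ∈ polygonInterior Q := by
  refine ⟨hx, (Metric.isBounded_closedBall (x := (0 : Plane)) (r := farRadius Q)).subset ?_⟩
  intro y hy
  rw [mem_closedBall_zero_iff]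
  by_contra hc
  apply h
  rw [wind_eq_of_mem isPreconnected_connectedComponentIn (connectedComponentIn_subset _ _)
    (mem_connectedComponentIn (show x ∈ (Q.boundary ℝ)ᶜ from hx)) hy]
  exact wind_eq_zero_of_far (not_le.1 hc)

theorem notMem_polygonInterior_of_unbounded {Q : Polygon Plane n} {S : Set Plane}
    (hS : IsPreconnected S) (hoff : S ⊆ (Q.boundary ℝ)ᶜ) (hb : ¬ Bornology.IsBounded S) {x : Plane}
    (hx : x ∈ S) : x ∉ polygonInterior Q := fun h =>
  hb (h.2.subset (hS.subset_connectedComponentIn hx hoff))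

end Winding

/-! ### The two sides of a simple polygon and the inflated polygon -/

section Sides
variable {n : ℕ} {P : Polygon Plane n}

theorem continuous_collar (i : Fin n) (s : ℝ) : Continuous fun t => collar P i s t := by
  unfold collar; fun_prop

theorem IsSimplePolygon.edge_interior_notMem (hP : IsSimplePolygon P) {i j : Fin n} (hij : i ≠ j)
    {s : ℝ} (hs : s ∈ Ioo (0 : ℝ) 1) : P i + s • edgeVec P i ∉ P.edgeSet ℝ j := by
  intro h
  have := (hP.edges_meet i j hij _ ⟨(mem_edgeSet_iff P i _).2 ⟨s, ⟨hs.1.le, hs.2.le⟩, rfl⟩, h⟩).1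
  rcases this with h1 | h1
  · rw [add_eq_left, smul_eq_zero] at h1
    exact h1.elim hs.1.ne' (hP.edgeVec_ne_zero i)
  · have : (1 - s) • edgeVec P i = 0 := by
      rw [← sub_eq_zero] at h1
      rw [← neg_eq_zero, ← h1]
      simp only [edgeVec]; module
    rw [smul_eq_zero] at this
    exact this.elim (fun h => by linarith [hs.2]) (hP.edgeVec_ne_zero i)

theorem tendsto_collar (i : Fin n) (s ρ : ℝ) :
    Tendsto (fun t => collar P i s (ρ * t)) (𝓝[>] 0) (𝓝 (P i + s • edgeVec P i)) := by
  have : Continuous fun t => collar P i s (ρ * t) :=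
    (continuous_collar i s).comp (continuous_const.mul continuous_id)
  simpa [collar_zero] using this.continuousWithinAt.tendsto (x := (0 : ℝ)) (s := Ioi 0)

/-- The winding numbers on the two sides of a simple polygon differ by one. -/
theorem IsCollarWidth.wind_jump {η : ℝ} (h : IsCollarWidth P η) (hP : IsSimplePolygon P)
    {x y : Plane} (hx : x ∈ strip P (Ioo 0 η)) (hy : y ∈ strip P (Ioo (-η) 0)) :
    wind P y = wind P x + 1 := by
  have hn := hP.three_le
  have off1 : strip P (Ioo 0 η) ⊆ (P.boundary ℝ)ᶜ := by
    rintro _ ⟨i, s, hs, t, ht, rfl⟩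
    exact h.collar_notMem_boundary hP hs (abs_lt.2 ⟨by linarith [ht.1, h.pos], ht.2⟩) ht.1.ne'
  have off2 : strip P (Ioo (-η) 0) ⊆ (P.boundary ℝ)ᶜ := by
    rintro _ ⟨i, s, hs, t, ht, rfl⟩
    exact h.collar_notMem_boundary hP hs (abs_lt.2 ⟨ht.1, by linarith [ht.2, h.pos]⟩) ht.2.ne
  let i : Fin n := ⟨0, by omega⟩
  have hhalf : (1 / 2 : ℝ) ∈ Icc (0 : ℝ) 1 := by constructor <;> norm_num
  let x' : ℝ → Plane := fun t => collar P i (1 / 2) t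
  have hx'c : Continuous x' := continuous_collar i _
  have hd := hP.edgeVec_norm_pos i
  have hx'0 : x' 0 = P i + (1 / 2 : ℝ) • edgeVec P i := collar_zero P i _
  -- The point `x' t` crosses the boundary at the midpoint of edge `i`. There the two ends of the
  -- edge are seen in opposite directions, so `q` tends to -1, from below for `t > 0` and from above
  -- for `t < 0`. The angle of edge `i` tends to `-π` and `π`; the other angles are continuous at `t
  -- = 0`.
  let q : ℝ → ℂ := fun t => toC (P (finRotate n i) - x' t) / toC (P i - x' t)
  have hden : toC (P i - x' 0) ≠ 0 := by
    rw [Ne, toC_eq_zero, hx'0, sub_add_cancel_left, neg_eq_zero, smul_eq_zero]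
    simpa using hP.edgeVec_ne_zero i
  have hq0 : q 0 = -1 := by
    have e : P (finRotate n i) - x' 0 = (-1 : ℝ) • (P i - x' 0) := by
      rw [hx'0]; simp only [edgeVec]; module
    simp only [q]
    rw [e, toC_smul, mul_div_assoc, div_self hden]; simp
  have hqc : ContinuousAt q 0 :=
    ContinuousAt.div (continuous_toC.continuousAt.comp (by fun_prop))
      (continuous_toC.continuousAt.comp (by fun_prop)) hden
  have hqim : ∀ t, (q t).im = -(t * ‖edgeVec P i‖) / Complex.normSq (toC (P i - x' t)) := by
    intro t
    rw [toC_div_im]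
    congr 1
    have e : P (finRotate n i) - x' t = (P i - x' t) + edgeVec P i := by
      simp only [edgeVec]; abel
    rw [e, cross_add_right, cross_self, zero_add, ← hP.cross_collar i (1 / 2) t, ← cross_neg_left,
      neg_sub]
  have hden' : ∀ᶠ t in 𝓝 (0 : ℝ), 0 < Complex.normSq (toC (P i - x' t)) := by
    have : ContinuousAt (fun t => toC (P i - x' t)) 0 :=
      continuous_toC.continuousAt.comp (by fun_prop)
    filter_upwards [this.eventually_ne hden] with t ht
    exact Complex.normSq_pos.2 ht
  have lim1 : Tendsto (fun t => viewAngle (P i - x' t) (P (finRotate n i) - x' t)) (𝓝[>] 0)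
      (𝓝 (-Real.pi)) := by
    have := Complex.tendsto_arg_nhdsWithin_im_neg_of_re_neg_of_im_zero
      (z := -1) (by simp) (by simp)
    refine this.comp (f := q) (tendsto_nhdsWithin_iff.2 ⟨?_, ?_⟩)
    · rw [← hq0]; exact hqc.mono_left nhdsWithin_le_nhds
    · filter_upwards [self_mem_nhdsWithin, hden'.filter_mono nhdsWithin_le_nhds] with t ht ht'
      rw [hqim]
      exact div_neg_of_neg_of_pos (neg_neg_of_pos (mul_pos ht hd)) ht'
  have lim2 : Tendsto (fun t => viewAngle (P i - x' t) (P (finRotate n i) - x' t)) (𝓝[<] 0)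
      (𝓝 Real.pi) := by
    have := Complex.tendsto_arg_nhdsWithin_im_nonneg_of_re_neg_of_im_zero
      (z := -1) (by simp) (by simp)
    refine this.comp (f := q) (tendsto_nhdsWithin_iff.2 ⟨?_, ?_⟩)
    · rw [← hq0]; exact hqc.mono_left nhdsWithin_le_nhds
    · filter_upwards [self_mem_nhdsWithin, hden'.filter_mono nhdsWithin_le_nhds] with t ht ht'
      rw [hqim]
      exact div_nonneg (neg_nonneg.2 (mul_nonpos_of_nonpos_of_nonneg (le_of_lt ht) hd.le)) ht'.le
  let r : ℝ → ℝ := fun t => ∑ j ∈ Finset.univ.erase i,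
    viewAngle (P j - x' t) (P (finRotate n j) - x' t)
  have hr : ContinuousAt r 0 := by
    refine tendsto_finsetSum _ fun j hj => ?_
    refine continuousAt_viewAngle (by fun_prop) (by fun_prop) (zero_notMem_segment_sub j ?_)
    rw [hx'0]
    exact hP.edge_interior_notMem (Finset.ne_of_mem_erase hj).symm ⟨by norm_num, by norm_num⟩
  have hw : ∀ t, wind P (x' t) = (r t + viewAngle (P i - x' t) (P (finRotate n i) - x' t)) /
      (2 * Real.pi) := by
    intro t
    rw [wind, ← Finset.sum_erase_add _ _ (Finset.mem_univ i)]
  have e1 : wind P x = (r 0 + -Real.pi) / (2 * Real.pi) := by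
    -- The winding number is constant along the strip, so it equals its one-sided limit at the
    -- midpoint.
    refine tendsto_nhds_unique (f := fun t => wind P (x' t)) (l := 𝓝[>] (0 : ℝ)) ?_ ?_
    · refine tendsto_const_nhds.congr' ?_
      filter_upwards [Ioo_mem_nhdsGT h.pos] with t ht
      exact wind_eq_of_mem (isPreconnected_strip P hn isPreconnected_Ioo) off1 hx
        ⟨i, _, hhalf, t, ht, rfl⟩
    · simp only [hw]
      exact ((hr.mono_left nhdsWithin_le_nhds).add lim1).div_const _
  have e2 : wind P y = (r 0 + Real.pi) / (2 * Real.pi) := by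
    refine tendsto_nhds_unique (f := fun t => wind P (x' t)) (l := 𝓝[<] (0 : ℝ)) ?_ ?_
    · refine tendsto_const_nhds.congr' ?_
      filter_upwards [Ioo_mem_nhdsLT (neg_neg_of_pos h.pos)] with t ht
      exact wind_eq_of_mem (isPreconnected_strip P hn isPreconnected_Ioo) off2 hy
        ⟨i, _, hhalf, t, ht, rfl⟩
    · simp only [hw]
      exact ((hr.mono_left nhdsWithin_le_nhds).add lim2).div_const _
  rw [e1, e2]
  have := Real.pi_pos
  field_simp; ring

/-- Every point off the boundary can be joined with the collar off the boundary. -/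
theorem IsCollarWidth.exists_join {η : ℝ} (h : IsCollarWidth P η) (hP : IsSimplePolygon P)
    {x : Plane} (hx : x ∉ P.boundary ℝ) :
    ∃ S, IsPreconnected S ∧ S ⊆ (P.boundary ℝ)ᶜ ∧ x ∈ S ∧
      ∃ z ∈ S, z ∈ strip P (Ioo 0 η) ∨ z ∈ strip P (Ioo (-η) 0) := by
  have hn := hP.three_le
  have hne : (P.boundary ℝ).Nonempty := ⟨P ⟨0, by omega⟩, (mem_boundary_iff P _).2
    ⟨⟨0, by omega⟩, 0, by simp, by simp⟩⟩
  -- The segment from `x` to a nearest boundary point meets the boundary only at its end, near which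
  -- it lies in the collar.
  obtain ⟨y, hy, hyd⟩ := (isCompact_boundary P).exists_infDist_eq_dist hne x
  have hxy : 0 < dist x y := dist_pos.2 (fun e => hx (e ▸ hy))
  let f : ℝ → Plane := fun τ => x + τ • (y - x)
  have hf : Continuous f := by fun_prop
  have hoff : f '' Ico 0 1 ⊆ (P.boundary ℝ)ᶜ := by
    rintro _ ⟨τ, hτ, rfl⟩ hm
    have h1 := Metric.infDist_le_dist_of_mem (x := x) hm
    have h2 : dist x (f τ) = τ * dist x y := by
      simp only [f, dist_self_add_right, norm_smul, Real.norm_of_nonneg hτ.1]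
      rw [dist_comm x y, dist_eq_norm]
    rw [hyd, h2] at h1
    nlinarith [hτ.2]
  have hf1 : f 1 = y := by simp [f]
  have hev : ∀ᶠ τ in 𝓝[<] (1 : ℝ),
      ∃ i, ∃ s ∈ Icc (0 : ℝ) 1, ∃ t, |t| < η ∧ collar P i s t = f τ := by
    have := hf.continuousAt.tendsto.mono_left (nhdsWithin_le_nhds (a := (1 : ℝ)) (s := Iio 1))
    rw [hf1] at this
    exact this.eventually (h.collar_mem_nhds hP hy)
  obtain ⟨τ, ⟨i, s, hs, t, ht, he⟩, hτ⟩ := (hev.and (Ioo_mem_nhdsLT (zero_lt_one' ℝ))).exists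
  refine ⟨f '' Ico 0 1, isPreconnected_Ico.image _ hf.continuousOn, hoff,
    ⟨0, by simp, by simp [f]⟩, f τ, ⟨τ, ⟨hτ.1.le, hτ.2⟩, rfl⟩, ?_⟩
  have ht0 : t ≠ 0 := by
    rintro rfl
    refine hoff ⟨τ, ⟨hτ.1.le, hτ.2⟩, he.symm⟩ ?_
    rw [collar_zero]
    exact (mem_boundary_iff P _).2 ⟨i, s, hs, rfl⟩
  rcases lt_or_gt_of_ne ht0 with h0 | h0
  · exact Or.inr ⟨i, s, hs, t, ⟨(abs_lt.1 ht).1, h0⟩, he⟩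
  · exact Or.inl ⟨i, s, hs, t, ⟨h0, (abs_lt.1 ht).2⟩, he⟩

variable (P) in
/-- The side `σ` (a sign) of the collar is outside of the polygon, the other side is inside, and
the interior consists of the points around which the polygon winds. -/
structure IsOuterSide (η σ : ℝ) : Prop extends IsCollarWidth P η where
  sign : σ = 1 ∨ σ = -1
  wind_outer : ∀ i, ∀ s ∈ Icc (0 : ℝ) 1, ∀ t ∈ Ioo 0 η, wind P (collar P i s (σ * t)) = 0
  wind_inner : ∀ i, ∀ s ∈ Icc (0 : ℝ) 1, ∀ t ∈ Ioo 0 η, wind P (collar P i s (-(σ * t))) ≠ 0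
  interior_iff : ∀ x ∉ P.boundary ℝ, (x ∈ polygonInterior P ↔ wind P x ≠ 0)

/-- A point far away has winding number 0 and can be joined to one of the strips, which is declared
the outer one; by the jump, the winding number on the other is nonzero. A point with winding number
0 can then only be joined to the outer strip. Through this strip it is connected to points
arbitrarily far away, so it is not in the interior. -/
theorem IsSimplePolygon.exists_outerSide (hP : IsSimplePolygon P) :
    ∃ η σ, IsOuterSide P η σ := by
  have hn := hP.three_le
  obtain ⟨η, h⟩ := hP.exists_collarWidth
  have off1 : strip P (Ioo 0 η) ⊆ (P.boundary ℝ)ᶜ := by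
    rintro _ ⟨i, s, hs, t, ht, rfl⟩
    exact h.collar_notMem_boundary hP hs (abs_lt.2 ⟨by linarith [ht.1, h.pos], ht.2⟩) ht.1.ne'
  have off2 : strip P (Ioo (-η) 0) ⊆ (P.boundary ℝ)ᶜ := by
    rintro _ ⟨i, s, hs, t, ht, rfl⟩
    exact h.collar_notMem_boundary hP hs (abs_lt.2 ⟨ht.1, by linarith [ht.2, h.pos]⟩) ht.2.ne
  have pre1 := isPreconnected_strip P hn (isPreconnected_Ioo (a := 0) (b := η))
  have pre2 := isPreconnected_strip P hn (isPreconnected_Ioo (a := -η) (b := 0))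
  have far_off : ∀ x, farRadius P < ‖x‖ → x ∉ P.boundary ℝ := fun x hx hb =>
    absurd (norm_le_farRadius hb) (not_le.2 hx)
  -- the two strips, the outer one first
  have main : ∀ A B : Set Plane, IsPreconnected A → A ⊆ (P.boundary ℝ)ᶜ →
      (∀ x ∉ P.boundary ℝ, ∃ S, IsPreconnected S ∧ S ⊆ (P.boundary ℝ)ᶜ ∧ x ∈ S ∧
        ∃ z ∈ S, z ∈ A ∨ z ∈ B) → (∀ z ∈ B, wind P z ≠ 0) →
      ∀ x ∉ P.boundary ℝ, (x ∈ polygonInterior P ↔ wind P x ≠ 0) := by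
    intro A B hA hAoff hjoin hB x hx
    refine ⟨fun hint h0 => ?_, mem_polygonInterior_of_wind_ne_zero hx⟩
    have comp : ∀ x ∉ P.boundary ℝ, wind P x = 0 → ∃ S, IsPreconnected S ∧
        S ⊆ (P.boundary ℝ)ᶜ ∧ x ∈ S ∧ (S ∩ A).Nonempty := by
      intro x hx h0
      obtain ⟨S, h1, h2, h3, z, hz, hz'⟩ := hjoin x hx
      refine ⟨S, h1, h2, h3, z, hz, hz'.resolve_right fun hzB => hB z hzB ?_⟩
      rw [← h0]
      exact wind_eq_of_mem h1 h2 hz h3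
    obtain ⟨S, h1, h2, h3, h4⟩ := comp x hx h0
    obtain ⟨C, hC⟩ := hint.2.exists_norm_le
    obtain ⟨y, hy⟩ := NormedSpace.exists_lt_norm ℝ Plane (max C (farRadius P))
    have hyf := (le_max_right _ _).trans_lt hy
    obtain ⟨S', h1', h2', h3', h4'⟩ := comp y (far_off y hyf) (wind_eq_zero_of_far hyf)
    have hU : IsPreconnected (S ∪ A) := h1.union' h4 hA
    have hU' : IsPreconnected ((S ∪ A) ∪ S') :=
      hU.union' (by obtain ⟨z, hz⟩ := h4'; exact ⟨z, Or.inr hz.2, hz.1⟩) h1'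
    have := hU'.subset_connectedComponentIn (Or.inl (Or.inl h3))
      (union_subset (union_subset h2 hAoff) h2') (Or.inr h3' : y ∈ _)
    exact absurd (hC y this) (not_le.2 ((le_max_left _ _).trans_lt hy))
  obtain ⟨x₀, hx₀⟩ := NormedSpace.exists_lt_norm ℝ Plane (farRadius P)
  obtain ⟨S, h1, h2, h3, z, hz, hz'⟩ := h.exists_join hP (far_off x₀ hx₀)
  have hz0 : wind P z = 0 := by
    rw [← wind_eq_zero_of_far hx₀]
    exact wind_eq_of_mem h1 h2 hz h3
  let i₀ : Fin n := ⟨0, by omega⟩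
  have mem1 : collar P i₀ 0 (η / 2) ∈ strip P (Ioo 0 η) :=
    ⟨i₀, 0, by simp, _, ⟨by linarith [h.pos], by linarith [h.pos]⟩, rfl⟩
  have mem2 : collar P i₀ 0 (-(η / 2)) ∈ strip P (Ioo (-η) 0) :=
    ⟨i₀, 0, by simp, _, ⟨by linarith [h.pos], by linarith [h.pos]⟩, rfl⟩
  rcases hz' with hz' | hz'
  · have w1 : ∀ x ∈ strip P (Ioo 0 η), wind P x = 0 := fun x hx => by
      rw [← hz0]; exact wind_eq_of_mem pre1 off1 hx hz'
    have w2 : ∀ x ∈ strip P (Ioo (-η) 0), wind P x ≠ 0 := fun x hx => by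
      rw [h.wind_jump hP mem1 hx, w1 _ mem1]; norm_num
    refine ⟨η, 1, ⟨h, Or.inl rfl, fun i s hs t ht => w1 _ ⟨i, s, hs, _, by simpa using ht, rfl⟩,
      fun i s hs t ht => w2 _ ⟨i, s, hs, _, ?_, rfl⟩, ?_⟩⟩
    · constructor <;> linarith [ht.1, ht.2]
    · exact main _ _ pre1 off1 (fun x hx => h.exists_join hP hx) w2
  · have w1 : ∀ x ∈ strip P (Ioo (-η) 0), wind P x = 0 := fun x hx => by
      rw [← hz0]; exact wind_eq_of_mem pre2 off2 hx hz'
    have w2 : ∀ x ∈ strip P (Ioo 0 η), wind P x ≠ 0 := fun x hx => by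
      have := h.wind_jump hP hx mem2
      rw [w1 _ mem2] at this
      intro h0; rw [h0] at this; norm_num at this
    refine ⟨η, -1, ⟨h, Or.inr rfl, fun i s hs t ht => w1 _ ⟨i, s, hs, _, ?_, rfl⟩,
      fun i s hs t ht => w2 _ ⟨i, s, hs, _, ?_, rfl⟩, ?_⟩⟩
    · constructor <;> linarith [ht.1, ht.2]
    · constructor <;> linarith [ht.1, ht.2]
    · refine main _ _ pre2 off2 (fun x hx => ?_) w2
      obtain ⟨S, a, b, c, z, d, e⟩ := h.exists_join hP hx
      exact ⟨S, a, b, c, z, d, e.symm⟩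

theorem IsOuterSide.abs_sign_mul {η σ : ℝ} (h : IsOuterSide P η σ) (t : ℝ) : |σ * t| = |t| := by
  rcases h.sign with rfl | rfl <;> simp

theorem IsOuterSide.abs_lt {η σ : ℝ} (h : IsOuterSide P η σ) {t : ℝ} (ht : t ∈ Ico 0 η) :
    |σ * t| < η := by
  rw [h.abs_sign_mul, abs_of_nonneg ht.1]; exact ht.2

theorem IsOuterSide.sign_mul_self {η σ : ℝ} (h : IsOuterSide P η σ) : σ * σ = 1 := by
  rcases h.sign with rfl | rfl <;> norm_num

theorem IsOuterSide.sign_ne_zero {η σ : ℝ} (h : IsOuterSide P η σ) : σ ≠ 0 := by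
  rcases h.sign with rfl | rfl <;> norm_num

/-- Near an interior point of an edge, a side of the edge is a side of the polygon. -/
theorem IsSimplePolygon.eventually_wind_eq (hP : IsSimplePolygon P) (i : Fin n) {s : ℝ}
    (hs : s ∈ Ioo (0 : ℝ) 1) (ρ : ℝ) :
    ∃ r > 0, ∀ x ∈ Metric.ball (P i + s • edgeVec P i) r,
      ∀ y ∈ Metric.ball (P i + s • edgeVec P i) r,
      0 < ρ * cross (x - P i) (edgeVec P i) → 0 < ρ * cross (y - P i) (edgeVec P i) →
      x ∉ P.boundary ℝ ∧ wind P x = wind P y := by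
  set m := P i + s • edgeVec P i
  have hK : IsClosed (⋃ j ∈ {j | j ≠ i}, P.edgeSet ℝ j) :=
    (Set.toFinite _).isClosed_biUnion fun j _ => (isCompact_edgeSet P j).isClosed
  have hm : m ∈ (⋃ j ∈ {j | j ≠ i}, P.edgeSet ℝ j)ᶜ := by
    intro hc
    simp only [mem_iUnion] at hc
    obtain ⟨j, hj, hc⟩ := hc
    exact hP.edge_interior_notMem (Ne.symm hj) hs hc
  obtain ⟨r, hr, hr'⟩ := Metric.isOpen_iff.1 hK.isOpen_compl m hm
  refine ⟨r, hr, fun x hx y hy hx' hy' => ?_⟩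
  -- An open half-disc on one side of edge `i`, so small that no other edge enters it: it is convex
  -- and avoids the boundary.
  let S := Metric.ball m r ∩ {z | 0 < ρ * cross (z - P i) (edgeVec P i)}
  have hS : Convex ℝ S := by
    refine (convex_ball _ _).inter fun z hz z' hz' a b ha hb hab => ?_
    have e : a • z + b • z' - P i = a • (z - P i) + b • (z' - P i) := by
      have : P i = (a + b) • P i := by rw [hab, one_smul]
      nth_rw 1 [this]; module
    change 0 < ρ * cross (a • z + b • z' - P i) (edgeVec P i)
    rw [e, cross_add_left, cross_smul_left, cross_smul_left]
    have hz : 0 < ρ * cross (z - P i) (edgeVec P i) := hz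
    have hz' : 0 < ρ * cross (z' - P i) (edgeVec P i) := hz'
    rcases eq_or_lt_of_le ha with rfl | ha
    · have : b = 1 := by linarith
      subst this; linarith
    · have := mul_pos ha hz
      have := mul_nonneg hb hz'.le
      nlinarith
  have hoff : S ⊆ (P.boundary ℝ)ᶜ := by
    rintro z ⟨hz1, hz2⟩ hz3
    obtain ⟨j, hj⟩ := mem_iUnion.1 hz3
    by_cases hji : j = i
    · subst hji
      obtain ⟨s', -, rfl⟩ := (mem_edgeSet_iff P j z).1 hj
      simp [cross_smul_left, cross_self] at hz2
    · exact hr' hz1 (mem_iUnion₂.2 ⟨j, hji, hj⟩)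
  exact ⟨hoff ⟨hx, hx'⟩, wind_eq_of_mem hS.isPreconnected hoff ⟨hx, hx'⟩ ⟨hy, hy'⟩⟩

/-- Near an interior point of an edge, the points off the edge are classified by the side of the
edge. -/
theorem IsOuterSide.eventually_side {η σ : ℝ} (h : IsOuterSide P η σ) (hP : IsSimplePolygon P)
    (i : Fin n) {s : ℝ} (hs : s ∈ Ioo (0 : ℝ) 1) :
    ∀ᶠ x in 𝓝 (P i + s • edgeVec P i),
      (0 < σ * cross (x - P i) (edgeVec P i) → x ∉ region P) ∧
      (0 < -(σ * cross (x - P i) (edgeVec P i)) → x ∈ polygonInterior P) := by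
  have hs' : s ∈ Icc (0 : ℝ) 1 := ⟨hs.1.le, hs.2.le⟩
  have ht : ∀ r > 0, ∀ ρ : ℝ, ∃ t ∈ Ioo 0 η, collar P i s (ρ * t) ∈
      Metric.ball (P i + s • edgeVec P i) r := by
    intro r hr ρ
    have := tendsto_collar (P := P) i s ρ
    obtain ⟨t, h1, h2⟩ := ((this.eventually (Metric.ball_mem_nhds _ hr)).and
      (Ioo_mem_nhdsGT h.pos)).exists
    exact ⟨t, h2, h1⟩
  have hd := hP.edgeVec_norm_pos i
  obtain ⟨r, hr, hr1⟩ := hP.eventually_wind_eq i hs σ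
  obtain ⟨r', hr', hr1'⟩ := hP.eventually_wind_eq i hs (-σ)
  obtain ⟨t, ht1, ht2⟩ := ht r hr σ
  obtain ⟨t', ht1', ht2'⟩ := ht r' hr' (-σ)
  filter_upwards [Metric.ball_mem_nhds _ hr, Metric.ball_mem_nhds _ hr'] with x hx hx'
  constructor
  · intro hpos
    obtain ⟨a, b⟩ := hr1 x hx _ ht2 hpos (by
      rw [hP.cross_collar, ← mul_assoc, ← mul_assoc, h.sign_mul_self, one_mul]
      exact mul_pos ht1.1 hd)
    rintro (hc | hc)
    · exact a hc
    · rw [h.interior_iff x a, b] at hc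
      exact hc (h.wind_outer i s hs' t ht1)
  · intro hpos
    obtain ⟨a, b⟩ := hr1' x hx' _ ht2' (by rw [neg_mul]; exact hpos) (by
      rw [hP.cross_collar, ← mul_assoc, ← mul_assoc, neg_mul_neg, h.sign_mul_self, one_mul]
      exact mul_pos ht1'.1 hd)
    rw [h.interior_iff x a, b, neg_mul]
    exact h.wind_inner i s hs' t' ht1'

/-- The midpoint is an interior point of the edge, so the classification of its two sides decides
the test in the definition of `outwardNormal`. The sign is the same for all edges. -/
theorem IsOuterSide.outwardNormal_eq {η σ : ℝ} (h : IsOuterSide P η σ) (hP : IsSimplePolygon P)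
    (i : Fin n) : outwardNormal P i = σ • edgeNormal P i := by
  have hmid : midpoint ℝ (P i) (P (finRotate n i)) = P i + (1 / 2 : ℝ) • edgeVec P i := by
    rw [midpoint_eq_smul_add]; simp only [edgeVec, invOf_eq_inv]; module
  have hc : ∀ t : ℝ, cross (P i + (1 / 2 : ℝ) • edgeVec P i + t • edgeNormal P i - P i)
      (edgeVec P i) = t * ‖edgeVec P i‖ := by
    intro t
    rw [add_assoc, add_sub_cancel_left, cross_add_left, cross_smul_left, cross_self,
      cross_smul_left, cross_edgeVec, real_inner_self_eq_norm_sq, hP.norm_edgeNormal]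
    ring
  have hd := hP.edgeVec_norm_pos i
  have hev := h.eventually_side hP i (s := 1 / 2) ⟨by norm_num, by norm_num⟩
  have htend : Tendsto (fun t : ℝ => P i + (1 / 2 : ℝ) • edgeVec P i + t • edgeNormal P i) (𝓝[>] 0)
      (𝓝 (P i + (1 / 2 : ℝ) • edgeVec P i)) := by
    have : Continuous fun t : ℝ => P i + (1 / 2 : ℝ) • edgeVec P i + t • edgeNormal P i := by
      fun_prop
    simpa using this.continuousWithinAt.tendsto (x := (0 : ℝ)) (s := Ioi 0)
  have hev' := htend.eventually hev
  rw [outwardNormal, hmid]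
  rcases h.sign with rfl | rfl
  · rw [if_pos, one_smul]
    filter_upwards [hev', self_mem_nhdsWithin] with t ht ht0
    apply ht.1
    rw [hc, one_mul]
    exact mul_pos ht0 hd
  · rw [if_neg, neg_one_smul]
    intro hcon
    obtain ⟨t, ⟨ht, ht0⟩, ht1⟩ := ((hev'.and self_mem_nhdsWithin).and hcon).exists
    refine ht1 (Or.inr (ht.2 ?_))
    rw [hc, neg_one_mul, neg_neg]
    exact mul_pos ht0 hd

/-- A common sign does not change the inner product of two normals and factors out of their sum.
Hence inflating is flowing along the collar for the signed time `σ * δ`. -/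
theorem IsOuterSide.inflate_eq {η σ : ℝ} (h : IsOuterSide P η σ) (hP : IsSimplePolygon P)
    (δ : ℝ) : inflate P δ = offset P (σ * δ) := by
  rw [inflate, offset]
  congr 1
  funext i
  simp only [h.outwardNormal_eq hP, mitre, inner_smul_left, inner_smul_right, RCLike.conj_to_real]
  rw [← mul_assoc, h.sign_mul_self, one_mul, ← smul_add, smul_smul, smul_smul, div_eq_mul_inv]
  congr 2
  ring

theorem isClosed_boundary (P : Polygon Plane n) : IsClosed (P.boundary ℝ) :=
  (isCompact_boundary P).isClosed

theorem isOpen_polygonInterior (P : Polygon Plane n) : IsOpen (polygonInterior P) := by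
  rw [isOpen_iff_mem_nhds]
  rintro x ⟨hx, hb⟩
  have ho : IsOpen (P.boundary ℝ)ᶜ := (isClosed_boundary P).isOpen_compl
  have hc : connectedComponentIn (P.boundary ℝ)ᶜ x ∈ 𝓝 x :=
    ho.connectedComponentIn.mem_nhds (mem_connectedComponentIn hx)
  filter_upwards [hc] with y hy
  refine ⟨connectedComponentIn_subset _ _ hy, ?_⟩
  rwa [← connectedComponentIn_eq hy]

/-- The complement consists of the points off the boundary with winding number 0, and the winding
number is locally constant there. -/
theorem IsOuterSide.isClosed_region {η σ : ℝ} (h : IsOuterSide P η σ) :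
    IsClosed (region P) := by
  rw [← isOpen_compl_iff, isOpen_iff_mem_nhds]
  intro x hx
  have hxb : x ∉ P.boundary ℝ := fun hc => hx (Or.inl hc)
  have hw : wind P x = 0 := by
    by_contra hc
    exact hx (Or.inr ((h.interior_iff x hxb).2 hc))
  obtain ⟨r, hr, hr'⟩ := Metric.isOpen_iff.1 (isClosed_boundary P).isOpen_compl x hxb
  filter_upwards [Metric.ball_mem_nhds x hr] with y hy
  rintro (hc | hc)
  · exact hr' hy hc
  · rw [h.interior_iff y (hr' hy)] at hc
    apply hc
    rw [← hw]
    exact wind_eq_of_mem (convex_ball x r).isPreconnected hr' hy (Metric.mem_ball_self hr)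

theorem IsOuterSide.isCompact_region {η σ : ℝ} (h : IsOuterSide P η σ) :
    IsCompact (region P) := by
  refine Metric.isCompact_of_isClosed_isBounded h.isClosed_region ?_
  refine (Metric.isBounded_closedBall (x := (0 : Plane)) (r := farRadius P)).subset ?_
  intro x hx
  rw [mem_closedBall_zero_iff]
  by_contra hc
  rcases hx with hx | hx
  · exact hc (norm_le_farRadius hx)
  · rw [h.interior_iff x hx.1] at hx
    exact hx (wind_eq_zero_of_far (not_le.1 hc))

theorem IsOuterSide.collar_notMem_region {η σ : ℝ} (h : IsOuterSide P η σ)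
    (hP : IsSimplePolygon P) {i : Fin n} {s t : ℝ} (hs : s ∈ Icc (0 : ℝ) 1) (ht : t ∈ Ioo 0 η) :
    collar P i s (σ * t) ∉ region P := by
  have hb := h.collar_notMem_boundary hP (i := i) hs (h.abs_lt ⟨ht.1.le, ht.2⟩)
    (mul_ne_zero h.sign_ne_zero ht.1.ne')
  rintro (hc | hc)
  · exact hb hc
  · rw [h.interior_iff _ hb] at hc
    exact hc (h.wind_outer i s hs t ht)

theorem IsOuterSide.collar_inner_mem {η σ : ℝ} (h : IsOuterSide P η σ)
    (hP : IsSimplePolygon P) {i : Fin n} {s t : ℝ} (hs : s ∈ Icc (0 : ℝ) 1) (ht : t ∈ Ioo 0 η) :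
    collar P i s (-(σ * t)) ∈ polygonInterior P := by
  have hb := h.collar_notMem_boundary hP (i := i) (t := -(σ * t)) hs
    (by rw [abs_neg]; exact h.abs_lt ⟨ht.1.le, ht.2⟩)
    (neg_ne_zero.2 (mul_ne_zero h.sign_ne_zero ht.1.ne'))
  rw [h.interior_iff _ hb]
  exact h.wind_inner i s hs t ht

/-- Boundary points are not interior points of the closed region. -/
theorem IsOuterSide.boundary_disjoint_interior {η σ : ℝ} (h : IsOuterSide P η σ)
    (hP : IsSimplePolygon P) {x : Plane} (hx : x ∈ P.boundary ℝ) : x ∉ interior (region P) := by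
  obtain ⟨i, s, hs, rfl⟩ := (mem_boundary_iff P x).1 hx
  intro hi
  have := tendsto_collar (P := P) i s σ
  obtain ⟨t, h1, h2⟩ := ((this.eventually (mem_interior_iff_mem_nhds.1 hi)).and
    (Ioo_mem_nhdsGT h.pos)).exists
  exact h.collar_notMem_region hP hs h2 h1

theorem continuous_offset_vertex (i : Fin n) : Continuous fun t => (offset P t) i := by
  simp only [offset]; fun_prop

theorem IsOuterSide.notMem_boundary_offset {η σ : ℝ} (h : IsOuterSide P η σ)
    (hP : IsSimplePolygon P) {δ : ℝ} (hδ : δ ∈ Ioo 0 η) {x : Plane} (hx : x ∈ region P) :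
    x ∉ (offset P (σ * δ)).boundary ℝ := by
  rw [mem_boundary_offset_iff]
  rintro ⟨i, s, hs, rfl⟩
  exact h.collar_notMem_region hP hs hδ hx

/-- While the polygon is moved outwards from time 0 to `δ`, its boundary never passes an interior
point of `P`, so the winding number around that point is preserved. A boundary point is first pushed
slightly inwards, which does not change the winding number of the offset polygon. -/
theorem IsOuterSide.wind_offset_ne_zero {η σ : ℝ} (h : IsOuterSide P η σ)
    (hP : IsSimplePolygon P) {δ : ℝ} (hδ : δ ∈ Ioo 0 η) {x : Plane} (hx : x ∈ region P) :
    wind (offset P (σ * δ)) x ≠ 0 := by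
  have hint : ∀ x ∈ polygonInterior P, wind (offset P (σ * δ)) x ≠ 0 := by
    intro x hx
    have e : wind (offset P (σ * 0)) x = wind (offset P (σ * δ)) x := by
      refine wind_eq_of_isPreconnected (S := Icc 0 δ) (Q := fun t => offset P (σ * t))
        (x := fun _ => x) isPreconnected_Icc
        (fun i => (continuous_offset_vertex i).comp (continuous_const.mul continuous_id))
        continuous_const (fun t ht => ?_) ⟨le_rfl, hδ.1.le⟩ ⟨hδ.1.le, le_rfl⟩
      rcases eq_or_lt_of_le ht.1 with rfl | h0
      · rw [mul_zero, offset_zero]; exact hx.1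
      · exact h.notMem_boundary_offset hP ⟨h0, ht.2.trans_lt hδ.2⟩ (Or.inr hx)
    rw [← e, mul_zero, offset_zero]
    exact (h.interior_iff x hx.1).1 hx
  rcases hx with hx | hx
  · obtain ⟨i, s, hs, rfl⟩ := (mem_boundary_iff P x).1 hx
    set x := P i + s • edgeVec P i
    obtain ⟨r, hr, hr'⟩ := Metric.isOpen_iff.1 (isClosed_boundary (offset P (σ * δ))).isOpen_compl x
      (h.notMem_boundary_offset hP hδ (Or.inl hx))
    have := tendsto_collar (P := P) i s (-σ)
    simp only [neg_mul] at this
    obtain ⟨t, h1, h2⟩ := ((this.eventually (Metric.ball_mem_nhds _ hr)).and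
      (Ioo_mem_nhdsGT h.pos)).exists
    rw [wind_eq_of_mem (convex_ball x r).isPreconnected hr' (Metric.mem_ball_self hr) h1]
    exact hint _ (h.collar_inner_mem hP hs h2)
  · exact hint x hx

/-- The inflated polygon contains the polygon in its interior. -/
theorem IsOuterSide.region_subset {η σ : ℝ} (h : IsOuterSide P η σ) (hP : IsSimplePolygon P)
    {δ : ℝ} (hδ : δ ∈ Ioo 0 η) : region P ⊆ polygonInterior (offset P (σ * δ)) := fun _ hx =>
  mem_polygonInterior_of_wind_ne_zero (h.notMem_boundary_offset hP hδ hx)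
    (h.wind_offset_ne_zero hP hδ hx)

/-- Points of the outer collar below the height `δ` lie in the inflated polygon. -/
theorem IsOuterSide.collar_mem_offset {η σ : ℝ} (h : IsOuterSide P η σ) (hP : IsSimplePolygon P)
    {δ : ℝ} (hδ : δ ∈ Ioo 0 η) {i : Fin n} {s t : ℝ} (hs : s ∈ Icc (0 : ℝ) 1)
    (ht : t ∈ Ico 0 δ) : collar P i s (σ * t) ∈ polygonInterior (offset P (σ * δ)) := by
  have hoff : ∀ t ∈ Ico 0 δ, collar P i s (σ * t) ∉ (offset P (σ * δ)).boundary ℝ := by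
    intro t ht
    refine h.collar_notMem_offset hP hs (h.abs_lt ⟨ht.1, ht.2.trans hδ.2⟩)
      (h.abs_lt ⟨hδ.1.le, hδ.2⟩) fun e => ?_
    exact ht.2.ne (mul_left_cancel₀ h.sign_ne_zero e)
  refine mem_polygonInterior_of_wind_ne_zero (hoff t ht) ?_
  have h0 : collar P i s (σ * 0) ∈ region P := by
    rw [mul_zero, collar_zero]
    exact Or.inl ((mem_boundary_iff P _).2 ⟨i, s, hs, rfl⟩)
  rw [← wind_eq_of_isPreconnected (S := Ico 0 δ) (Q := fun _ => offset P (σ * δ))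
    (x := fun t => collar P i s (σ * t)) isPreconnected_Ico (fun _ => continuous_const)
    ((continuous_collar i s).comp (continuous_const.mul continuous_id)) hoff
    ⟨le_rfl, hδ.1⟩ ht]
  exact h.wind_offset_ne_zero hP hδ h0

end Sides

/-! ### Directions -/

/-- The unit vector in direction `θ`. -/
def dir (θ : ℝ) : Plane := !₂[Real.cos θ, Real.sin θ]

theorem continuous_dir : Continuous dir := by
  unfold dir
  refine (PiLp.continuous_toLp 2 _).comp (continuous_pi fun i => ?_)
  fin_cases i
  · exact Real.continuous_cos
  · exact Real.continuous_sin

theorem norm_dir (θ : ℝ) : ‖dir θ‖ = 1 := by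
  rw [← sq_eq_sq₀ (norm_nonneg _) zero_le_one, plane_norm_sq]
  simp [dir]

theorem cross_dir (a b : ℝ) : cross (dir a) (dir b) = Real.sin (b - a) := by
  rw [Real.sin_sub, cross]; simp [dir]; ring

theorem dir_add_two_pi (θ : ℝ) : dir (θ + 2 * Real.pi) = dir θ := by
  simp [dir]

theorem dir_add_int_mul_two_pi (θ : ℝ) (k : ℤ) : dir (θ + k * (2 * Real.pi)) = dir θ := by
  simp [dir, Real.cos_add_int_mul_two_pi, Real.sin_add_int_mul_two_pi]

theorem dir_eq_iff {a b : ℝ} (h1 : a - b < 2 * Real.pi) (h2 : b - a < 2 * Real.pi)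
    (h : dir a = dir b) : a = b := by
  have hc := congrArg (fun v : Plane => v 0) h
  have hs := congrArg (fun v : Plane => v 1) h
  simp only [dir, PiLp.toLp_apply, Matrix.cons_val_zero, Matrix.cons_val_one] at hc hs
  have : Real.cos (a - b) = 1 := by
    rw [Real.cos_sub, hc, hs]
    have := Real.cos_sq_add_sin_sq b
    linarith [sq (Real.cos b), sq (Real.sin b)]
  rw [Real.cos_eq_one_iff_of_lt_of_lt (by linarith) h1] at this
  linarith

theorem exists_polar (θ : ℝ) (x : Plane) :
    ∃ ψ ∈ Ico 0 (2 * Real.pi), x = ‖x‖ • dir (θ + ψ) := by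
  have hpi := Real.two_pi_pos
  set φ := Complex.arg (toC x)
  have hn : ‖toC x‖ = ‖x‖ := by
    rw [← sq_eq_sq₀ (norm_nonneg _) (norm_nonneg _), plane_norm_sq, ← Complex.normSq_eq_norm_sq,
      Complex.normSq_apply]
    simp only [toC]; ring
  have hx : x = ‖x‖ • dir φ := by
    ext k
    fin_cases k
    · have := Complex.norm_mul_cos_arg (toC x)
      rw [hn] at this
      simpa [dir, toC, φ] using this.symm
    · have := Complex.norm_mul_sin_arg (toC x)
      rw [hn] at this
      simpa [dir, toC, φ] using this.symm
  refine ⟨2 * Real.pi * Int.fract ((φ - θ) / (2 * Real.pi)),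
    ⟨mul_nonneg hpi.le (Int.fract_nonneg _), ?_⟩, ?_⟩
  · exact mul_lt_of_lt_one_right hpi (Int.fract_lt_one _)
  · have e : θ + 2 * Real.pi * Int.fract ((φ - θ) / (2 * Real.pi)) =
        φ + (-⌊(φ - θ) / (2 * Real.pi)⌋ : ℤ) * (2 * Real.pi) := by
      rw [Int.fract]; push_cast; field_simp; ring
    rw [e, dir_add_int_mul_two_pi]
    exact hx

/-- A nonzero combination of two directions with nonnegative coefficients lies between them. -/
theorem exists_polar_between {θ α A B : ℝ} (hα : α ∈ Ioo 0 Real.pi) (hA : 0 ≤ A) (hB : 0 ≤ B)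
    (hAB : 0 < A + B) :
    ∃ ρ > 0, ∃ ψ ∈ Icc 0 α, A • dir θ + B • dir (θ + α) = ρ • dir (θ + ψ) ∧
      B * Real.sin α = ρ * Real.sin ψ ∧ A * Real.sin α = ρ * Real.sin (α - ψ) := by
  have hsin := Real.sin_pos_of_pos_of_lt_pi hα.1 hα.2
  set x := A • dir θ + B • dir (θ + α)
  obtain ⟨ψ, hψ, hx⟩ := exists_polar θ x
  have e1 : B * Real.sin α = ‖x‖ * Real.sin ψ := by
    have := congrArg (cross (dir θ)) hx
    simpa [x, cross_add_right, cross_smul_right, cross_dir] using this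
  have e2 : A * Real.sin α = ‖x‖ * Real.sin (α - ψ) := by
    have := congrArg (fun v => cross v (dir (θ + α))) hx
    simpa [x, cross_add_left, cross_smul_left, cross_dir] using this
  have hρ : 0 < ‖x‖ := by
    rcases eq_or_lt_of_le (norm_nonneg x) with h | h
    · rw [← h, zero_mul] at e1 e2
      have := (mul_eq_zero.1 e1).resolve_right hsin.ne'
      have := (mul_eq_zero.1 e2).resolve_right hsin.ne'
      linarith
    · exact h
  refine ⟨‖x‖, hρ, ψ, ⟨hψ.1, ?_⟩, hx, e1, e2⟩
  -- The cross products with the two extreme directions show that `sin ψ` and `sin (α - ψ)` are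
  -- nonnegative. The first gives `ψ ≤ π`, and then the second gives `ψ ≤ α`.
  have s1 : 0 ≤ Real.sin ψ := nonneg_of_mul_nonneg_right (e1 ▸ mul_nonneg hB hsin.le) hρ
  have s2 : 0 ≤ Real.sin (α - ψ) := nonneg_of_mul_nonneg_right (e2 ▸ mul_nonneg hA hsin.le) hρ
  have hψπ : ψ ≤ Real.pi := by
    by_contra hc
    have : Real.sin (ψ - Real.pi) > 0 :=
      Real.sin_pos_of_pos_of_lt_pi (by linarith) (by linarith [hψ.2])
    rw [Real.sin_sub_pi] at this
    linarith
  by_contra hc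
  have := Real.sin_neg_of_neg_of_neg_pi_lt (x := α - ψ) (by linarith) (by linarith [hα.1])
  linarith

/-! ### Star-shaped polygons -/

/-- The data of a polygon that is star-shaped with respect to the origin, with `m` vertices in
equally spaced directions. -/
structure StarData where
  /-- the number of vertices -/
  m : ℕ
  three_le : 3 ≤ m
  /-- the direction of the first vertex -/
  θ : ℝ
  /-- the distances of the vertices from the origin -/
  r : ℕ → ℝ
  r_pos : ∀ k, 0 < r k
  r_per : r m = r 0

namespace StarData
variable (s : StarData)

/-- The angle between consecutive vertices. -/
def α : ℝ := 2 * Real.pi / s.m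

/-- The vertices. -/
def V (k : ℕ) : Plane := s.r k • dir (s.θ + k * s.α)

theorem m_mul_α : s.m * s.α = 2 * Real.pi := by
  have : (s.m : ℝ) ≠ 0 := by have := s.three_le; positivity
  rw [α]; field_simp

theorem α_mem : s.α ∈ Ioo 0 Real.pi := by
  have h3 : (3 : ℝ) ≤ s.m := by exact_mod_cast s.three_le
  have hpi := Real.pi_pos
  constructor
  · rw [α]; positivity
  · rw [α, div_lt_iff₀ (by linarith)]; nlinarith

theorem V_per : s.V s.m = s.V 0 := by
  rw [V, V, m_mul_α, dir_add_two_pi, s.r_per]; simp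

theorem V_eq (k : ℕ) (a b : ℝ) : a • s.V k + b • s.V (k + 1) =
    (a * s.r k) • dir (s.θ + k * s.α) + (b * s.r (k + 1)) • dir (s.θ + k * s.α + s.α) := by
  rw [V, V, smul_smul, smul_smul]
  congr 3
  push_cast; ring

/-- Different cones over the edges overlap at most in a common ray. -/
theorem cone_unique {k j : ℕ} (hkj : k ≤ j) (hj : j < s.m) {a b a' b' : ℝ} (ha : 0 ≤ a)
    (hb : 0 ≤ b) (ha' : 0 ≤ a') (hb' : 0 ≤ b') (hab : 0 < a + b) (hab' : 0 < a' + b')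
    (h : a • s.V k + b • s.V (k + 1) = a' • s.V j + b' • s.V (j + 1)) :
    (k = j ∧ a = a' ∧ b = b') ∨ (j = k + 1 ∧ a = 0 ∧ b' = 0 ∧ b = a') ∨
      (k = 0 ∧ j + 1 = s.m ∧ b = 0 ∧ a' = 0 ∧ a = b') := by
  have hα := s.α_mem
  have hsin := Real.sin_pos_of_pos_of_lt_pi hα.1 hα.2
  have hpi := Real.pi_pos
  have rk := s.r_pos
  have pos : ∀ {a b : ℝ} (k : ℕ), 0 ≤ a → 0 ≤ b → 0 < a + b → 0 < a * s.r k + b * s.r (k + 1) := by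
    intro a b k ha hb hab
    rcases eq_or_lt_of_le ha with rfl | ha'
    · have := mul_pos (by linarith : 0 < b) (rk (k + 1)); linarith
    · have := mul_pos ha' (rk k); have := mul_nonneg hb (rk (k + 1)).le; linarith
  rw [V_eq, V_eq] at h
  obtain ⟨ρ, hρ, ψ, hψ, e1, e2, e3⟩ := exists_polar_between (θ := s.θ + k * s.α) hα
    (mul_nonneg ha (rk k).le) (mul_nonneg hb (rk (k + 1)).le) (pos k ha hb hab)
  obtain ⟨ρ', hρ', ψ', hψ', e1', e2', e3'⟩ := exists_polar_between (θ := s.θ + j * s.α) hα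
    (mul_nonneg ha' (rk j).le) (mul_nonneg hb' (rk (j + 1)).le) (pos j ha' hb' hab')
  rw [e1, e1'] at h
  have hρρ : ρ = ρ' := by
    have := congrArg norm h
    rwa [norm_smul, norm_smul, norm_dir, norm_dir, mul_one, mul_one, Real.norm_of_nonneg hρ.le,
      Real.norm_of_nonneg hρ'.le] at this
  subst hρρ
  have hdir := smul_right_injective _ hρ.ne' h
  have zero_of : ∀ {c : ℝ} (k : ℕ), c * s.r k * Real.sin s.α = ρ * Real.sin 0 → c = 0 := by
    intro c k h
    rw [Real.sin_zero, mul_zero] at h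
    simpa [hsin.ne', (rk k).ne'] using h
  have eq_of : ∀ {c c' : ℝ} (k : ℕ), c * s.r k * Real.sin s.α = c' * s.r k * Real.sin s.α →
      c = c' := fun k h => mul_right_cancel₀ (rk k).ne' (mul_right_cancel₀ hsin.ne' h)
  have hjm : ((j : ℝ) + 1) * s.α ≤ 2 * Real.pi := by
    rw [← s.m_mul_α]
    exact mul_le_mul_of_nonneg_right (by exact_mod_cast hj) hα.1.le
  have hkj' : (k : ℝ) * s.α ≤ j * s.α := mul_le_mul_of_nonneg_right (by exact_mod_cast hkj) hα.1.le
  have hk0 : 0 ≤ (k : ℝ) * s.α := mul_nonneg (Nat.cast_nonneg _) hα.1.le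
  -- The two polar angles, measured from `θ`, lie in `[0, 2π]` and agree modulo `2π`. They are equal
  -- unless one is 0 and the other is `2π`; in that case the first ray of the first cone meets the
  -- last ray of the last cone.
  by_cases hw : j * s.α + ψ' - (k * s.α + ψ) < 2 * Real.pi
  · have hang := dir_eq_iff (by linarith [hψ.2, hψ'.1, hα.2]) (by linarith) hdir
    rcases Nat.eq_or_lt_of_le hkj with rfl | hlt
    · have : ψ = ψ' := by linarith
      subst this
      exact Or.inl ⟨rfl, eq_of k (e3.trans e3'.symm), eq_of (k + 1) (e2.trans e2'.symm)⟩
    · have hlt' : ((k : ℝ) + 1) * s.α ≤ j * s.α :=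
        mul_le_mul_of_nonneg_right (by exact_mod_cast hlt) hα.1.le
      have h1 : ψ' = 0 := by linarith [hψ.2, hψ'.1]
      have h2 : ψ = s.α := by linarith [hψ.2]
      have h3 : (j : ℝ) = k + 1 := mul_right_cancel₀ hα.1.ne' (by linarith)
      have h3' : j = k + 1 := by exact_mod_cast h3
      subst h3' h1 h2
      rw [sub_self] at e3
      rw [sub_zero] at e3'
      exact Or.inr (Or.inl ⟨rfl, zero_of k e3, zero_of _ e2', eq_of (k + 1) (e2.trans e3'.symm)⟩)
  · have h1 : ψ' = s.α := by linarith [hψ.1, hψ'.2]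
    have h2 : ψ = 0 := by linarith [hψ.1, hψ'.2]
    have h3 : (k : ℝ) * s.α = 0 := by linarith [hψ.1, hψ'.2]
    have h4 : ((j : ℝ) + 1) * s.α = s.m * s.α := by rw [s.m_mul_α]; linarith [hψ.1, hψ'.2]
    have h3' : k = 0 := by exact_mod_cast (mul_eq_zero.1 h3).resolve_right hα.1.ne'
    have h4' : j + 1 = s.m := by exact_mod_cast mul_right_cancel₀ hα.1.ne' h4
    subst h3' h1 h2
    rw [sub_self] at e3'
    rw [sub_zero] at e3
    rw [h4', s.r_per] at e2'
    exact Or.inr (Or.inr ⟨rfl, h4', zero_of _ e2, zero_of j e3', eq_of 0 (e3.trans e2'.symm)⟩)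

/-- The sum of the coordinates in a cone does not depend on the cone. -/
theorem cone_sum_eq {k j : ℕ} (hk : k < s.m) (hj : j < s.m) {a b a' b' : ℝ} (ha : 0 ≤ a)
    (hb : 0 ≤ b) (ha' : 0 ≤ a') (hb' : 0 ≤ b') (hab : 0 < a + b) (hab' : 0 < a' + b')
    (h : a • s.V k + b • s.V (k + 1) = a' • s.V j + b' • s.V (j + 1)) : a + b = a' + b' := by
  rcases le_total k j with hkj | hkj
  · rcases s.cone_unique hkj hj ha hb ha' hb' hab hab' h with h | h | h <;> linarith [h.2.1, h.2.2]
  · rcases s.cone_unique hkj hk ha' hb' ha hb hab' hab h.symm with h | h | h <;>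
      linarith [h.2.1, h.2.2]

/-- The cones cover the plane. -/
theorem exists_cone (x : Plane) : ∃ k < s.m, ∃ a b : ℝ, 0 ≤ a ∧ 0 ≤ b ∧
    x = a • s.V k + b • s.V (k + 1) := by
  have hα := s.α_mem
  have hsin := Real.sin_pos_of_pos_of_lt_pi hα.1 hα.2
  obtain ⟨ψ, hψ, hx⟩ := exists_polar s.θ x
  set k := ⌊ψ / s.α⌋₊
  have h1 : k * s.α ≤ ψ := (le_div_iff₀ hα.1).1 (Nat.floor_le (div_nonneg hψ.1 hα.1.le))
  have h2 : ψ < (k + 1) * s.α := (div_lt_iff₀ hα.1).1 (Nat.lt_floor_add_one _)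
  have hk : k < s.m := by
    have : (k : ℝ) * s.α < s.m * s.α := by rw [s.m_mul_α]; linarith [hψ.2]
    exact_mod_cast lt_of_mul_lt_mul_right this hα.1.le
  set β := ψ - k * s.α
  have hb0 : 0 ≤ Real.sin β := Real.sin_nonneg_of_nonneg_of_le_pi (by linarith) (by linarith [hα.2])
  have ha0 : 0 ≤ Real.sin (s.α - β) :=
    Real.sin_nonneg_of_nonneg_of_le_pi (by linarith) (by linarith [hα.2])
  refine ⟨k, hk, ‖x‖ * Real.sin (s.α - β) / (Real.sin s.α * s.r k),
    ‖x‖ * Real.sin β / (Real.sin s.α * s.r (k + 1)), ?_, ?_, ?_⟩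
  · have := s.r_pos k; positivity
  · have := s.r_pos (k + 1); positivity
  · rw [V_eq]
    have r1 := (s.r_pos k).ne'
    have r2 := (s.r_pos (k + 1)).ne'
    have e : s.θ + ψ = s.θ + k * s.α + β := by simp only [β]; ring
    rw [e] at hx
    have c1 : ‖x‖ * Real.sin (s.α - β) / (Real.sin s.α * s.r k) * s.r k =
      ‖x‖ * Real.sin (s.α - β) / Real.sin s.α := by field_simp
    have c2 : ‖x‖ * Real.sin β / (Real.sin s.α * s.r (k + 1)) * s.r (k + 1) =
      ‖x‖ * Real.sin β / Real.sin s.α := by field_simp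
    rw [c1, c2]
    have key : Real.sin s.α • dir (s.θ + k * s.α + β) = Real.sin (s.α - β) • dir (s.θ + k * s.α) +
        Real.sin β • dir (s.θ + k * s.α + s.α) := by
      set φ := s.θ + k * s.α
      ext i
      fin_cases i
      · simp [dir, Real.cos_add, Real.sin_sub]; ring
      · simp [dir, Real.sin_add, Real.sin_sub]; ring
    nth_rw 1 [hx]
    have : dir (s.θ + k * s.α + β) = (Real.sin s.α)⁻¹ • (Real.sin s.α • dir (s.θ + k * s.α + β)) := by
      rw [smul_smul, inv_mul_cancel₀ hsin.ne', one_smul]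
    rw [this, key]
    simp only [div_eq_mul_inv]
    module

/-- A point of an edge. -/
def OnEdge (x : Plane) (k : ℕ) : Prop :=
  ∃ a b : ℝ, 0 ≤ a ∧ 0 ≤ b ∧ a + b = 1 ∧ x = a • s.V k + b • s.V (k + 1)

/-- The polygon separates its inside from its outside. -/
theorem exists_onEdge_of_isPreconnected {B : Set Plane} (hB : IsPreconnected B)
    (h1 : ∃ x ∈ B, ∃ k < s.m, ∃ a b : ℝ, 0 ≤ a ∧ 0 ≤ b ∧ a + b ≤ 1 ∧
      x = a • s.V k + b • s.V (k + 1))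
    (h2 : ∃ x ∈ B, ∃ k < s.m, ∃ a b : ℝ, 0 ≤ a ∧ 0 ≤ b ∧ 1 ≤ a + b ∧
      x = a • s.V k + b • s.V (k + 1)) : ∃ x ∈ B, ∃ k < s.m, s.OnEdge x k := by
  have hα := s.α_mem
  have hsin := Real.sin_pos_of_pos_of_lt_pi hα.1 hα.2
  let c : ℕ → ℝ := fun k => cross (s.V k) (s.V (k + 1))
  have hc : ∀ k, 0 < c k := by
    intro k
    have : c k = s.r k * (s.r (k + 1) * Real.sin s.α) := by
      simp only [c, V]
      rw [cross_smul_left, cross_smul_right, cross_dir]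
      congr 3; push_cast; ring
    rw [this]
    exact mul_pos (s.r_pos k) (mul_pos (s.r_pos _) hsin)
  let fa : ℕ → Plane → ℝ := fun k x => cross x (s.V (k + 1)) / c k
  let fb : ℕ → Plane → ℝ := fun k x => cross (s.V k) x / c k
  have hfa : ∀ k, Continuous (fa k) := fun k => (continuous_cross_left _).div_const _
  have hfb : ∀ k, Continuous (fb k) := fun k => (continuous_cross_right _).div_const _
  have coords : ∀ k a b, fa k (a • s.V k + b • s.V (k + 1)) = a ∧
      fb k (a • s.V k + b • s.V (k + 1)) = b := by
    intro k a b
    have := (hc k).ne'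
    simp only [fa, fb, cross_add_left, cross_add_right, cross_smul_left, cross_smul_right,
      cross_self, mul_zero, add_zero, zero_add]
    constructor
    · change a * c k / c k = a; field_simp
    · change b * c k / c k = b; field_simp
  have recon : ∀ k x, x = fa k x • s.V k + fb k x • s.V (k + 1) := by
    intro k x
    have := (hc k).ne'
    have e : c k • x = cross x (s.V (k + 1)) • s.V k + cross (s.V k) x • s.V (k + 1) := by
      ext i
      fin_cases i
      · simp [c, cross]; ring
      · simp [c, cross]; ring
    have e2 : x = (c k)⁻¹ • (c k • x) := by rw [smul_smul, inv_mul_cancel₀ this, one_smul]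
    nth_rw 1 [e2]
    rw [e]
    simp only [fa, fb, div_eq_mul_inv]
    module
  -- `D` is the closed inside and `E` the closed outside. They cover the plane, so a connected set
  -- that meets both contains a common point. Since the coordinate sum does not depend on the cone,
  -- it equals 1 there; the origin, where the cones overlap completely, is not in `E`.
  let D : Set Plane := ⋃ k ∈ {k | k < s.m}, {x | 0 ≤ fa k x ∧ 0 ≤ fb k x ∧ fa k x + fb k x ≤ 1}
  let E : Set Plane := ⋃ k ∈ {k | k < s.m}, {x | 0 ≤ fa k x ∧ 0 ≤ fb k x ∧ 1 ≤ fa k x + fb k x}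
  have hfin : {k | k < s.m}.Finite := finite_lt_nat s.m
  have hD : IsClosed D := hfin.isClosed_biUnion fun k _ =>
    (isClosed_le continuous_const (hfa k)).inter ((isClosed_le continuous_const (hfb k)).inter
      (isClosed_le ((hfa k).add (hfb k)) continuous_const))
  have hE : IsClosed E := hfin.isClosed_biUnion fun k _ =>
    (isClosed_le continuous_const (hfa k)).inter ((isClosed_le continuous_const (hfb k)).inter
      (isClosed_le continuous_const ((hfa k).add (hfb k))))
  have cover : B ⊆ D ∪ E := by
    intro x _
    obtain ⟨k, hk, a, b, ha, hb, rfl⟩ := s.exists_cone x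
    have := coords k a b
    rcases le_total (a + b) 1 with h | h
    · left; exact mem_iUnion₂.2 ⟨k, hk, by simp only [mem_ofPred_eq, this]; exact ⟨ha, hb, h⟩⟩
    · right; exact mem_iUnion₂.2 ⟨k, hk, by simp only [mem_ofPred_eq, this]; exact ⟨ha, hb, h⟩⟩
  obtain ⟨x, hxB, hxD, hxE⟩ := isPreconnected_closed_iff.1 hB D E hD hE cover
    (by
      obtain ⟨x, hx, k, hk, a, b, ha, hb, hab, rfl⟩ := h1
      exact ⟨_, hx, mem_iUnion₂.2 ⟨k, hk, by
        simp only [mem_ofPred_eq, coords k a b]; exact ⟨ha, hb, hab⟩⟩⟩)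
    (by
      obtain ⟨x, hx, k, hk, a, b, ha, hb, hab, rfl⟩ := h2
      exact ⟨_, hx, mem_iUnion₂.2 ⟨k, hk, by
        simp only [mem_ofPred_eq, coords k a b]; exact ⟨ha, hb, hab⟩⟩⟩)
  obtain ⟨k, hk, ha, hb, hab⟩ := mem_iUnion₂.1 hxD
  obtain ⟨j, hj, ha', hb', hab'⟩ := mem_iUnion₂.1 hxE
  refine ⟨x, hxB, j, hj, fa j x, fb j x, ha', hb', le_antisymm ?_ hab', recon j x⟩
  rcases eq_or_lt_of_le (add_nonneg ha hb) with h0 | h0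
  · exfalso
    have z1 : fa k x = 0 := by linarith
    have z2 : fb k x = 0 := by linarith
    have hx0 : x = 0 := by rw [recon k x, z1, z2]; simp
    rw [hx0] at hab'
    have c0 := coords j 0 0
    simp only [zero_smul, add_zero] at c0
    rw [c0.1, c0.2] at hab'
    linarith
  · have := s.cone_sum_eq hk hj ha hb ha' hb' h0 (by linarith)
      ((recon k x).symm.trans (recon j x))
    linarith

end StarData

/-! ### Level sets of the distance from a star-shaped set -/

section Level
variable {K : Set Plane} {w : Plane}

/-- Contracting towards `w` by the factor `c` maps `K` into itself, so it carries a nearest point of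
`w + v` to a point of `K` at `c` times the distance. -/
theorem infDist_star_le (hK : IsCompact K) (hw : w ∈ K) (hs : StarConvex ℝ w K) {c : ℝ}
    (hc : c ∈ Icc (0 : ℝ) 1) (v : Plane) :
    Metric.infDist (w + c • v) K ≤ c * Metric.infDist (w + v) K := by
  obtain ⟨y, hy, hyd⟩ := hK.exists_infDist_eq_dist ⟨w, hw⟩ (w + v)
  have hm : w + c • (y - w) ∈ K := by
    have := hs hy (show 0 ≤ 1 - c by linarith [hc.2]) hc.1 (by ring)
    convert this using 1; module
  refine (Metric.infDist_le_dist_of_mem hm).trans ?_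
  rw [hyd, dist_eq_norm, dist_eq_norm]
  have e : w + c • v - (w + c • (y - w)) = c • (w + v - y) := by module
  rw [e, norm_smul, Real.norm_of_nonneg hc.1]

theorem infDist_ray_lt (hK : IsCompact K) (hw : w ∈ K) (hs : StarConvex ℝ w K) {a b : ℝ}
    (ha : 0 ≤ a) (hab : a < b) {v : Plane} (h : 0 < Metric.infDist (w + b • v) K) :
    Metric.infDist (w + a • v) K < Metric.infDist (w + b • v) K := by
  have hb : 0 < b := ha.trans_lt hab
  have := infDist_star_le hK hw hs (c := a / b) ⟨by positivity, (div_le_one hb).2 hab.le⟩ (b • v)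
  rw [smul_smul, div_mul_cancel₀ _ hb.ne'] at this
  refine this.trans_lt (mul_lt_of_lt_one_left h ((div_lt_one hb).2 hab))

/-- Every ray from `w` meets the level once, by the intermediate value theorem and strict
monotonicity. The radius is continuous because `a < R θ` and `R θ < a` amount, for `a ≥ 0`, to
strict inequalities for the distance at radius `a`, which persist for nearby angles. -/
theorem exists_level_radius (hK : IsCompact K) (hw : w ∈ K) (hs : StarConvex ℝ w K) {s : ℝ}
    (hs0 : 0 < s) : ∃ R : ℝ → ℝ, Continuous R ∧ (∀ θ, 0 < R θ) ∧
      (∀ θ, Metric.infDist (w + R θ • dir θ) K = s) ∧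
      ∀ θ, ∀ ρ, 0 < ρ → Metric.infDist (w + ρ • dir θ) K = s → ρ = R θ := by
  obtain ⟨C, hC⟩ := hK.isBounded.exists_norm_le
  have hC0 : 0 ≤ C := (norm_nonneg w).trans (hC w hw)
  have hcont : ∀ θ, Continuous fun ρ : ℝ => Metric.infDist (w + ρ • dir θ) K := fun θ =>
    (Metric.continuous_infDist_pt K).comp (by fun_prop)
  have hex : ∀ θ, ∃ ρ : ℝ, 0 < ρ ∧ Metric.infDist (w + ρ • dir θ) K = s := by
    intro θ
    -- `K` lies within `2 * C` of `w`, so a point at distance `2 * C + s` from `w` has distance at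
    -- least `s` from `K`.
    have hbig : s ≤ Metric.infDist (w + (2 * C + s) • dir θ) K := by
      obtain ⟨y, hy, hyd⟩ := hK.exists_infDist_eq_dist ⟨w, hw⟩ (w + (2 * C + s) • dir θ)
      rw [hyd, dist_eq_norm]
      have e : w + (2 * C + s) • dir θ - y = (2 * C + s) • dir θ - (y - w) := by abel
      rw [e]
      have h1 := norm_sub_norm_le ((2 * C + s) • dir θ) (y - w)
      rw [norm_smul, norm_dir, mul_one, Real.norm_of_nonneg (by positivity)] at h1
      have h2 := norm_sub_le y w
      linarith [hC y hy, hC w hw]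
    obtain ⟨ρ, hρ, hρs⟩ := intermediate_value_Icc (show (0 : ℝ) ≤ 2 * C + s by positivity)
      (hcont θ).continuousOn (show s ∈ Icc _ _ from ⟨by
        simp only [zero_smul, add_zero, Metric.infDist_zero_of_mem hw]; exact hs0.le, hbig⟩)
    refine ⟨ρ, lt_of_le_of_ne hρ.1 ?_, hρs⟩
    rintro rfl
    simp only [zero_smul, add_zero, Metric.infDist_zero_of_mem hw] at hρs
    exact hs0.ne hρs
  choose R hR hRs using hex
  have hlt : ∀ θ ρ, 0 ≤ ρ → ρ < R θ → Metric.infDist (w + ρ • dir θ) K < s := by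
    intro θ ρ h0 h
    rw [← hRs θ]
    exact infDist_ray_lt hK hw hs h0 h (by rw [hRs]; exact hs0)
  have hgt : ∀ θ ρ, R θ < ρ → s < Metric.infDist (w + ρ • dir θ) K := by
    intro θ ρ h
    by_contra hc
    have hpos : 0 < Metric.infDist (w + ρ • dir θ) K := by
      rcases eq_or_lt_of_le (Metric.infDist_nonneg (x := w + ρ • dir θ) (s := K)) with h0 | h0
      · exfalso
        have h1 := infDist_star_le hK hw hs (c := R θ / ρ) ⟨div_nonneg (hR θ).le
          ((hR θ).trans h).le, (div_le_one ((hR θ).trans h)).2 h.le⟩ (ρ • dir θ)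
        rw [smul_smul, div_mul_cancel₀ _ ((hR θ).trans h).ne', ← h0, hRs] at h1
        linarith
      · exact h0
    have := infDist_ray_lt hK hw hs (hR θ).le h hpos
    rw [hRs] at this
    linarith
  refine ⟨R, ?_, hR, hRs, fun θ ρ hρ h => ?_⟩
  · have hc2 : ∀ ρ : ℝ, Continuous fun θ => Metric.infDist (w + ρ • dir θ) K := fun ρ =>
      (Metric.continuous_infDist_pt K).comp
        (continuous_const.add (continuous_dir.const_smul ρ))
    rw [continuous_iff_continuousAt]
    intro θ
    refine tendsto_order.2 ⟨fun a ha => ?_, fun a ha => ?_⟩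
    · rcases lt_or_ge a 0 with h0 | h0
      · exact Eventually.of_forall fun θ' => h0.trans (hR θ')
      · filter_upwards [(hc2 a).continuousAt.eventually_lt continuousAt_const (hlt θ a h0 ha)]
          with θ' h'
        by_contra hc
        rcases eq_or_lt_of_le (not_lt.1 hc) with h1 | h1
        · rw [← h1, hRs] at h'; exact lt_irrefl _ h'
        · exact lt_asymm h' (hgt θ' a h1)
    · filter_upwards [continuousAt_const.eventually_lt (hc2 a).continuousAt (hgt θ a ha)]
        with θ' h'
      by_contra hc
      rcases eq_or_lt_of_le (not_lt.1 hc) with h1 | h1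
      · rw [h1, hRs] at h'; exact lt_irrefl _ h'
      · exact lt_asymm h' (hlt θ' a ((hR θ).trans ha).le h1)
  · rcases lt_trichotomy ρ (R θ) with h1 | h1 | h1
    · exact absurd h (hlt θ ρ hρ.le h1).ne
    · exact h1
    · exact absurd h (hgt θ ρ h1).ne'

/-- A star-shaped polygon with short edges and with vertices on a level set of the distance. -/
theorem exists_starData (hK : IsCompact K) (hw : w ∈ K) (hs : StarConvex ℝ w K) {v : Plane}
    (hv : 0 < Metric.infDist (w + v) K) {κ : ℝ} (hκ : 0 < κ) :
    ∃ S : StarData, S.V 0 = v ∧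
      (∀ k, Metric.infDist (w + S.V k) K = Metric.infDist (w + v) K) ∧
      ∀ k < S.m, dist (S.V k) (S.V (k + 1)) < κ := by
  obtain ⟨R, hRc, hR0, hRs, hRu⟩ := exists_level_radius hK hw hs hv
  obtain ⟨θ, -, hθ⟩ := exists_polar 0 v
  rw [zero_add] at hθ
  have hv0 : 0 < ‖v‖ := by
    rw [norm_pos_iff]; rintro rfl
    rw [add_zero, Metric.infDist_zero_of_mem hw] at hv
    exact lt_irrefl _ hv
  have hRθ : R θ = ‖v‖ := (hRu θ ‖v‖ hv0 (by rw [← hθ])).symm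
  have hpi := Real.pi_pos
  have hcv : Continuous fun φ => R φ • dir φ := hRc.smul continuous_dir
  -- Uniform continuity of the level curve over a full turn turns a small angle between consecutive
  -- vertices into short edges. That the curve closes up follows from the uniqueness of the radius.
  obtain ⟨ε, hε, hε'⟩ := Metric.uniformContinuousOn_iff.1
    ((isCompact_Icc (a := θ) (b := θ + 2 * Real.pi)).uniformContinuousOn_of_continuous
      hcv.continuousOn) κ hκ
  obtain ⟨m, hm⟩ := exists_nat_gt (max 3 (2 * Real.pi / ε))
  have hm3 : (3 : ℝ) < m := (le_max_left _ _).trans_lt hm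
  have hm0 : (0 : ℝ) < m := by linarith
  have hmε : 2 * Real.pi / m < ε := by
    rw [div_lt_iff₀ hm0]
    have := (div_lt_iff₀ hε).1 ((le_max_right _ _).trans_lt hm)
    linarith
  have hmα : (m : ℝ) * (2 * Real.pi / m) = 2 * Real.pi := by field_simp
  let S : StarData :=
    { m := m
      three_le := by exact_mod_cast hm3.le
      θ := θ
      r := fun k => R (θ + k * (2 * Real.pi / m))
      r_pos := fun k => hR0 _
      r_per := by
        rw [hmα, Nat.cast_zero, zero_mul, add_zero]
        exact (hRu θ _ (hR0 _) (by rw [← hRs (θ + 2 * Real.pi), dir_add_two_pi])) }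
  refine ⟨S, ?_, fun k => hRs _, fun k hk => ?_⟩
  · change R (θ + (0 : ℕ) * (2 * Real.pi / m)) • dir (θ + (0 : ℕ) * S.α) = v
    rw [Nat.cast_zero, zero_mul, zero_mul, add_zero, hRθ, ← hθ]
  · have hα0 : 0 < 2 * Real.pi / m := by positivity
    have hk1 : ((k : ℝ) + 1) * (2 * Real.pi / m) ≤ 2 * Real.pi := by
      have hk' : k + 1 ≤ m := hk
      have := mul_le_mul_of_nonneg_right (show (k : ℝ) + 1 ≤ m by exact_mod_cast hk') hα0.le
      linarith
    have hk0 : 0 ≤ (k : ℝ) * (2 * Real.pi / m) := by positivity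
    have e : ((k + 1 : ℕ) : ℝ) * (2 * Real.pi / m) = k * (2 * Real.pi / m) + 2 * Real.pi / m := by
      push_cast; ring
    refine hε' (θ + k * (2 * Real.pi / m)) ⟨by linarith, by linarith⟩
      (θ + (k + 1 : ℕ) * (2 * Real.pi / m)) ⟨by linarith, by linarith⟩ ?_
    rw [dist_comm, Real.dist_eq, e, add_sub_add_left_eq_sub, add_sub_cancel_left, abs_of_pos hα0]
    exact hmε

/-- The nearest point of a compact set is a frontier point. -/
theorem mem_thickening_frontier (hK : IsCompact K) (hne : K.Nonempty) {x : Plane} {η : ℝ}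
    (h0 : 0 < Metric.infDist x K) (h1 : Metric.infDist x K < η) :
    x ∈ Metric.thickening η (frontier K) := by
  obtain ⟨y, hy, hyd⟩ := hK.exists_infDist_eq_dist hne x
  refine Metric.mem_thickening_iff.2 ⟨y, ⟨subset_closure hy, fun hi => ?_⟩, hyd ▸ h1⟩
  have hc : Continuous fun t : ℝ => y + t • (x - y) := by fun_prop
  have : ∀ᶠ t in 𝓝[>] (0 : ℝ), y + t • (x - y) ∈ K := by
    have ht := hc.continuousWithinAt.tendsto (x := (0 : ℝ)) (s := Ioi 0)
    rw [zero_smul, add_zero] at ht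
    exact ht.eventually (mem_interior_iff_mem_nhds.1 hi)
  obtain ⟨t, ht, ht'⟩ := (this.and (Ioo_mem_nhdsGT (zero_lt_one' ℝ))).exists
  have h2 := Metric.infDist_le_dist_of_mem (x := x) ht
  have e : x - (y + t • (x - y)) = (1 - t) • (x - y) := by module
  rw [dist_eq_norm, e, norm_smul, Real.norm_of_nonneg (by linarith [ht'.2]), ← dist_eq_norm,
    ← hyd] at h2
  nlinarith [ht'.1]

/-- Each frontier point has points outside `K` nearby, each at some positive distance from `K`;
compactness makes the level uniform. A curve around `K` below this level is then crossed close to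
every frontier point. -/
theorem exists_frontier_level (hK : IsCompact K) {η : ℝ} (hη : 0 < η) :
    ∃ s > 0, ∀ p ∈ frontier K, ∃ y, dist p y < η ∧ s < Metric.infDist y K := by
  have hfr : IsCompact (frontier K) := hK.of_isClosed_subset isClosed_frontier hK.isClosed.frontier_subset
  let U : {s : ℝ // 0 < s} → Set Plane := fun s =>
    ⋃ y ∈ {y | s.1 < Metric.infDist y K}, Metric.ball y η
  have hU : ∀ s, IsOpen (U s) := fun s => isOpen_biUnion fun _ _ => Metric.isOpen_ball
  have hcov : frontier K ⊆ ⋃ s, U s := by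
    intro p hp
    have hp' : p ∈ closure Kᶜ := by
      rw [frontier_eq_closure_inter_closure] at hp; exact hp.2
    obtain ⟨y, hy, hpy⟩ := Metric.mem_closure_iff.1 hp' η hη
    have hne : K.Nonempty := ⟨p, hK.isClosed.frontier_subset hp⟩
    have hpos := (hK.isClosed.notMem_iff_infDist_pos hne).1 hy
    exact mem_iUnion.2 ⟨⟨Metric.infDist y K / 2, by linarith⟩,
      mem_iUnion₂.2 ⟨y, half_lt_self hpos, hpy⟩⟩
  have : Nonempty {s : ℝ // 0 < s} := ⟨⟨1, one_pos⟩⟩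
  obtain ⟨s, hs⟩ := hfr.elim_directed_cover U hU hcov (by
    intro a b
    refine ⟨⟨min a.1 b.1, lt_min a.2 b.2⟩, ?_, ?_⟩
    · exact biUnion_subset_biUnion_left fun y hy => (min_le_left a.1 b.1).trans_lt hy
    · exact biUnion_subset_biUnion_left fun y hy => (min_le_right a.1 b.1).trans_lt hy)
  refine ⟨s.1, s.2, fun p hp => ?_⟩
  obtain ⟨y, hy, hpy⟩ := mem_iUnion₂.1 (hs hp)
  exact ⟨y, hpy, hy⟩

end Level

/-! ### Strings around star-shaped sets -/

/-- The string that runs from `o` via `h` to the vertices of a star-shaped polygon. -/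
theorem StarData.exists_string (S : StarData) (w o h : Plane) (c : ℝ) (hc : 1 < c)
    (hh : h = w + c • S.V 0) (g : Plane → ℝ) (s : ℝ)
    (g_tail : ∀ x ∈ segment ℝ o h, x ≠ h → s < g x) (g_h : g h = s) (ho : o ≠ h)
    (g_edge : ∀ k < S.m, ∀ x, S.OnEdge x k → g (w + x) < s)
    (g_ray : ∀ x ∈ segment ℝ h (w + S.V 0), x ≠ h → g x < s) :
    ∃ A : PolygonalString, A.origin = o ∧ ∀ x, x ∈ A.carrier ↔ x ∈ segment ℝ o h ∨
      x ∈ segment ℝ h (w + S.V 0) ∨ ∃ k, k + 1 < S.m ∧ S.OnEdge (x - w) k := by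
  have hm := S.three_le
  -- The vertices are `o`, `h`, then `S.V 0, …, S.V (m - 1)` translated by `w`. The closing edge
  -- from `S.V (m - 1)` to `S.V 0` is left out, so there are `m + 1` edges.
  let vert : ℕ → Plane := fun i => if i = 0 then o else if i = 1 then h else w + S.V (i - 2)
  have v0 : vert 0 = o := rfl
  have v1 : vert 1 = h := rfl
  have v2 : ∀ k, vert (k + 2) = w + S.V k := fun k => rfl
  have edge_iff : ∀ k x, x ∈ segment ℝ (w + S.V k) (w + S.V (k + 1)) ↔ S.OnEdge (x - w) k := by
    intro k x
    constructor
    · rintro ⟨a, b, ha, hb, hab, rfl⟩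
      refine ⟨a, b, ha, hb, hab, ?_⟩
      have : w = (a + b) • w := by rw [hab, one_smul]
      nth_rw 3 [this]; module
    · rintro ⟨a, b, ha, hb, hab, hx⟩
      refine ⟨a, b, ha, hb, hab, ?_⟩
      rw [← sub_eq_zero, eq_add_of_sub_eq hx]
      have : w = (a + b) • w := by rw [hab, one_smul]
      nth_rw 3 [this]; module
  have gV : ∀ k < S.m, g (w + S.V k) < s := fun k hk =>
    g_edge k hk _ ⟨1, 0, by norm_num, le_rfl, by norm_num, by simp⟩
  have V_inj : ∀ k j, k < S.m → j < S.m → k < j → S.V k ≠ S.V j := by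
    intro k j hk hj hkj h
    have := S.cone_unique hkj.le hj (a := 1) (b := 0) (a' := 1) (b' := 0) (by norm_num) le_rfl
      (by norm_num) le_rfl (by norm_num) (by norm_num) (by simpa using h)
    rcases this with h | h | h
    · omega
    · linarith [h.2.1]
    · linarith [h.2.2.2.2]
  have inj_lt : ∀ i j, i < j → j < S.m + 2 → vert i ≠ vert j := by
    intro i j hij hj
    obtain rfl | rfl | ⟨k, rfl⟩ : i = 0 ∨ i = 1 ∨ ∃ k, i = k + 2 := by
      rcases i with _ | _ | k
      · simp
      · simp
      · exact Or.inr (Or.inr ⟨k, rfl⟩)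
    · obtain rfl | ⟨l, rfl⟩ : j = 1 ∨ ∃ l, j = l + 2 := by
        rcases j with _ | _ | l
        · omega
        · simp
        · exact Or.inr ⟨l, rfl⟩
      · rw [v0, v1]; exact ho
      · rw [v0, v2]
        intro e
        have h1 := g_tail o (left_mem_segment ℝ _ _) ho
        have h2 := gV l (by omega)
        rw [e] at h1
        linarith
    · obtain ⟨l, rfl⟩ : ∃ l, j = l + 2 := ⟨j - 2, by omega⟩
      rw [v1, v2]
      intro e
      have h2 := gV l (by omega)
      rw [← e] at h2
      linarith
    · obtain ⟨l, rfl⟩ : ∃ l, j = l + 2 := ⟨j - 2, by omega⟩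
      rw [v2, v2]
      intro e
      exact V_inj k l (by omega) (by omega) (by omega) (add_left_cancel e)
  have ray : ∀ x ∈ segment ℝ h (w + S.V 0), ∃ μ : ℝ, 1 ≤ μ ∧ x - w = μ • S.V 0 := by
    rintro x ⟨a, b, ha, hb, hab, rfl⟩
    refine ⟨a * c + b, by nlinarith, ?_⟩
    rw [hh]
    have : w = (a + b) • w := by rw [hab, one_smul]
    nth_rw 3 [this]; module
  -- The function `g` separates the tail, where it exceeds `s` except at `h`, from the rest. The
  -- second edge has cone coordinates `(μ, 0)` with `μ ≥ 1` and so meets the star-shaped polygon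
  -- only in `S.V 0`. The edges of that polygon are separated by their cones.
  have meet : ∀ i j, i < j → j < S.m + 1 → ∀ x ∈ segment ℝ (vert i) (vert (i + 1)) ∩
      segment ℝ (vert j) (vert (j + 1)), i + 1 = j ∧ x = vert (i + 1) := by
    rintro i j hij hj x ⟨hx, hx'⟩
    obtain rfl | rfl | ⟨k, rfl⟩ : i = 0 ∨ i = 1 ∨ ∃ k, i = k + 2 := by
      rcases i with _ | _ | k
      · simp
      · simp
      · exact Or.inr (Or.inr ⟨k, rfl⟩)
    · obtain rfl | ⟨l, rfl⟩ : j = 1 ∨ ∃ l, j = l + 2 := by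
        rcases j with _ | _ | l
        · omega
        · simp
        · exact Or.inr ⟨l, rfl⟩
      · refine ⟨rfl, ?_⟩
        by_contra hne
        have h1 := g_tail x hx hne
        have h2 := g_ray x hx' hne
        linarith
      · exfalso
        have h2 := g_edge l (by omega) _ ((edge_iff l x).1 hx')
        rw [add_sub_cancel] at h2
        by_cases hne : x = h
        · rw [hne, g_h] at h2; exact lt_irrefl _ h2
        · have h1 := g_tail x hx hne
          linarith
    · obtain ⟨l, rfl⟩ : ∃ l, j = l + 2 := ⟨j - 2, by omega⟩
      obtain ⟨μ, hμ, hxμ⟩ := ray x hx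
      obtain ⟨a, b, ha, hb, hab, hxe⟩ := (edge_iff l x).1 hx'
      have := S.cone_unique (Nat.zero_le l) (by omega) (a := μ) (b := 0) (by linarith) le_rfl ha hb
        (by linarith) (by linarith) (by rw [← hxe, hxμ]; simp)
      rcases this with h | h | h
      · obtain ⟨rfl, rfl, rfl⟩ := h
        refine ⟨rfl, ?_⟩
        have : μ = 1 := by linarith
        rw [this, one_smul] at hxμ
        exact (eq_add_of_sub_eq' hxμ)
      · linarith [h.2.1]
      · omega
    · obtain ⟨l, rfl⟩ : ∃ l, j = l + 2 := ⟨j - 2, by omega⟩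
      obtain ⟨a, b, ha, hb, hab, hxe⟩ := (edge_iff k x).1 hx
      obtain ⟨a', b', ha', hb', hab', hxe'⟩ := (edge_iff l x).1 hx'
      have := S.cone_unique (show k ≤ l by omega) (by omega) ha hb ha' hb' (by linarith)
        (by linarith) (hxe.symm.trans hxe')
      rcases this with h | h | h
      · omega
      · obtain ⟨rfl, rfl, rfl, rfl⟩ := h
        refine ⟨rfl, ?_⟩
        have : b = 1 := by linarith
        rw [this, zero_smul, zero_add, one_smul] at hxe
        exact (eq_add_of_sub_eq' hxe)
      · omega
  refine ⟨⟨S.m + 1, by omega, fun i => vert i.val, fun i j hij => ?_, fun i j hij x hx => ?_⟩,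
    rfl, fun x => ?_⟩
  · rcases lt_trichotomy i.val j.val with h | h | h
    · exact absurd hij (inj_lt _ _ h (by omega))
    · exact Fin.ext h
    · exact absurd hij.symm (inj_lt _ _ h (by omega))
  · exact meet i j hij (by omega) x hx
  · simp only [PolygonalString.carrier, mem_iUnion]
    constructor
    · rintro ⟨i, hi⟩
      change x ∈ segment ℝ (vert i.val) (vert (i.val + 1)) at hi
      obtain ⟨i, hi'⟩ := i
      rcases i with _ | _ | k
      · exact Or.inl hi
      · exact Or.inr (Or.inl hi)
      · exact Or.inr (Or.inr ⟨k, by omega, (edge_iff k x).1 hi⟩)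
    · rintro (hx | hx | ⟨k, hk, hx⟩)
      · exact ⟨⟨0, by omega⟩, hx⟩
      · exact ⟨⟨1, by omega⟩, hx⟩
      · exact ⟨⟨k + 2, by omega⟩, (edge_iff k x).2 hx⟩

/-- A string that follows the boundary of a star-shaped compact set and is hard to avoid. -/
theorem exists_string {K : Set Plane} {w : Plane} (hK : IsCompact K) (hw : w ∈ K)
    (hs : StarConvex ℝ w K) {p o : Plane} (hp : p ∈ K) (ho : o ∉ K) {C : Set Plane}
    (hC : IsClosed C) (hCp : segment ℝ o p ∩ C ⊆ {p}) {η : ℝ} (hη : 0 < η) :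
    ∃ A : PolygonalString, A.origin = o ∧
      A.carrier ⊆ segment ℝ o p ∪ Metric.thickening η (frontier K) ∧
      frontier K ⊆ Metric.thickening η A.carrier ∧
      ∃ r > 0, ∀ B : Set Plane, IsPreconnected B → (B ∩ Metric.thickening r K).Nonempty →
        (B \ Metric.thickening η K).Nonempty → B ⊆ Metric.thickening r C →
        (B ∩ A.carrier).Nonempty := by
  have hne : K.Nonempty := ⟨w, hw⟩
  let f : Plane → ℝ := fun x => Metric.infDist x K
  have hf : Continuous f := Metric.continuous_infDist_pt K
  have f_lip : ∀ x y, f x ≤ f y + dist x y := fun x y => Metric.infDist_le_infDist_add_dist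
  obtain ⟨s₀, hs₀, hnet⟩ := exists_frontier_level hK (half_pos hη)
  have hfo : 0 < f o := (hK.isClosed.notMem_iff_infDist_pos hne).1 ho
  -- The level `s` lies below `s₀` so that the curve is met near every frontier point, below `η` so
  -- that the curve stays near `K`, and below `f o` so that `o` is outside.
  obtain ⟨s, hs1, hs2⟩ := exists_between (lt_min hs₀ (lt_min hη hfo))
  obtain ⟨hss₀, hsη, hso⟩ : s < s₀ ∧ s < η ∧ s < f o := by
    simpa only [lt_min_iff] using hs2
  -- the first point of the tail near `K`
  let q : ℝ → Plane := fun τ => o + τ • (p - o)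
  have hq : Continuous q := by fun_prop
  have hq_mem : ∀ τ ∈ Icc (0 : ℝ) 1, q τ ∈ segment ℝ o p := by
    intro τ hτ
    exact ⟨1 - τ, τ, by linarith [hτ.2], hτ.1, by ring, by simp only [q]; module⟩
  have hcomp : IsCompact (Icc (0 : ℝ) 1 ∩ {τ | f (q τ) ≤ s}) :=
    isCompact_Icc.inter_right (isClosed_le (hf.comp hq) continuous_const)
  have hq1 : q 1 = p := by simp [q]
  have hq0 : q 0 = o := by simp [q]
  obtain ⟨τ, ⟨hτ, hτs⟩, hτmin⟩ := hcomp.exists_isLeast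
    ⟨1, ⟨by norm_num, by
      change f (q 1) ≤ s
      rw [hq1]; simp only [f, Metric.infDist_zero_of_mem hp]; exact hs1.le⟩⟩
  have hbefore : ∀ σ ∈ Ico 0 τ, s < f (q σ) := by
    intro σ hσ
    by_contra hc
    exact absurd (hτmin ⟨⟨hσ.1, hσ.2.le.trans hτ.2⟩, not_lt.1 hc⟩) (not_le.2 hσ.2)
  have hfh : f (q τ) = s := by
    refine le_antisymm hτs ?_
    obtain ⟨σ, hσ, hσs⟩ := intermediate_value_Icc' hτ.1 (hf.comp hq).continuousOn
      (show s ∈ Icc (f (q τ)) (f (q 0)) from ⟨hτs, by rw [hq0]; exact hso.le⟩)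
    rcases eq_or_lt_of_le hσ.2 with h | h
    · rw [← h]; exact hσs.ge
    · exact absurd hσs (hbefore σ ⟨hσ.1, h⟩).ne'
  set h := q τ
  have hτ0 : 0 < τ := by
    rcases eq_or_lt_of_le hτ.1 with h0 | h0
    · exfalso
      have : h = o := by simp only [h, ← h0, hq0]
      rw [this] at hfh; linarith
    · exact h0
  have hoh : o ≠ h := by rintro e; rw [← e] at hfh; linarith
  have hhC : h ∉ C := by
    intro hc
    have : h = p := hCp ⟨hq_mem τ hτ, hc⟩
    rw [this] at hfh
    simp only [f, Metric.infDist_zero_of_mem hp] at hfh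
    linarith
  have tail_sub : segment ℝ o h ⊆ segment ℝ o p :=
    (convex_segment o p).segment_subset (left_mem_segment ℝ _ _) (hq_mem τ hτ)
  -- The end `h` of the tail has positive distance from `K`, so it is not `p` and hence not in `C`.
  -- The gap of the string will be hidden in this ball around `h`.
  obtain ⟨ρ, hρ, hρC⟩ := Metric.isOpen_iff.1 hC.isOpen_compl h hhC
  -- the first vertex on the star-shaped polygon
  have hev : ∀ᶠ c in 𝓝[<] (1 : ℝ), dist (w + c • (h - w)) h < min (s / 2) (min (ρ / 3) (η / 4)) := by
    have hc : Continuous fun c : ℝ => dist (w + c • (h - w)) h := by fun_prop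
    have := hc.continuousWithinAt.tendsto (x := (1 : ℝ)) (s := Iio 1)
    rw [one_smul, add_sub_cancel, dist_self] at this
    exact this.eventually (gt_mem_nhds (by positivity))
  obtain ⟨c, hcd, hc⟩ := (hev.and (Ioo_mem_nhdsLT (zero_lt_one' ℝ))).exists
  set v := c • (h - w)
  obtain ⟨hd1, hd2, hd3⟩ : dist (w + v) h < s / 2 ∧ dist (w + v) h < ρ / 3 ∧ dist (w + v) h < η / 4 := by
    simpa only [lt_min_iff] using hcd
  have hfv1 : f (w + v) < s := by
    have := infDist_ray_lt hK hw hs hc.1.le hc.2 (v := h - w)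
      (by rw [one_smul, add_sub_cancel]; change 0 < f h; rw [hfh]; exact hs1)
    rw [one_smul, add_sub_cancel] at this
    exact this.trans_eq hfh
  have hfv2 : s / 2 < f (w + v) := by
    have := f_lip h (w + v)
    rw [dist_comm] at this
    linarith
  set s' := f (w + v)
  -- The bounds on the edge length `κ` keep the edges below level `s` and above level `s' / 2`, keep
  -- the gap within the ball of radius `ρ` around `h`, and make the gap harmless for the
  -- approximation of the frontier.
  obtain ⟨κ, hκ, hκ'⟩ := exists_between (show 0 < min (s - s') (min (s' / 2) (min (ρ / 3) (η / 4)))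
    from lt_min (by linarith) (lt_min (by linarith) (by positivity)))
  obtain ⟨hκ1, hκ2, hκ3, hκ4⟩ : κ < s - s' ∧ κ < s' / 2 ∧ κ < ρ / 3 ∧ κ < η / 4 := by
    simpa only [lt_min_iff] using hκ'
  obtain ⟨S, hS0, hSf, hSd⟩ := exists_starData hK hw hs (v := v) (by change 0 < s'; linarith) hκ
  have edge_near : ∀ k < S.m, ∀ x, S.OnEdge x k → dist x (S.V k) < κ ∧ dist x (S.V (k + 1)) < κ := by
    rintro k hk x ⟨a, b, ha, hb, hab, rfl⟩
    have e1 : a • S.V k + b • S.V (k + 1) - S.V k = b • (S.V (k + 1) - S.V k) := by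
      have : a = 1 - b := by linarith
      rw [this]; module
    have e2 : a • S.V k + b • S.V (k + 1) - S.V (k + 1) = a • (S.V k - S.V (k + 1)) := by
      have : b = 1 - a := by linarith
      rw [this]; module
    have hd := hSd k hk
    rw [dist_eq_norm, dist_eq_norm, e1, e2, norm_smul, norm_smul, Real.norm_of_nonneg ha,
      Real.norm_of_nonneg hb, ← dist_eq_norm, ← dist_eq_norm, dist_comm (S.V (k + 1))]
    have := dist_nonneg (x := S.V k) (y := S.V (k + 1))
    constructor <;> nlinarith
  have edge_f : ∀ k < S.m, ∀ x, S.OnEdge x k → s' / 2 < f (w + x) ∧ f (w + x) < s := by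
    intro k hk x hx
    have h1 := (edge_near k hk x hx).1
    have h2 := f_lip (w + x) (w + S.V k)
    have h3 := f_lip (w + S.V k) (w + x)
    rw [dist_add_left] at h2 h3
    rw [dist_comm] at h3
    have h4 : f (w + S.V k) = s' := hSf k
    constructor <;> linarith
  have ray_f : ∀ x ∈ segment ℝ h (w + S.V 0), s' ≤ f x ∧ (x ≠ h → f x < s) := by
    rintro x ⟨a, b, ha, hb, hab, rfl⟩
    rw [hS0]
    have e : a • h + b • (w + v) = w + (a + b * c) • (h - w) := by
      have : a = 1 - b := by linarith
      simp only [v, this]; module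
    have hhw : f (w + (1 : ℝ) • (h - w)) = s := by rw [one_smul, add_sub_cancel]; exact hfh
    have hle : a + b * c ≤ 1 := by nlinarith [hc.2]
    have hge : c ≤ a + b * c := by nlinarith [hc.2]
    rw [e]
    have hpos : 0 < a + b * c := hc.1.trans_le hge
    constructor
    · have := infDist_star_le hK hw hs (c := c / (a + b * c))
        ⟨by have := hc.1; positivity, (div_le_one hpos).2 hge⟩ ((a + b * c) • (h - w))
      rw [smul_smul, div_mul_cancel₀ _ hpos.ne'] at this
      refine le_trans this (mul_le_of_le_one_left Metric.infDist_nonneg ((div_le_one hpos).2 hge))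
    · intro hne
      have hlt : a + b * c < 1 := by
        refine lt_of_le_of_ne hle fun e1 => hne ?_
        rw [e1, one_smul, add_sub_cancel]
      have := infDist_ray_lt hK hw hs hpos.le hlt (v := h - w) (by
        change 0 < f _; rw [hhw]; exact hs1)
      exact this.trans_eq hhw
  have tail_f : ∀ x ∈ segment ℝ o h, x ≠ h → s < f x := by
    rintro x ⟨a, b, ha, hb, hab, rfl⟩ hne
    have e : a • o + b • h = q (b * τ) := by
      have : a = 1 - b := by linarith
      simp only [h, q, this]; module
    rw [e]
    refine hbefore _ ⟨by positivity, ?_⟩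
    refine lt_of_le_of_ne (mul_le_of_le_one_left hτ0.le (by linarith)) fun e1 => hne ?_
    rw [e, e1]
  obtain ⟨A, hA0, hA⟩ := S.exists_string w o h c⁻¹ (one_lt_inv_iff₀.2 hc)
    (by rw [hS0, smul_smul, inv_mul_cancel₀ hc.1.ne', one_smul, add_sub_cancel]) f s tail_f hfh hoh
    (fun k hk x hx => (edge_f k hk x hx).2) (fun x hx hne => (ray_f x hx).2 hne)
  -- inside and outside of the star-shaped polygon
  have cone_f : ∀ k < S.m, ∀ a b : ℝ, 0 ≤ a → 0 ≤ b → 0 < a + b →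
      S.OnEdge ((a + b)⁻¹ • (a • S.V k + b • S.V (k + 1))) k := by
    intro k hk a b ha hb hab
    refine ⟨(a + b)⁻¹ * a, (a + b)⁻¹ * b, by positivity, by positivity, ?_, by module⟩
    field_simp
  have inside : ∀ x, f x < s' / 2 → ∃ k < S.m, ∃ a b : ℝ, 0 ≤ a ∧ 0 ≤ b ∧ a + b ≤ 1 ∧
      x - w = a • S.V k + b • S.V (k + 1) := by
    intro x hx
    obtain ⟨k, hk, a, b, ha, hb, e⟩ := S.exists_cone (x - w)
    refine ⟨k, hk, a, b, ha, hb, ?_, e⟩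
    by_contra hab
    have hab := not_le.1 hab
    have h1 := (edge_f k hk _ (cone_f k hk a b ha hb (by linarith))).1
    have h2 := infDist_star_le hK hw hs (c := (a + b)⁻¹)
      ⟨by positivity, inv_le_one_of_one_le₀ hab.le⟩ (a • S.V k + b • S.V (k + 1))
    rw [← e, add_sub_cancel] at h2
    rw [← e] at h1
    have h3 : (a + b)⁻¹ * Metric.infDist x K ≤ Metric.infDist x K :=
      mul_le_of_le_one_left Metric.infDist_nonneg (inv_le_one_of_one_le₀ hab.le)
    have h4 : Metric.infDist x K < s' / 2 := hx
    have h5 : s' / 2 < Metric.infDist (w + (a + b)⁻¹ • (x - w)) K := h1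
    linarith
  have outside : ∀ x, s ≤ f x → ∃ k < S.m, ∃ a b : ℝ, 0 ≤ a ∧ 0 ≤ b ∧ 1 ≤ a + b ∧
      x - w = a • S.V k + b • S.V (k + 1) := by
    intro x hx
    obtain ⟨k, hk, a, b, ha, hb, e⟩ := S.exists_cone (x - w)
    refine ⟨k, hk, a, b, ha, hb, ?_, e⟩
    by_contra hab
    have hab := not_le.1 hab
    rcases eq_or_lt_of_le (add_nonneg ha hb) with h0 | h0
    · have z1 : a = 0 := by linarith
      have z2 : b = 0 := by linarith
      rw [z1, z2, zero_smul, zero_smul, add_zero, sub_eq_zero] at e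
      rw [e] at hx
      simp only [f, Metric.infDist_zero_of_mem hw] at hx
      linarith
    · have h1 := (edge_f k hk _ (cone_f k hk a b ha hb h0)).2
      have h2 := infDist_star_le hK hw hs (c := a + b) ⟨h0.le, hab.le⟩
        ((a + b)⁻¹ • (a • S.V k + b • S.V (k + 1)))
      rw [smul_smul, mul_inv_cancel₀ h0.ne', one_smul, ← e, add_sub_cancel] at h2
      rw [← e] at h1
      have h3 : (a + b) * f (w + (a + b)⁻¹ • (x - w)) ≤ f (w + (a + b)⁻¹ • (x - w)) :=
        mul_le_of_le_one_left Metric.infDist_nonneg hab.le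
      have h4 : f x ≤ (a + b) * f (w + (a + b)⁻¹ • (x - w)) := h2
      linarith
  -- A connected set that goes from inside to outside meets an edge of the closed polygon. Either
  -- this edge belongs to the string or it is the omitted one, which stays within `κ` of the first
  -- vertex `w + v`.
  have cross : ∀ B : Set Plane, IsPreconnected B → (∃ x ∈ B, f x < s' / 2) → (∃ x ∈ B, s ≤ f x) →
      ∃ x ∈ B, x ∈ A.carrier ∨ dist x (w + v) < κ := by
    rintro B hB ⟨x, hx, hxf⟩ ⟨y, hy, hyf⟩
    obtain ⟨_, ⟨z, hz, rfl⟩, k, hk, he⟩ := S.exists_onEdge_of_isPreconnected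
      (hB.image (fun z => z - w) (by fun_prop)) ⟨_, ⟨x, hx, rfl⟩, inside x hxf⟩
      ⟨_, ⟨y, hy, rfl⟩, outside y hyf⟩
    refine ⟨z, hz, ?_⟩
    by_cases hk' : k + 1 < S.m
    · exact Or.inl ((hA z).2 (Or.inr (Or.inr ⟨k, hk', he⟩)))
    · right
      have h1 := (edge_near k hk _ he).2
      rw [show k + 1 = S.m by omega, S.V_per, hS0] at h1
      rwa [dist_eq_norm, ← sub_sub, ← dist_eq_norm]
  have hv_mem : w + v ∈ A.carrier := (hA _).2 (Or.inr (Or.inl (by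
    rw [hS0]; exact right_mem_segment ℝ _ _)))
  have hs'0 : 0 < s' := by linarith
  refine ⟨A, hA0, ?_, ?_, min (s' / 2) (ρ / 3), by positivity, ?_⟩
  · intro x hx
    rcases (hA x).1 hx with hx | hx | ⟨k, hk, hx⟩
    · exact Or.inl (tail_sub hx)
    · right
      refine mem_thickening_frontier hK hne (hs'0.trans_le (ray_f x hx).1) ?_
      by_cases hxh : x = h
      · rw [hxh]; change f h < η; rw [hfh]; exact hsη
      · exact ((ray_f x hx).2 hxh).trans hsη
    · right
      have := edge_f k (by omega) _ hx
      rw [add_sub_cancel] at this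
      exact mem_thickening_frontier hK hne ((half_pos hs'0).trans this.1) (this.2.trans hsη)
  · intro p' hp'
    obtain ⟨y, hy, hys⟩ := hnet p' hp'
    obtain ⟨z, hz, hz'⟩ := cross _ (convex_segment p' y).isPreconnected
      ⟨p', left_mem_segment ℝ _ _, by
        simp only [f, Metric.infDist_zero_of_mem (hK.isClosed.frontier_subset hp')]; linarith⟩
      ⟨y, right_mem_segment ℝ _ _, hss₀.le.trans hys.le⟩
    have hpz : dist p' z < η / 2 := by
      have hb : segment ℝ p' y ⊆ Metric.ball p' (η / 2) :=
        (convex_ball p' (η / 2)).segment_subset (Metric.mem_ball_self (half_pos hη))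
          (by rw [Metric.mem_ball, dist_comm]; exact hy)
      have := hb hz
      rwa [Metric.mem_ball, dist_comm] at this
    rw [Metric.mem_thickening_iff]
    rcases hz' with hz' | hz'
    · exact ⟨z, hz', by linarith⟩
    · exact ⟨w + v, hv_mem, by linarith [dist_triangle p' z (w + v)]⟩
  · rintro B hB ⟨x, hxB, hx⟩ ⟨y, hyB, hy⟩ hBC
    rw [Metric.mem_thickening_iff_infDist_lt hne] at hx hy
    obtain ⟨z, hz, hz'⟩ := cross B hB ⟨x, hxB, hx.trans_le (min_le_left _ _)⟩
      ⟨y, hyB, hsη.le.trans (not_lt.1 hy)⟩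
    rcases hz' with hz' | hz'
    · exact ⟨z, hz, hz'⟩
    -- Slipping through the gap would bring `B`, and with it `C`, too close to `h`: the distances
    -- from `C` to `z`, from `z` to `w + v` and from `w + v` to `h` are each less than `ρ / 3`.
    · exfalso
      obtain ⟨d, hd, hzd⟩ := Metric.mem_thickening_iff.1 (hBC hz)
      have h1 := hzd.trans_le (min_le_right _ _)
      have h2 : dist d h < ρ := by
        have := dist_triangle4 d z (w + v) h
        rw [dist_comm d z] at this
        linarith
      exact hρC h2 hd

/-! ### Visibility regions -/

section Visibility
variable {n : ℕ} {P : Polygon Plane n} {η σ : ℝ}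

theorem mem_Vis_iff {w q : Plane} :
    q ∈ Vis P w ↔ ∀ t ∈ Icc (0 : ℝ) 1, w + t • (q - w) ∈ region P := by
  constructor
  · intro h t ht
    refine h.2 ⟨1 - t, t, by linarith [ht.2], ht.1, by ring, by module⟩
  · intro h
    refine ⟨by simpa using h 1 (by norm_num), ?_⟩
    rintro _ ⟨a, b, ha, hb, hab, rfl⟩
    have := h b ⟨hb, by linarith⟩
    have e : a = 1 - b := by linarith
    rw [e]
    convert this using 1; module

theorem Vis_subset_region (w : Plane) : Vis P w ⊆ region P := fun _ h => h.1

theorem IsOuterSide.isCompact_Vis (h : IsOuterSide P η σ) (w : Plane) :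
    IsCompact (Vis P w) := by
  refine h.isCompact_region.of_isClosed_subset ?_ (Vis_subset_region w)
  have : Vis P w = ⋂ t ∈ Icc (0 : ℝ) 1, (fun q => w + t • (q - w)) ⁻¹' region P := by
    ext q; simp only [mem_Vis_iff, mem_iInter, mem_preimage]
  rw [this]
  exact isClosed_biInter fun t _ => h.isClosed_region.preimage (by fun_prop)

theorem starConvex_Vis (w : Plane) : StarConvex ℝ w (Vis P w) := by
  intro q hq a b ha hb hab
  rw [mem_Vis_iff] at hq ⊢
  intro t ht
  have := hq (t * b) ⟨mul_nonneg ht.1 hb, mul_le_one₀ ht.2 hb (by linarith)⟩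
  have e : a = 1 - b := by linarith
  rw [e]
  convert this using 1; module

theorem self_mem_Vis {w : Plane} (hw : w ∈ region P) : w ∈ Vis P w :=
  mem_Vis_iff.2 fun t _ => by simpa using hw

/-- Boundary points of the polygon are limits of outer collar points, so they are interior neither
to the region nor to any subset of it. -/
theorem IsOuterSide.boundary_inter_Vis_subset (h : IsOuterSide P η σ) (hP : IsSimplePolygon P)
    (w : Plane) : Vis P w ∩ P.boundary ℝ ⊆ frontier (Vis P w) := fun _ hx =>
  ⟨subset_closure hx.1, fun hi =>
    h.boundary_disjoint_interior hP hx.2 (interior_mono (Vis_subset_region w) hi)⟩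

theorem Vis_mem_nhds {w : Plane} (hw : w ∈ polygonInterior P) : Vis P w ∈ 𝓝 w := by
  obtain ⟨r, hr, hr'⟩ := Metric.isOpen_iff.1 (isOpen_polygonInterior P) w hw
  filter_upwards [Metric.ball_mem_nhds w hr] with q hq
  have hs := (convex_ball w r).segment_subset (Metric.mem_ball_self hr) hq
  exact ⟨Or.inr (hr' hq), fun z hz => Or.inr (hr' (hs hz))⟩

/-- A ray leaves the visibility region through the boundary of the polygon. -/
theorem IsOuterSide.exists_exit_ray (h : IsOuterSide P η σ) {w v : Plane} (hv : v ≠ 0)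
    (hwv : w + v ∈ Vis P w) : ∃ τ : ℝ, 1 ≤ τ ∧ w + τ • v ∈ Vis P w ∩ P.boundary ℝ := by
  have hK := h.isCompact_Vis w
  have hc : Continuous fun τ : ℝ => w + τ • v := by fun_prop
  obtain ⟨C, hC⟩ := hK.isBounded.exists_norm_le
  have hv' : 0 < ‖v‖ := norm_pos_iff.2 hv
  have hcomp : IsCompact (Icc 1 ((C + ‖w‖) / ‖v‖) ∩ {τ : ℝ | w + τ • v ∈ Vis P w}) :=
    isCompact_Icc.inter_right (hK.isClosed.preimage hc)
  have hle : ∀ τ : ℝ, 1 ≤ τ → w + τ • v ∈ Vis P w → τ ≤ (C + ‖w‖) / ‖v‖ := by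
    intro τ hτ hm
    rw [le_div_iff₀ hv']
    have h1 := hC _ hm
    have h2 := norm_sub_le (w + τ • v) w
    rw [add_sub_cancel_left, norm_smul, Real.norm_of_nonneg (by linarith)] at h2
    linarith
  have h1m : w + (1 : ℝ) • v ∈ Vis P w := by rwa [one_smul]
  -- At the last visible point of the ray: were it in the open interior, the line of sight could be
  -- prolonged by `r / 2`.
  obtain ⟨τ, ⟨⟨hτ1, -⟩, hτm⟩, hmax⟩ := hcomp.exists_isGreatest
    ⟨1, ⟨⟨le_rfl, hle 1 le_rfl h1m⟩, h1m⟩⟩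
  have hτm : w + τ • v ∈ Vis P w := hτm
  refine ⟨τ, hτ1, hτm, ?_⟩
  by_contra hb
  have hint : w + τ • v ∈ polygonInterior P := (Vis_subset_region w hτm).resolve_left hb
  obtain ⟨r, hr, hr'⟩ := Metric.isOpen_iff.1 ((isOpen_polygonInterior P).preimage hc) τ hint
  have hmem : w + (τ + r / 2) • v ∈ Vis P w := by
    rw [mem_Vis_iff]
    intro t ht
    have e : w + t • (w + (τ + r / 2) • v - w) = w + (t * (τ + r / 2)) • v := by module
    rw [e]
    have hτ0 : 0 < τ := by linarith
    rcases le_total (t * (τ + r / 2)) τ with hle' | hle'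
    · have := mem_Vis_iff.1 hτm (t * (τ + r / 2) / τ)
        ⟨div_nonneg (mul_nonneg ht.1 (by linarith)) hτ0.le, (div_le_one hτ0).2 hle'⟩
      rw [add_sub_cancel_left, smul_smul, div_mul_cancel₀ _ hτ0.ne'] at this
      exact this
    · refine Or.inr (hr' ?_)
      rw [Metric.mem_ball, Real.dist_eq, abs_of_nonneg (by linarith)]
      have : t * (τ + r / 2) ≤ τ + r / 2 := mul_le_of_le_one_left (by linarith) ht.2
      linarith
  have := hmax ⟨⟨by linarith, hle _ (by linarith) hmem⟩, hmem⟩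
  linarith

theorem ray_mem_Vis {w v : Plane} {τ : ℝ} (hτ : 0 < τ) (hm : w + τ • v ∈ Vis P w) {t : ℝ}
    (ht : t ∈ Icc 0 τ) : w + t • v ∈ Vis P w := by
  have := starConvex_Vis w hm (a := 1 - t / τ) (b := t / τ)
    (by rw [sub_nonneg, div_le_one hτ]; exact ht.2) (div_nonneg ht.1 hτ.le) (by ring)
  convert this using 1
  have e : (t / τ) • (w + τ • v) = (t / τ) • w + t • v := by
    rw [smul_add, smul_smul, div_mul_cancel₀ _ hτ.ne']
  rw [e]; module

theorem exists_small_mem_Vis {w : Plane} (hw : w ∈ polygonInterior P) (v : Plane) :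
    ∃ t : ℝ, 0 < t ∧ w + t • v ∈ Vis P w := by
  have hc : Continuous fun τ : ℝ => w + τ • v := by fun_prop
  have := hc.continuousWithinAt.tendsto (x := (0 : ℝ)) (s := Ioi 0)
  rw [zero_smul, add_zero] at this
  obtain ⟨t, h1, h2⟩ := ((this.eventually (Vis_mem_nhds hw)).and self_mem_nhdsWithin).exists
  exact ⟨t, h2, h1⟩

theorem segment_ray_subset {w v : Plane} {a b : ℝ} {S : Set Plane} (hab : a ≤ b)
    (hS : ∀ t ∈ Icc a b, w + t • v ∈ S) : segment ℝ (w + a • v) (w + b • v) ⊆ S := by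
  rintro _ ⟨c, d, hc, hd, hcd, rfl⟩
  have e : c • (w + a • v) + d • (w + b • v) = w + (c * a + d * b) • v := by
    have : c = 1 - d := by linarith
    rw [this]; module
  rw [e]
  have hc' : c = 1 - d := by linarith
  refine hS _ ⟨?_, ?_⟩ <;> rw [hc'] <;> nlinarith

/-- From every visible point one can reach the boundary of the polygon within the visibility
region. -/
theorem IsOuterSide.exists_exit (h : IsOuterSide P η σ) {w q : Plane} (hw : w ∈ region P)
    (hq : q ∈ Vis P w) : ∃ p ∈ Vis P w ∩ P.boundary ℝ, segment ℝ q p ⊆ Vis P w := by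
  rcases eq_or_ne q w with rfl | hne
  · rcases hw with hw | hw
    · exact ⟨q, ⟨hq, hw⟩, by simpa using hq⟩
    · obtain ⟨t, ht, htm⟩ := exists_small_mem_Vis hw (dir 0)
      have hd : dir 0 ≠ 0 := norm_pos_iff.1 (by rw [norm_dir]; exact one_pos)
      obtain ⟨τ, hτ, hτm⟩ := h.exists_exit_ray (smul_ne_zero ht.ne' hd) htm
      refine ⟨_, hτm, ?_⟩
      have := segment_ray_subset (w := q) (v := t • dir 0) (S := Vis P q) (a := 0) (b := τ)
        (by linarith) (fun c hc => ray_mem_Vis (by linarith) hτm.1 hc)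
      rwa [zero_smul, add_zero] at this
  · obtain ⟨τ, hτ, hτm⟩ := h.exists_exit_ray (sub_ne_zero.2 hne) (by rwa [add_sub_cancel])
    refine ⟨_, hτm, ?_⟩
    have := segment_ray_subset (w := w) (v := q - w) (S := Vis P w) (a := 1) (b := τ) hτ
      (fun c hc => ray_mem_Vis (by linarith) hτm.1 ⟨by linarith [hc.1], hc.2⟩)
    rwa [one_smul, add_sub_cancel] at this

/-- From every frontier point of a visibility region one can reach the boundary of the polygon
within the frontier. -/
theorem IsOuterSide.exists_exit_frontier (h : IsOuterSide P η σ) {w q : Plane} (hw : w ∈ region P)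
    (hq : q ∈ frontier (Vis P w)) :
    ∃ p ∈ Vis P w ∩ P.boundary ℝ, segment ℝ q p ⊆ frontier (Vis P w) := by
  have hcl := (h.isCompact_Vis w).isClosed
  have hqV : q ∈ Vis P w := hcl.frontier_subset hq
  rcases eq_or_ne q w with rfl | hne
  · rcases hw with hw | hw
    · exact ⟨q, ⟨hqV, hw⟩, by simpa using hq⟩
    · exact absurd (mem_interior_iff_mem_nhds.2 (Vis_mem_nhds hw)) hq.2
  · obtain ⟨τ, hτ, hτm⟩ := h.exists_exit_ray (sub_ne_zero.2 hne) (by rwa [add_sub_cancel])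
    refine ⟨_, hτm, ?_⟩
    have := segment_ray_subset (w := w) (v := q - w) (S := frontier (Vis P w)) (a := 1) (b := τ) hτ
      (fun c hc => by
        refine ⟨subset_closure (ray_mem_Vis (by linarith) hτm.1 ⟨by linarith [hc.1], hc.2⟩),
          fun hi => hq.2 ?_⟩
        have hc0 : 0 < c := by linarith [hc.1]
        -- Dilating from `w` by `c ≥ 1` pulls a visible neighbourhood of the far point back to a
        -- neighbourhood of `q`, which is visible by star-shapedness. So beyond a frontier point,
        -- the visible part of the ray stays in the frontier.
        have hcont : Continuous fun z => w + c • (z - w) := by fun_prop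
        rw [mem_interior]
        refine ⟨(fun z => w + c • (z - w)) ⁻¹' interior (Vis P w), fun z hz => ?_,
          isOpen_interior.preimage hcont, hi⟩
        have := ray_mem_Vis (t := 1) hc0 (interior_subset hz) ⟨by norm_num, hc.1⟩
        rwa [one_smul, add_sub_cancel] at this)
    rwa [one_smul, add_sub_cancel] at this

theorem exists_mem_frontier_of_segment {S : Set Plane} {a b : Plane} (ha : a ∈ S) (hb : b ∉ S) :
    ∃ x ∈ segment ℝ a b, x ∈ frontier S := by
  have hpre : IsPreconnected (segment ℝ a b) := (convex_segment a b).isPreconnected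
  obtain ⟨x, hx, h1, h2⟩ := isPreconnected_closed_iff.1 hpre (closure S) (closure Sᶜ)
    isClosed_closure isClosed_closure
    (fun x _ => (em (x ∈ S)).imp (fun h => subset_closure h) fun h => subset_closure h)
    ⟨a, left_mem_segment ℝ _ _, subset_closure ha⟩ ⟨b, right_mem_segment ℝ _ _, subset_closure hb⟩
  exact ⟨x, hx, by rw [frontier_eq_closure_inter_closure]; exact ⟨h1, h2⟩⟩

/-- If two visibility regions meet, so do their frontiers. -/
theorem IsOuterSide.frontier_inter_nonempty (h : IsOuterSide P η σ) (hP : IsSimplePolygon P)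
    {w w' : Plane} (hw : w ∈ region P) (hw' : w' ∈ region P)
    (hne : (Vis P w ∩ Vis P w').Nonempty) :
    (frontier (Vis P w) ∩ frontier (Vis P w')).Nonempty := by
  obtain ⟨q, hq, hq'⟩ := hne
  obtain ⟨p, hp, hpq⟩ := h.exists_exit hw hq
  by_cases hp' : p ∈ Vis P w'
  · exact ⟨p, h.boundary_inter_Vis_subset hP w hp,
      h.boundary_inter_Vis_subset hP w' ⟨hp', hp.2⟩⟩
  -- The way from `q` out to `p` stays in `Vis P w` and leaves `Vis P w'` at `r`. From `r` a second
  -- way leads within the frontier of `Vis P w'` to a boundary point `p'`. Either `p'` is visible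
  -- from `w`, or this second way crosses the frontier of `Vis P w`.
  · obtain ⟨r, hr, hr'⟩ := exists_mem_frontier_of_segment hq' hp'
    obtain ⟨p', hp', hrp'⟩ := h.exists_exit_frontier hw' hr'
    by_cases hpV : p' ∈ Vis P w
    · exact ⟨p', h.boundary_inter_Vis_subset hP w ⟨hpV, hp'.2⟩,
        h.boundary_inter_Vis_subset hP w' hp'⟩
    · obtain ⟨z, hz, hz'⟩ := exists_mem_frontier_of_segment (hpq hr) hpV
      exact ⟨z, hz', hrp' hz⟩

/-- Every point of the polygon sees infinitely many boundary points. -/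
theorem IsOuterSide.infinite_Vis_inter_boundary (h : IsOuterSide P η σ) (hP : IsSimplePolygon P)
    {w : Plane} (hw : w ∈ region P) : (Vis P w ∩ P.boundary ℝ).Infinite := by
  rcases hw with hw | hw
  · obtain ⟨i, hi⟩ := mem_iUnion.1 hw
    have hsub : P.edgeSet ℝ i ⊆ Vis P w ∩ P.boundary ℝ := by
      intro x hx
      -- A boundary point sees the whole edge on which it lies.
      have hxb : x ∈ P.boundary ℝ := mem_iUnion.2 ⟨i, hx⟩
      refine ⟨⟨Or.inl hxb, fun z hz => Or.inl (mem_iUnion.2 ⟨i, ?_⟩)⟩, hxb⟩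
      rw [edgeSet_eq_segment] at hi hx ⊢
      exact (convex_segment _ _).segment_subset hi hx hz
    refine Infinite.mono hsub ?_
    have : (fun s : ℝ => P i + s • edgeVec P i) '' Icc 0 1 ⊆ P.edgeSet ℝ i := by
      rintro _ ⟨s, hs, rfl⟩
      exact (mem_edgeSet_iff P i _).2 ⟨s, hs, rfl⟩
    refine Infinite.mono this (Infinite.image ?_ (Icc_infinite zero_lt_one))
    intro s _ s' _ hss
    exact smul_left_injective ℝ (hP.edgeVec_ne_zero i) (add_left_cancel hss)
  · have hd : ∀ θ, dir θ ≠ 0 := fun θ => norm_pos_iff.1 (by rw [norm_dir]; exact one_pos)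
    have hex : ∀ θ : ℝ, ∃ τ : ℝ, 0 < τ ∧ w + τ • dir θ ∈ Vis P w ∩ P.boundary ℝ := by
      intro θ
      obtain ⟨t, ht, htm⟩ := exists_small_mem_Vis hw (dir θ)
      obtain ⟨τ, hτ, hτm⟩ := h.exists_exit_ray (smul_ne_zero ht.ne' (hd θ)) htm
      rw [smul_smul] at hτm
      exact ⟨τ * t, mul_pos (by linarith) ht, hτm⟩
    choose τ hτ hτm using hex
    have : (fun θ : ℝ => w + τ θ • dir θ) '' Icc 0 1 ⊆ Vis P w ∩ P.boundary ℝ := by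
      rintro _ ⟨θ, -, rfl⟩
      exact hτm θ
    refine Infinite.mono this (Infinite.image ?_ (Icc_infinite zero_lt_one))
    intro θ hθ θ' hθ' he
    have he := add_left_cancel he
    have hn := congrArg norm he
    rw [norm_smul, norm_smul, norm_dir, norm_dir, Real.norm_of_nonneg (hτ θ).le,
      Real.norm_of_nonneg (hτ θ').le, mul_one, mul_one] at hn
    rw [hn] at he
    have hpi := Real.pi_gt_three
    exact dir_eq_iff (by linarith [hθ.2, hθ'.1]) (by linarith [hθ'.2, hθ.1])
      (smul_right_injective _ (hτ θ').ne' he)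

end Visibility

/-! ### Choosing the strings -/

theorem exists_injective_choice {ι β : Type*} [Finite ι] (S : ι → Set β)
    (hS : ∀ i, (S i).Infinite) : ∃ p : ι → β, Function.Injective p ∧ ∀ i, p i ∈ S i := by
  classical
  have := Fintype.ofFinite ι
  have key : ∀ F : Finset ι, ∃ p : ι → β, InjOn p F ∧ ∀ i, p i ∈ S i := by
    intro F
    induction F using Finset.induction_on with
    | empty =>
      choose p hp using fun i => (hS i).nonempty
      exact ⟨p, by simp, hp⟩
    | insert a F ha ih =>
      obtain ⟨p, hp, hpS⟩ := ih
      obtain ⟨b, hb, hbF⟩ := (hS a).exists_notMem_finset (F.image p)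
      refine ⟨Function.update p a b, ?_, fun i => ?_⟩
      · have e : ∀ i ∈ F, Function.update p a b i = p i := fun i hi =>
          Function.update_of_ne (ne_of_mem_of_not_mem hi ha) _ _
        rw [Finset.coe_insert, injOn_insert (by simpa using ha)]
        refine ⟨fun i hi j hj hij => hp hi hj (by rwa [e i hi, e j hj] at hij), ?_⟩
        rintro ⟨i, hi, hib⟩
        rw [Function.update_self, e i hi] at hib
        exact hbF (Finset.mem_image.2 ⟨i, hi, hib⟩)
      · rcases eq_or_ne i a with rfl | hia
        · rwa [Function.update_self]
        · rw [Function.update_of_ne hia]; exact hpS i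
  obtain ⟨p, hp, hpS⟩ := key Finset.univ
  exact ⟨p, by simpa using hp, hpS⟩

/-- Objects can be chosen one after the other, each fine enough for all the previous ones. -/
theorem exists_sequential_choice {ι A : Type*} [Finite ι] (Good Trap : ι → ℝ → A → Prop)
    (hex : ∀ i, ∀ η > 0, ∃ a, Good i η a ∧ ∃ r > 0, Trap i r a)
    (mono : ∀ i a η η', η ≤ η' → Good i η a → Good i η' a) {η₀ : ℝ} (hη₀ : 0 < η₀) :
    ∃ f : ι → A, (∀ i, Good i η₀ (f i)) ∧ ∀ i j, i ≠ j →
      (∃ r > 0, Trap i r (f i) ∧ Good j r (f j)) ∨ (∃ r > 0, Trap j r (f j) ∧ Good i r (f i)) := by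
  classical
  have := Fintype.ofFinite ι
  -- The induction keeps an object with a trap radius for every index, including those not yet
  -- treated. The object at `a` is replaced by one finer than all current radii, so every earlier
  -- trap works on it.
  have key : ∀ F : Finset ι, ∃ f : ι → A, (∀ i, Good i η₀ (f i)) ∧
      (∀ i, ∃ r > 0, Trap i r (f i)) ∧ ∀ i ∈ F, ∀ j ∈ F, i ≠ j →
      (∃ r > 0, Trap i r (f i) ∧ Good j r (f j)) ∨ (∃ r > 0, Trap j r (f j) ∧ Good i r (f i)) := by
    intro F
    induction F using Finset.induction_on with
    | empty =>
      choose f hf hf' using fun i => hex i η₀ hη₀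
      exact ⟨f, hf, hf', by simp⟩
    | insert a F ha ih =>
      obtain ⟨f, hf, hfr, hfF⟩ := ih
      choose r hr hrT using hfr
      obtain ⟨η, hη, hηr⟩ : ∃ η > 0, η ≤ η₀ ∧ ∀ i, η ≤ r i := by
        have h1 : ∀ᶠ η in 𝓝[>] (0 : ℝ), ∀ i, η ≤ r i := eventually_all.2 fun i => by
          filter_upwards [Ioo_mem_nhdsGT (hr i)] with η hη using hη.2.le
        obtain ⟨η, ⟨h1, h2⟩, h3⟩ := (h1.and (Ioo_mem_nhdsGT hη₀)).exists.imp
          fun η h => (⟨⟨h.1, h.2.2.le⟩, h.2.1⟩ : ((∀ i, η ≤ r i) ∧ η ≤ η₀) ∧ 0 < η)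
        exact ⟨η, h3, h2, h1⟩
      obtain ⟨x, hx, hxr⟩ := hex a η hη
      have e : ∀ i, i ≠ a → Function.update f a x i = f i := fun i hi =>
        Function.update_of_ne hi _ _
      have ea : Function.update f a x a = x := Function.update_self _ _ _
      refine ⟨Function.update f a x, fun i => ?_, fun i => ?_, fun i hi j hj hij => ?_⟩
      · rcases eq_or_ne i a with rfl | hia
        · rw [ea]; exact mono _ _ _ _ hηr.1 hx
        · rw [e i hia]; exact hf i
      · rcases eq_or_ne i a with rfl | hia
        · rw [ea]; exact hxr
        · rw [e i hia]; exact ⟨r i, hr i, hrT i⟩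
      · rcases eq_or_ne i a with rfl | hia
        · right
          rw [ea, e j hij.symm]
          exact ⟨r j, hr j, hrT j, mono _ _ _ _ (hηr.2 j) hx⟩
        · rcases eq_or_ne j a with rfl | hja
          · left
            rw [ea, e i hia]
            exact ⟨r i, hr i, hrT i, mono _ _ _ _ (hηr.2 i) hx⟩
          · rw [e i hia, e j hja]
            exact hfF i (Finset.mem_of_mem_insert_of_ne hi hia) j
              (Finset.mem_of_mem_insert_of_ne hj hja) hij
  obtain ⟨f, h1, -, h3⟩ := key Finset.univ
  exact ⟨f, h1, fun i j hij => h3 i (Finset.mem_univ _) j (Finset.mem_univ _) hij⟩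

/-! ### The strings of a finite set of points -/

section Strings
variable {n : ℕ} {P : Polygon Plane n} {η σ : ℝ}

/-- Two collar fibres that meet anywhere coincide, even when the common fibre sits at a vertex and
is described by two edges. Hence tails with different feet are disjoint. -/
theorem IsCollarWidth.collar_eq (h : IsCollarWidth P η) (hP : IsSimplePolygon P)
    {i j : Fin n} {s s' t t' : ℝ} (hs : s ∈ Icc (0 : ℝ) 1) (hs' : s' ∈ Icc (0 : ℝ) 1)
    (ht : |t| < η) (ht' : |t'| < η) (heq : collar P i s t = collar P j s' t') (τ : ℝ) :
    collar P i s τ = collar P j s' τ := by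
  rcases (h.collar_inj hP hs hs' ht ht' heq).2 with ⟨rfl, rfl⟩ | ⟨rfl, rfl, rfl⟩ | ⟨rfl, rfl, rfl⟩
  · rfl
  · exact collar_one P i τ
  · exact (collar_one P j τ).symm

theorem segment_collar_eq (i : Fin n) (s σ : ℝ) {δ : ℝ} (hδ : 0 < δ) (x : Plane) :
    x ∈ segment ℝ (collar P i s (σ * δ)) (collar P i s 0) ↔
      ∃ t ∈ Icc 0 δ, collar P i s (σ * t) = x := by
  constructor
  · rintro ⟨a, b, ha, hb, hab, rfl⟩
    refine ⟨a * δ, ⟨by positivity, by nlinarith⟩, ?_⟩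
    have : b = 1 - a := by linarith
    rw [this]; simp only [collar]; module
  · rintro ⟨t, ht, rfl⟩
    refine ⟨t / δ, 1 - t / δ, div_nonneg ht.1 hδ.le, ?_, by ring, ?_⟩
    · rw [sub_nonneg, div_le_one hδ]; exact ht.2
    · have e : σ * t = σ * ((t / δ) * δ) := by field_simp
      rw [e]
      simp only [collar]
      module

/-- The strings of a set of points of a simple polygon. -/
theorem IsOuterSide.exists_strings (h : IsOuterSide P η σ) (hP : IsSimplePolygon P)
    {F : Finset Plane} (hF : (F : Set Plane) ⊆ region P) {ε : ℝ} (hε : 0 < ε) :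
    ∃ δ₀ > 0, ∀ δ, 0 < δ → δ < δ₀ → ∃ Str : F → PolygonalString,
      (∀ w, (Str w).origin ∈ (offset P (σ * δ)).boundary ℝ ∧
        (Str w).carrier \ {(Str w).origin} ⊆ polygonInterior (offset P (σ * δ))) ∧
      (Function.Injective fun w => (Str w).origin) ∧
      (∀ w : F, (Str w).carrier ⊆ Metric.thickening ε (frontier (Vis P w)) ∧
        frontier (Vis P w) ⊆ Metric.thickening ε (Str w).carrier) ∧
      (∀ w w' : F, ((Str w).carrier ∩ (Str w').carrier).Nonempty ↔
        (Vis P w ∩ Vis P w').Nonempty) := by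
  have hFr : ∀ w : F, (w : Plane) ∈ region P := fun w => hF w.2
  obtain ⟨p, hp_inj, hp⟩ := exists_injective_choice (fun w : F => Vis P w ∩ P.boundary ℝ)
    fun w => h.infinite_Vis_inter_boundary hP (hFr w)
  have hp' : ∀ w, ∃ i, ∃ s ∈ Icc (0 : ℝ) 1, collar P i s 0 = p w := by
    intro w
    obtain ⟨i, s, hs, e⟩ := (mem_boundary_iff P _).1 (hp w).2
    exact ⟨i, s, hs, by rw [collar_zero, e]⟩
  choose ι u hu hpu using hp'
  have hM := mitreBound_nonneg P
  -- Below `η` the tails lie in the collar; the second bound keeps them within `ε` of their feet,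
  -- with `+ 1` to avoid a zero denominator.
  refine ⟨min η (ε / (mitreBound P + 1)), lt_min h.pos (by positivity), fun δ hδ0 hδ => ?_⟩
  obtain ⟨hδη, hδε⟩ := lt_min_iff.1 hδ
  have hδ' : δ ∈ Ioo 0 η := ⟨hδ0, hδη⟩
  let o : F → Plane := fun w => collar P (ι w) (u w) (σ * δ)
  let T : F → Set Plane := fun w => segment ℝ (o w) (p w)
  have hT : ∀ w x, x ∈ T w ↔ ∃ t ∈ Icc 0 δ, collar P (ι w) (u w) (σ * t) = x := by
    intro w x
    rw [← segment_collar_eq _ _ _ hδ0, hpu]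
  have habs : ∀ t ∈ Icc 0 δ, |σ * t| < η := fun t ht => h.abs_lt ⟨ht.1, ht.2.trans_lt hδη⟩
  have T_region : ∀ w, T w ∩ region P ⊆ {p w} := by
    rintro w x ⟨hx, hxr⟩
    obtain ⟨t, ht, rfl⟩ := (hT w x).1 hx
    rcases eq_or_lt_of_le ht.1 with rfl | h0
    · rw [mul_zero, hpu]; rfl
    · exact absurd hxr (h.collar_notMem_region hP (hu w) ⟨h0, ht.2.trans_lt hδη⟩)
  have T_disj : ∀ w w', w ≠ w' → Disjoint (T w) (T w') := by
    intro w w' hne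
    rw [Set.disjoint_left]
    intro x hx hx'
    obtain ⟨t, ht, rfl⟩ := (hT w x).1 hx
    obtain ⟨t', ht', e⟩ := (hT w' _).1 hx'
    refine hne (hp_inj ?_)
    rw [← hpu, ← hpu]
    exact h.collar_eq hP (hu w) (hu w') (habs t ht) (habs t' ht') e.symm 0
  have o_bd : ∀ w, o w ∈ (offset P (σ * δ)).boundary ℝ := fun w =>
    (mem_boundary_offset_iff P _ _).2 ⟨_, _, hu w, rfl⟩
  have o_not : ∀ w, o w ∉ polygonInterior (offset P (σ * δ)) := fun w hw => hw.1 (o_bd w)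
  have o_T : ∀ w, o w ∈ T w := fun w => left_mem_segment ℝ _ _
  have T_int : ∀ w, T w \ {o w} ⊆ polygonInterior (offset P (σ * δ)) := by
    rintro w x ⟨hx, hxo⟩
    obtain ⟨t, ht, rfl⟩ := (hT w x).1 hx
    refine h.collar_mem_offset hP hδ' (hu w) ⟨ht.1, lt_of_le_of_ne ht.2 ?_⟩
    rintro rfl
    exact hxo rfl
  have T_comp : ∀ w, IsCompact (T w) := fun w => isCompact_segment _ _
  have T_near : ∀ w, ∀ x ∈ T w, dist x (p w) < ε := by
    intro w x hx
    obtain ⟨t, ht, rfl⟩ := (hT w x).1 hx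
    rw [← hpu]
    refine (dist_collar_le P _ (hu w) _ _).trans_lt ?_
    rw [sub_zero, h.abs_sign_mul, abs_of_nonneg ht.1]
    have h1 : δ * (mitreBound P + 1) < ε := (lt_div_iff₀ (by linarith)).1 hδε
    nlinarith [ht.2]
  have K_comp : ∀ w : F, IsCompact (Vis P w) := fun w => h.isCompact_Vis w
  have K_self : ∀ w : F, (w : Plane) ∈ Vis P w := fun w => self_mem_Vis (hFr w)
  -- scales
  obtain ⟨η₁, hη₁, hη₁'⟩ := h.isCompact_region.exists_thickening_subset_open
    (isOpen_polygonInterior (offset P (σ * δ))) (h.region_subset hP hδ')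
  have hsep : ∀ᶠ r in 𝓝[>] (0 : ℝ), ∀ w w' : F, ¬ (Vis P w ∩ Vis P w').Nonempty →
      Disjoint (Metric.thickening r (T w ∪ Vis P w)) (Metric.thickening r (T w' ∪ Vis P w')) := by
    refine eventually_all.2 fun w => eventually_all.2 fun w' => ?_
    by_cases hne : (Vis P w ∩ Vis P w').Nonempty
    · filter_upwards with r hr
      exact absurd hne hr
    · have hww : w ≠ w' := by
        rintro rfl
        exact hne ⟨w, K_self w, K_self w⟩
      have hd : Disjoint (T w ∪ Vis P w) (T w' ∪ Vis P w') := by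
        rw [Set.disjoint_left]
        rintro x (hx | hx) (hx' | hx')
        · exact Set.disjoint_left.1 (T_disj w w' hww) hx hx'
        · have : x = p w := T_region w ⟨hx, Vis_subset_region _ hx'⟩
          exact hne ⟨x, this ▸ (hp w).1, hx'⟩
        · have : x = p w' := T_region w' ⟨hx', Vis_subset_region _ hx⟩
          exact hne ⟨x, hx, this ▸ (hp w').1⟩
        · exact hne ⟨x, hx, hx'⟩
      obtain ⟨r, hr, hr'⟩ := hd.exists_thickenings ((T_comp w).union (K_comp w))
        ((T_comp w').union (K_comp w')).isClosed
      filter_upwards [Ioo_mem_nhdsGT hr] with r₁ hr₁ _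
      exact hr'.mono (Metric.thickening_mono hr₁.2.le _) (Metric.thickening_mono hr₁.2.le _)
  -- The scale `η₀` separates strings of disjoint regions, respects `ε`, and keeps neighbourhoods of
  -- the regions inside the inflated polygon and hence away from the origins.
  obtain ⟨η₀, hsep, hη₀⟩ := (hsep.and (Ioo_mem_nhdsGT (lt_min hε hη₁))).exists
  have hη₀ε : η₀ ≤ ε := hη₀.2.le.trans (min_le_left _ _)
  have hη₀1 : η₀ ≤ η₁ := hη₀.2.le.trans (min_le_right _ _)
  have K_thick : ∀ w : F, Metric.thickening η₀ (Vis P w) ⊆ polygonInterior (offset P (σ * δ)) :=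
    fun w => ((Metric.thickening_mono hη₀1 _).trans
      (Metric.thickening_subset_of_subset _ (Vis_subset_region _))).trans hη₁'
  have fr_sub : ∀ w : F, frontier (Vis P w) ⊆ Vis P w := fun w =>
    (K_comp w).isClosed.frontier_subset
  -- Every other string runs near this set, while the tail of `w` touches it only at its foot `p w`.
  let C : F → Set Plane := fun w => region P ∪ ⋃ w' ∈ {w' | w' ≠ w}, T w'
  have C_closed : ∀ w, IsClosed (C w) := fun w => h.isClosed_region.union
    ((Set.toFinite _).isClosed_biUnion fun w' _ => (T_comp w').isClosed)
  have C_tail : ∀ w, T w ∩ C w ⊆ {p w} := by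
    rintro w x ⟨hx, hx' | hx'⟩
    · exact T_region w ⟨hx, hx'⟩
    · obtain ⟨w', hw', hx'⟩ := mem_iUnion₂.1 hx'
      exact absurd hx' (Set.disjoint_left.1 (T_disj w w' (Ne.symm hw')) hx)
  let Good : F → ℝ → PolygonalString → Prop := fun w r A => A.origin = o w ∧
    A.carrier ⊆ T w ∪ Metric.thickening r (frontier (Vis P w)) ∧
    frontier (Vis P w) ⊆ Metric.thickening r A.carrier
  -- Escape is measured at the fixed scale `η₀`; only the closeness to the region and to `C w` is
  -- measured by the trap radius `r`.
  let Trap : F → ℝ → PolygonalString → Prop := fun w r A => ∀ B : Set Plane, IsPreconnected B →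
    (B ∩ Metric.thickening r (Vis P w)).Nonempty →
    (B \ Metric.thickening η₀ (Vis P w)).Nonempty → B ⊆ Metric.thickening r (C w) →
    (B ∩ A.carrier).Nonempty
  obtain ⟨Str, hgood, htrap⟩ := exists_sequential_choice Good Trap
    (by
      intro w r hr
      have ho : o w ∉ Vis P w := fun hc =>
        h.collar_notMem_region hP (hu w) hδ' (Vis_subset_region _ hc)
      obtain ⟨A, hA0, hA1, hA2, r', hr', hA3⟩ := exists_string (K_comp w) (K_self w)
        (starConvex_Vis _) (hp w).1 ho (C_closed w) (C_tail w) (lt_min hr hη₀.1)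
      refine ⟨A, ⟨hA0, hA1.trans (union_subset_union_right _
        (Metric.thickening_mono (min_le_left _ _) _)),
        hA2.trans (Metric.thickening_mono (min_le_left _ _) _)⟩, r', hr', ?_⟩
      intro B hB h1 h2 h3
      exact hA3 B hB h1 (h2.mono (sdiff_subset_sdiff_right
        (Metric.thickening_mono (min_le_right _ _) _))) h3)
    (by
      rintro w A r r' hr ⟨h1, h2, h3⟩
      exact ⟨h1, h2.trans (union_subset_union_right _ (Metric.thickening_mono hr _)),
        h3.trans (Metric.thickening_mono hr _)⟩) hη₀.1
  have inter : ∀ w w' : F, w ≠ w' → (Vis P w ∩ Vis P w').Nonempty →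
      (∃ r > 0, Trap w r (Str w) ∧ Good w' r (Str w')) →
      ((Str w).carrier ∩ (Str w').carrier).Nonempty := by
    rintro w w' hne hV ⟨r, hr, htr, hgo⟩
    -- The string of `w'` satisfies the hypotheses of the trap: it comes near a common point of the
    -- two frontiers, its origin is outside the neighbourhood of `Vis P w`, and it stays near its
    -- own tail and the region.
    rw [inter_comm]
    apply htr _ (Str w').isPreconnected_carrier
    · obtain ⟨x, hx, hx'⟩ := h.frontier_inter_nonempty hP (hFr w) (hFr w') hV
      obtain ⟨y, hy, hxy⟩ := Metric.mem_thickening_iff.1 (hgo.2.2 hx')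
      exact ⟨y, hy, Metric.mem_thickening_iff.2 ⟨x, fr_sub w hx, by rwa [dist_comm]⟩⟩
    · refine ⟨_, (Str w').origin_mem_carrier, fun hc => ?_⟩
      rw [hgo.1] at hc
      exact o_not w' (K_thick w hc)
    · refine hgo.2.1.trans (union_subset ?_ ?_)
      · have hTC : T w' ⊆ C w := fun x hx => Or.inr (mem_iUnion₂.2 ⟨w', hne.symm, hx⟩)
        exact hTC.trans (Metric.self_subset_thickening hr _)
      · exact Metric.thickening_subset_of_subset _
          (((fr_sub w').trans (Vis_subset_region _)).trans subset_union_left)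
  refine ⟨Str, fun w => ⟨?_, ?_⟩, fun w w' hww => ?_, fun w => ⟨?_, ?_⟩, fun w w' => ⟨fun hi => ?_,
    fun hV => ?_⟩⟩
  · rw [(hgood w).1]; exact o_bd w
  · rintro x ⟨hx, hxo⟩
    rw [(hgood w).1] at hxo
    rcases (hgood w).2.1 hx with hx | hx
    · exact T_int w ⟨hx, hxo⟩
    · exact K_thick w (Metric.thickening_subset_of_subset _ (fr_sub w) hx)
  · by_contra hne
    simp only [(hgood _).1] at hww
    exact Set.disjoint_left.1 (T_disj w w' hne) (o_T w) (hww ▸ o_T w')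
  · intro x hx
    rcases (hgood w).2.1 hx with hx | hx
    · exact Metric.mem_thickening_iff.2 ⟨p w, h.boundary_inter_Vis_subset hP _ (hp w), T_near w x hx⟩
    · exact Metric.thickening_mono hη₀ε _ hx
  · exact (hgood w).2.2.trans (Metric.thickening_mono hη₀ε _)
  · by_contra hV
    obtain ⟨x, hx, hx'⟩ := hi
    have sub : ∀ w, (Str w).carrier ⊆ Metric.thickening η₀ (T w ∪ Vis P w) := fun w =>
      (hgood w).2.1.trans (union_subset (subset_union_left.trans
        (Metric.self_subset_thickening hη₀.1 _)) (Metric.thickening_subset_of_subset _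
          ((fr_sub w).trans subset_union_right)))
    exact Set.disjoint_left.1 (hsep w w' hV) (sub w hx) (sub w' hx')
  · rcases eq_or_ne w w' with rfl | hne
    · exact ⟨_, (Str w).origin_mem_carrier, (Str w).origin_mem_carrier⟩
    · rcases htrap w w' hne with h1 | h1
      · exact inter w w' hne hV h1
      · rw [inter_comm]
        exact inter w' w hne.symm (by rwa [inter_comm]) h1

end Strings

/-! ### Outerstring representations -/

theorem isOuterstring_of_curves {V : Type*} {G : SimpleGraph V} {R : ℝ} (hR : 0 < R)
    (γ : V → C(unitInterval, Plane)) (hinj : ∀ v, Function.Injective (γ v))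
    (h0 : ∀ v, ‖γ v 0‖ = R) (hin : ∀ v t, t ≠ 0 → ‖γ v t‖ < R)
    (hadj : ∀ u v, u ≠ v → (G.Adj u v ↔ (range (γ u) ∩ range (γ v)).Nonempty)) :
    IsOuterstring G := by
  have hR' : R⁻¹ ≠ 0 := inv_ne_zero hR.ne'
  have hnorm : ∀ x : Plane, ‖R⁻¹ • x‖ = R⁻¹ * ‖x‖ := fun x => by
    rw [norm_smul, Real.norm_of_nonneg (inv_nonneg.2 hR.le)]
  refine ⟨fun v => R⁻¹ • γ v, fun v => ⟨?_, ?_, ?_⟩,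
    fun u v huv => ?_⟩
  · intro s t hst
    exact hinj v (smul_right_injective _ hR' hst)
  · rw [mem_sphere_zero_iff_norm]
    change ‖R⁻¹ • γ v 0‖ = 1
    rw [hnorm, h0, inv_mul_cancel₀ hR.ne']
  · intro t ht
    rw [mem_ball_zero_iff]
    change ‖R⁻¹ • γ v t‖ < 1
    rw [hnorm, inv_mul_lt_one₀ hR]
    exact hin v t ht
  · rw [hadj u v huv]
    constructor
    · rintro ⟨_, ⟨s, rfl⟩, t, ht⟩
      exact ⟨R⁻¹ • γ u s, ⟨s, rfl⟩, t, by change R⁻¹ • γ v t = _; rw [ht]⟩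
    · rintro ⟨_, ⟨s, rfl⟩, t, ht⟩
      exact ⟨γ u s, ⟨s, rfl⟩, t, smul_right_injective _ hR' ht⟩

/-! ### Continuing the strings outside of the inflated polygon to a circle -/

section Exterior
variable {n : ℕ} {P : Polygon Plane n} {η σ : ℝ}

theorem not_isBounded_ray {y g : Plane} (hg : g ≠ 0) {S : Set Plane}
    (hS : ∀ x : ℝ, 0 < x → y + x • g ∈ S) : ¬ Bornology.IsBounded S := by
  intro hb
  obtain ⟨C, hC⟩ := hb.exists_norm_le
  have hg' : 0 < ‖g‖ := norm_pos_iff.2 hg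
  have hC0 : 0 ≤ C := (norm_nonneg _).trans (hC _ (hS 1 one_pos))
  set x := (C + ‖y‖ + 1) / ‖g‖
  have hx : 0 < x := by positivity
  have h1 := hC _ (hS x hx)
  have h2 := norm_sub_le (y + x • g) y
  rw [add_sub_cancel_left, norm_smul, Real.norm_of_nonneg hx.le] at h2
  have h3 : x * ‖g‖ = C + ‖y‖ + 1 := div_mul_cancel₀ _ hg'.ne'
  linarith

/-- There is a part of an edge from which parallel rays lead to infinity. -/
theorem IsOuterSide.exists_exit_window (h : IsOuterSide P η σ) (hP : IsSimplePolygon P) :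
    ∃ (i : Fin n) (g : Plane) (a b δ₁ : ℝ), 0 < σ * cross g (edgeVec P i) ∧ 0 < a ∧ a < b ∧ b < 1 ∧
      0 < δ₁ ∧ δ₁ < η ∧ ∀ s ∈ Icc a b, ∀ x : ℝ, 0 ≤ x → ∀ j ≠ i, ∀ s' ∈ Icc (0 : ℝ) 1,
        ∀ t ∈ Icc 0 δ₁, collar P i s (σ * δ₁) + x • g ≠ collar P j s' (σ * t) := by
  have hn := hP.three_le
  let i₀ : Fin n := ⟨0, by omega⟩
  set g := edgeNormal P i₀
  have hg1 : ‖g‖ = 1 := hP.norm_edgeNormal i₀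
  have hg0 : g ≠ 0 := norm_pos_iff.1 (by rw [hg1]; exact one_pos)
  have hgd : cross g (edgeVec P i₀) = ‖edgeVec P i₀‖ := by
    rw [cross_edgeVec, real_inner_self_eq_norm_sq, hg1]; ring
  have hd0 := hP.edgeVec_norm_pos i₀
  -- a generic line in direction `g`
  obtain ⟨α, hα, hαv⟩ := (Ioo_infinite (show cross g (P i₀) <
    cross g (P i₀) + ‖edgeVec P i₀‖ by linarith)).exists_notMem_finite
    (Set.finite_range fun j => cross g (P j))
  have hαv' : ∀ j, cross g (P j) ≠ α := fun j hj => hαv ⟨j, hj⟩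
  have hcomp : IsCompact (P.boundary ℝ ∩ {x | cross g x = α}) :=
    (isCompact_boundary P).inter_right (isClosed_eq (continuous_cross_right g) continuous_const)
  have hne : (P.boundary ℝ ∩ {x | cross g x = α}).Nonempty := by
    refine ⟨P i₀ + ((α - cross g (P i₀)) / ‖edgeVec P i₀‖) • edgeVec P i₀,
      (mem_boundary_iff P _).2 ⟨i₀, _, ⟨div_nonneg (by linarith [hα.1]) hd0.le,
        (div_le_one hd0).2 (by linarith [hα.2])⟩, rfl⟩, ?_⟩
    change cross g _ = α
    rw [cross_add_right, cross_smul_right, hgd]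
    field_simp; ring
  have hinner : Continuous fun x : Plane => (inner ℝ x g : ℝ) := by fun_prop
  -- The last boundary point on the line in direction `g`. Since the line misses all vertices, `y`
  -- is an interior point of an edge not parallel to `g`.
  obtain ⟨y, ⟨hyb, hyα⟩, hymax⟩ := hcomp.exists_isMaxOn hne hinner.continuousOn
  have hyα : cross g y = α := hyα
  have hray : ∀ x : ℝ, 0 < x → y + x • g ∉ P.boundary ℝ := by
    intro x hx hb
    have h1 : (inner ℝ (y + x • g) g : ℝ) ≤ inner ℝ y g := hymax ⟨hb, by
      change cross g _ = α
      rw [cross_add_right, cross_smul_right, cross_self, mul_zero, add_zero, hyα]⟩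
    rw [inner_add_left, inner_smul_left, real_inner_self_eq_norm_sq, hg1] at h1
    simp at h1
    linarith
  obtain ⟨i, s₀, hs₀, hy⟩ := (mem_boundary_iff P y).1 hyb
  have hαy : cross g (P i) + s₀ * cross g (edgeVec P i) = α := by
    rw [← hyα, ← hy, cross_add_right, cross_smul_right]
  have hs0 : s₀ ≠ 0 := by
    rintro rfl
    rw [zero_mul, add_zero] at hαy
    exact hαv' i hαy
  have hs1 : s₀ ≠ 1 := by
    rintro rfl
    refine hαv' (finRotate n i) ?_
    rw [← hαy, one_mul, edgeVec, cross_sub_right]; ring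
  have hs : s₀ ∈ Ioo (0 : ℝ) 1 := ⟨lt_of_le_of_ne hs₀.1 hs0.symm, lt_of_le_of_ne hs₀.2 hs1⟩
  have hc0 : cross g (edgeVec P i) ≠ 0 := by
    intro h0
    rw [h0, mul_zero, add_zero] at hαy
    exact hαv' i hαy
  -- Otherwise the ray from `y` would start in the interior of the polygon, although it is unbounded
  -- and never meets the boundary again.
  have hside : 0 < σ * cross g (edgeVec P i) := by
    by_contra hc
    have hneg : 0 < -(σ * cross g (edgeVec P i)) := by
      rcases lt_or_eq_of_le (not_lt.1 hc) with h1 | h1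
      · linarith
      · exact absurd h1 (mul_ne_zero h.sign_ne_zero hc0)
    have hev := h.eventually_side hP i hs
    rw [hy] at hev
    have hcont : Continuous fun x : ℝ => y + x • g := by fun_prop
    have htend := hcont.continuousWithinAt.tendsto (x := (0 : ℝ)) (s := Ioi 0)
    rw [zero_smul, add_zero] at htend
    obtain ⟨x, hx, hx0⟩ := ((htend.eventually hev).and self_mem_nhdsWithin).exists
    have hx0 : 0 < x := hx0
    have hm := hx.2 (by
      have e : y + x • g - P i = s₀ • edgeVec P i + x • g := by rw [← hy]; abel
      rw [e, cross_add_left, cross_smul_left, cross_self, cross_smul_left, mul_zero, zero_add]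
      have := mul_pos hx0 hneg
      linarith)
    refine notMem_polygonInterior_of_unbounded (S := (fun x : ℝ => y + x • g) '' Ioi 0)
      (isPreconnected_Ioi.image _ hcont.continuousOn) ?_
      (not_isBounded_ray hg0 (y := y) fun x hx => ⟨x, hx, rfl⟩) ⟨x, hx0, rfl⟩ hm
    rintro _ ⟨x, hx, rfl⟩
    exact hray x hx
  -- distance of the ray from the other edges
  have hL : IsClosed {z : Plane | cross (z - y) g = 0 ∧ 0 ≤ (inner ℝ (z - y) g : ℝ)} :=
    (isClosed_eq ((continuous_cross_left g).comp (by fun_prop : Continuous fun z => z - y))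
      continuous_const).inter (isClosed_le continuous_const
        (hinner.comp (by fun_prop : Continuous fun z => z - y)))
  have hE : IsCompact (⋃ j ∈ {j | j ≠ i}, P.edgeSet ℝ j) :=
    (Set.toFinite _).isCompact_biUnion fun j _ => isCompact_edgeSet P j
  have hdisj : Disjoint (⋃ j ∈ {j | j ≠ i}, P.edgeSet ℝ j)
      {z : Plane | cross (z - y) g = 0 ∧ 0 ≤ (inner ℝ (z - y) g : ℝ)} := by
    rw [Set.disjoint_left]
    rintro z hz ⟨hz1, hz2⟩
    obtain ⟨j, hj, hzj⟩ := mem_iUnion₂.1 hz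
    have e := eq_smul_of_cross_eq_zero hg0 hz1
    rw [hg1, one_pow, div_one] at e
    have e' : z = y + (inner ℝ (z - y) g : ℝ) • g := by rw [← e]; abel
    rcases eq_or_lt_of_le hz2 with h0 | h0
    · rw [← h0, zero_smul, add_zero] at e'
      rw [e', ← hy] at hzj
      exact hP.edge_interior_notMem (Ne.symm hj) hs hzj
    · refine hray _ h0 ?_
      rw [← e']
      exact mem_iUnion.2 ⟨j, hzj⟩
  obtain ⟨c, hc, hcd⟩ := exists_pos_forall_le_dist hE hL hdisj
  have hM := mitreBound_nonneg P
  have hdi := hP.edgeVec_norm_pos i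
  -- Three errors of less than `c / 4` each occur: the shift along the edge, the shift to height
  -- `δ₁`, and the motion of the other edge. Together they stay below the distance `c` between the
  -- other edges and the ray from `y`.
  obtain ⟨ρ, hρ0, hρ⟩ := exists_between (show 0 < min (min s₀ (1 - s₀)) (c / 4 / ‖edgeVec P i‖) from
    lt_min (lt_min hs.1 (by linarith [hs.2])) (by positivity))
  obtain ⟨⟨hρ1, hρ2⟩, hρ3⟩ : (ρ < s₀ ∧ ρ < 1 - s₀) ∧ ρ < c / 4 / ‖edgeVec P i‖ := by
    simpa only [lt_min_iff] using hρ
  rw [lt_div_iff₀ hdi] at hρ3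
  obtain ⟨δ₁, hδ0, hδ⟩ := exists_between (show 0 < min η (c / 4 / (mitreBound P + 1)) from
    lt_min h.pos (by positivity))
  obtain ⟨hδη, hδc⟩ := lt_min_iff.1 hδ
  rw [lt_div_iff₀ (by linarith)] at hδc
  refine ⟨i, g, s₀ - ρ, s₀ + ρ, δ₁, hside, by linarith, by linarith, by linarith, hδ0, hδη, ?_⟩
  intro s hsab x hx j hj s' hs' t ht heq
  have hs01 : s ∈ Icc (0 : ℝ) 1 := ⟨by linarith [hsab.1], by linarith [hsab.2]⟩
  have h1 := hcd (collar P j s' 0) (mem_iUnion₂.2 ⟨j, hj, (mem_edgeSet_iff P j _).2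
    ⟨s', hs', (collar_zero P j s').symm⟩⟩) (y + x • g) (by
      refine ⟨?_, ?_⟩
      · rw [add_sub_cancel_left, cross_smul_left, cross_self, mul_zero]
      · rw [add_sub_cancel_left, inner_smul_left, real_inner_self_eq_norm_sq, hg1]
        simpa using hx)
  have h2 := dist_collar_le P j hs' 0 (σ * t)
  have h3 := dist_collar_le P i hs01 (σ * δ₁) 0
  rw [zero_sub, abs_neg, h.abs_sign_mul, abs_of_nonneg ht.1] at h2
  rw [sub_zero, h.abs_sign_mul, abs_of_pos hδ0] at h3
  have h4 : dist (collar P i s 0) y ≤ ρ * ‖edgeVec P i‖ := by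
    rw [collar_zero, ← hy, dist_add_left, dist_eq_norm, ← sub_smul, norm_smul, Real.norm_eq_abs]
    refine mul_le_mul_of_nonneg_right (abs_le.2 ⟨?_, ?_⟩) hdi.le <;> linarith [hsab.1, hsab.2]
  have h5 : dist (collar P i s (σ * δ₁) + x • g) (y + x • g) ≤
      δ₁ * mitreBound P + ρ * ‖edgeVec P i‖ := by
    rw [dist_add_right]
    exact (dist_triangle _ (collar P i s 0) _).trans (add_le_add h3 h4)
  have h6 := dist_triangle (collar P j s' 0) (collar P j s' (σ * t)) (y + x • g)
  rw [← heq] at h6 h2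
  have h7 : t * mitreBound P ≤ δ₁ * mitreBound P := mul_le_mul_of_nonneg_right ht.2 hM
  nlinarith

theorem rotate_pow_eq_one (hn : 3 ≤ n) : finRotate n ^ n = 1 := by
  have h := (isCycle_finRotate_of_le (n := n) (by linarith)).orderOf
  rw [support_finRotate_of_le (by linarith), Finset.card_univ, Fintype.card_fin] at h
  rw [← orderOf_dvd_iff_pow_eq_one, h]

theorem cyc_injOn (hn : 3 ≤ n) (i₀ : Fin n) {k l : ℤ} (hk : k ∈ Ico (0 : ℤ) n)
    (hl : l ∈ Ico (0 : ℤ) n) (h : cyc i₀ k = cyc i₀ l) : k = l := by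
  have hcyc := isCycle_finRotate_of_le (n := n) (by linarith)
  have ho := hcyc.orderOf
  rw [support_finRotate_of_le (by linarith), Finset.card_univ, Fintype.card_fin] at ho
  have hi : finRotate n i₀ ≠ i₀ := by
    rw [← Equiv.Perm.mem_support, support_finRotate_of_le (by linarith)]
    exact Finset.mem_univ _
  have key : ∀ k l : ℤ, k ≤ l → l - k < n → cyc i₀ k = cyc i₀ l → k = l := by
    intro k l hkl hlk h
    obtain ⟨m, hm⟩ := Int.eq_ofNat_of_zero_le (sub_nonneg.2 hkl)
    have e : (finRotate n ^ m) i₀ = i₀ := by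
      have h1 : finRotate n ^ l = finRotate n ^ k * finRotate n ^ m := by
        rw [← zpow_natCast, ← zpow_add]; congr 1; omega
      rw [cyc, cyc, h1, Equiv.Perm.mul_apply] at h
      exact ((finRotate n ^ k).injective h).symm
    have h1 := (hcyc.pow_eq_one_iff' hi).2 e
    rw [← orderOf_dvd_iff_pow_eq_one, ho] at h1
    have h2 : m < n := by omega
    have h3 := Nat.eq_zero_of_dvd_of_lt h1 h2
    omega
  rcases le_total k l with hkl | hkl
  · exact key k l hkl (by linarith [hk.1, hl.2]) h
  · exact (key l k hkl (by linarith [hl.1, hk.2]) h.symm).symm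

/-- One half-open turn visits every edge once. As fractional parts never equal 1, the two gluing
cases of `collar_inj` cannot occur. -/
theorem IsCollarWidth.collarCurve_inj (h : IsCollarWidth P η) (hP : IsSimplePolygon P)
    (i₀ : Fin n) {u u' t t' : ℝ} (hu : u ∈ Ico (0 : ℝ) n) (hu' : u' ∈ Ico (0 : ℝ) n)
    (ht : |t| < η) (ht' : |t'| < η) (heq : collarCurve P i₀ u t = collarCurve P i₀ u' t') :
    u = u' ∧ t = t' := by
  have hfl : ∀ u ∈ Ico (0 : ℝ) n, ⌊u⌋ ∈ Ico (0 : ℤ) n := fun u hu =>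
    ⟨Int.floor_nonneg.2 hu.1, Int.floor_lt.2 (by exact_mod_cast hu.2)⟩
  have hfr : ∀ u : ℝ, Int.fract u ∈ Icc (0 : ℝ) 1 := fun u =>
    ⟨Int.fract_nonneg u, (Int.fract_lt_one u).le⟩
  rw [collarCurve_eq, collarCurve_eq] at heq
  obtain ⟨h1, h2⟩ := h.collar_inj hP (hfr u) (hfr u') ht ht' heq
  refine ⟨?_, h1⟩
  rcases h2 with ⟨h2, h3⟩ | ⟨-, h3, -⟩ | ⟨-, h3, -⟩
  · have := cyc_injOn hP.three_le i₀ (hfl u hu) (hfl u' hu') h2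
    rw [← Int.floor_add_fract u, ← Int.floor_add_fract u', this, h3]
  · exact absurd h3 (Int.fract_lt_one u).ne
  · exact absurd h3 (Int.fract_lt_one u').ne

theorem exists_collarCurve_eq (hP : IsSimplePolygon P) (i₀ i : Fin n) {s : ℝ}
    (hs : s ∈ Icc (0 : ℝ) 1) (t : ℝ) :
    ∃ u ∈ Ico (0 : ℝ) n, collarCurve P i₀ u t = collar P i s t := by
  have hn := hP.three_le
  have hn0 : (0 : ℝ) < n := by have : 0 < n := by omega
                               exact_mod_cast this
  obtain ⟨k, rfl⟩ := exists_cyc_eq hn i₀ i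
  have hper : ∀ (u : ℝ) (m : ℤ), collarCurve P i₀ (u + (m * n : ℤ)) t = collarCurve P i₀ u t := by
    intro u m
    rw [collarCurve_eq, collarCurve_eq, Int.floor_add_intCast, Int.fract_add_intCast]
    congr 1
    rw [cyc, cyc, zpow_add, mul_comm m, zpow_mul, zpow_natCast, rotate_pow_eq_one hn, one_zpow,
      mul_one]
  set v : ℝ := k + s
  refine ⟨n * Int.fract (v / n), ⟨mul_nonneg hn0.le (Int.fract_nonneg _),
    mul_lt_of_lt_one_right hn0 (Int.fract_lt_one _)⟩, ?_⟩
  rw [← collarCurve_add P i₀ k hs, ← hper _ ⌊v / n⌋]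
  congr 1
  rw [Int.fract]; push_cast; field_simp; ring

theorem continuous_collarCurve_comp {X : Type*} [TopologicalSpace X] {f g : X → ℝ}
    (hf : Continuous f) (i₀ : Fin n) (hg : Continuous g) :
    Continuous fun x => collarCurve P i₀ (f x) (g x) := by
  have h : Continuous fun x => (f x, g x) := hf.prodMk hg
  exact Continuous.comp (g := fun p : ℝ × ℝ => collarCurve P i₀ p.1 p.2)
    (f := fun x => (f x, g x)) (continuous_collarCurve P i₀) h

/-- Curves in the outer collar, continued by rays, turn strings in the inflated polygon into
outerstrings. -/
theorem IsOuterSide.exists_isOuterstring (h : IsOuterSide P η σ) (hP : IsSimplePolygon P) :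
    ∃ δ₁ > 0, ∀ δ, 0 < δ → δ < δ₁ → ∀ {ι : Type} [Finite ι] (Str : ι → PolygonalString),
      (∀ w, (Str w).origin ∈ (offset P (σ * δ)).boundary ℝ ∧
        (Str w).carrier \ {(Str w).origin} ⊆ polygonInterior (offset P (σ * δ))) →
      (Function.Injective fun w => (Str w).origin) →
      ∀ G : SimpleGraph ι, (∀ w w', w ≠ w' →
        (G.Adj w w' ↔ ((Str w).carrier ∩ (Str w').carrier).Nonempty)) → IsOuterstring G := by
  obtain ⟨i, g, a, b, δ₁, hg, ha, hab, hb, hδ₁, hδη, hwin⟩ := h.exists_exit_window hP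
  refine ⟨δ₁, hδ₁, fun δ hδ hδδ ι _ Str hStr horig G hG => ?_⟩
  have hn := hP.three_le
  have hn0 : (0 : ℝ) < n := by
    have : 0 < n := by omega
    exact_mod_cast this
  have hn1 : (1 : ℝ) ≤ n := by
    have : 1 ≤ n := by omega
    exact_mod_cast this
  have hd := hP.edgeVec_norm_pos i
  have hg0 : g ≠ 0 := by rintro rfl; simp [cross] at hg
  have hpar : ∀ w, ∃ u ∈ Ico (0 : ℝ) n, collarCurve P i u (σ * δ) = (Str w).origin := by
    intro w
    obtain ⟨j, s, hs, e⟩ := (mem_boundary_offset_iff P _ _).1 (hStr w).1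
    rw [← e]
    exact exists_collarCurve_eq hP i j hs _
  choose u hu hue using hpar
  have u_inj : Function.Injective u := fun w w' hww => horig (by
    change (Str w).origin = (Str w').origin
    rw [← hue, ← hue, hww])
  have hκ : 0 < (b - a) / n := by
    have : 0 < b - a := by linarith
    positivity
  -- The full turn `[0, n)` is compressed into the window `[a, b)` on edge `i`, which is the edge
  -- with parameters in `[0, 1]`.
  let U : ι → ℝ := fun w => a + (b - a) / n * u w
  have hU : ∀ w, U w ∈ Icc a b := by
    intro w
    have h1 := mul_nonneg hκ.le (hu w).1
    have h2 : (b - a) / n * u w ≤ (b - a) / n * n := mul_le_mul_of_nonneg_left (hu w).2.le hκ.le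
    rw [div_mul_cancel₀ _ hn0.ne'] at h2
    exact ⟨by simp only [U]; linarith, by simp only [U]; linarith⟩
  have hU01 : ∀ w, U w ∈ Icc (0 : ℝ) 1 := fun w =>
    ⟨by linarith [(hU w).1], by linarith [(hU w).2]⟩
  let lev : ℝ → ℝ := fun l => δ + l * (δ₁ - δ)
  let pos : ι → ℝ → ℝ := fun w l => (1 - l) * u w + l * U w
  -- While the height rises from `δ` to `δ₁`, the position slides from `u w` to `U w`. At each
  -- height the positions are one increasing affine function of `u w`, so different curves never
  -- meet. As `pos` stays in `[0, n)`, there is no wrapping around.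
  let ring : ι → ℝ → Plane := fun w l => collarCurve P i (pos w l) (σ * lev l)
  have lev_mem : ∀ l ∈ Icc (0 : ℝ) 1, lev l ∈ Icc δ δ₁ := by
    intro l hl
    have h1 : 0 ≤ l * (δ₁ - δ) := mul_nonneg hl.1 (by linarith)
    have h2 : l * (δ₁ - δ) ≤ δ₁ - δ := mul_le_of_le_one_left (by linarith) hl.2
    exact ⟨by simp only [lev]; linarith, by simp only [lev]; linarith⟩
  have lev_abs : ∀ l ∈ Icc (0 : ℝ) 1, |σ * lev l| < η := fun l hl =>
    h.abs_lt ⟨hδ.le.trans (lev_mem l hl).1, (lev_mem l hl).2.trans_lt hδη⟩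
  have pos_mem : ∀ w, ∀ l ∈ Icc (0 : ℝ) 1, pos w l ∈ Ico (0 : ℝ) n := by
    intro w l hl
    have := (convex_Ico (0 : ℝ) n) (hu w)
      (show U w ∈ Ico (0 : ℝ) n from ⟨(hU01 w).1, by linarith [(hU w).2]⟩)
      (show 0 ≤ 1 - l by linarith [hl.2]) hl.1 (by ring_nf)
    simpa only [smul_eq_mul] using this
  have ring_cont : ∀ w, Continuous (ring w) := by
    intro w
    have h1 : Continuous (pos w) := by simp only [pos]; fun_prop
    have h2 : Continuous lev := by simp only [lev]; fun_prop
    exact continuous_collarCurve_comp h1 i (continuous_const.mul h2)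
  have ring0 : ∀ w, ring w 0 = (Str w).origin := by
    intro w
    rw [← hue]
    simp [ring, pos, lev]
  have ring1 : ∀ w, ring w 1 = collar P i (U w) (σ * δ₁) := by
    intro w
    have := collarCurve_add P i 0 (hU01 w) (σ * δ₁)
    rw [Int.cast_zero, zero_add, cyc_zero] at this
    rw [← this]
    simp [ring, pos, lev]
  have ring_inj : ∀ w w' l l', l ∈ Icc (0 : ℝ) 1 → l' ∈ Icc (0 : ℝ) 1 → ring w l = ring w' l' →
      w = w' ∧ l = l' := by
    intro w w' l l' hl hl' e
    obtain ⟨h1, h2⟩ := h.collarCurve_inj hP i (pos_mem w l hl) (pos_mem w' l' hl')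
      (lev_abs l hl) (lev_abs l' hl') e
    have h3 : lev l = lev l' := mul_left_cancel₀ h.sign_ne_zero h2
    have h4 : l = l' := by
      simp only [lev] at h3
      exact mul_right_cancel₀ (show δ₁ - δ ≠ 0 by linarith) (by linarith)
    subst h4
    refine ⟨u_inj ?_, rfl⟩
    have h5 : (1 - l + l * ((b - a) / n)) * u w = (1 - l + l * ((b - a) / n)) * u w' := by
      simp only [pos, U] at h1
      linarith
    have h6 : 0 < 1 - l + l * ((b - a) / n) := by
      rcases eq_or_lt_of_le hl.2 with h7 | h7
      · rw [h7]; linarith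
      · have := mul_nonneg hl.1 hκ.le
        linarith
    exact mul_left_cancel₀ h6.ne' h5
  let ray : ι → ℝ → Plane := fun w x => ring w 1 + x • g
  have ray_cont : ∀ w, Continuous (ray w) := fun w => by fun_prop
  have ray_height : ∀ w x, cross (ray w x - P i) (edgeVec P i) =
      σ * δ₁ * ‖edgeVec P i‖ + x * cross g (edgeVec P i) := by
    intro w x
    have e : ray w x - P i = (collar P i (U w) (σ * δ₁) - P i) + x • g := by
      simp only [ray, ring1]; abel
    rw [e, cross_add_left, hP.cross_collar, cross_smul_left]
  have hcg : cross g (edgeVec P i) ≠ 0 := by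
    intro h0; rw [h0, mul_zero] at hg; exact lt_irrefl _ hg
  -- rays avoid the collar
  have ray_off : ∀ w x, 0 ≤ x → ∀ j, ∀ s ∈ Icc (0 : ℝ) 1, ∀ t ∈ Icc 0 δ₁,
      (0 < x ∨ t < δ₁) → ray w x ≠ collar P j s (σ * t) := by
    intro w x hx j s hs t ht hxt e
    by_cases hj : j = i
    · subst hj
      have h1 := ray_height w x
      rw [e, hP.cross_collar] at h1
      have h2 : t * ‖edgeVec P j‖ = δ₁ * ‖edgeVec P j‖ + x * (σ * cross g (edgeVec P j)) := by
        have := congrArg (fun z => σ * z) h1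
        have hσ := h.sign_mul_self
        have e1 : σ * (σ * t * ‖edgeVec P j‖) = (σ * σ) * (t * ‖edgeVec P j‖) := by ring_nf
        have e2 : σ * (σ * δ₁ * ‖edgeVec P j‖ + x * cross g (edgeVec P j)) =
          (σ * σ) * (δ₁ * ‖edgeVec P j‖) + x * (σ * cross g (edgeVec P j)) := by ring_nf
        simp only [e1, e2, hσ, one_mul] at this
        exact this
      have h3 : t * ‖edgeVec P j‖ ≤ δ₁ * ‖edgeVec P j‖ := mul_le_mul_of_nonneg_right ht.2 hd.le
      rcases hxt with hx0 | ht0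
      · have := mul_pos hx0 hg
        linarith
      · have h4 : t * ‖edgeVec P j‖ < δ₁ * ‖edgeVec P j‖ := mul_lt_mul_of_pos_right ht0 hd
        have := mul_nonneg hx hg.le
        linarith
    · simp only [ray, ring1] at e
      exact hwin (U w) (hU w) x hx j hj s hs t ht e
  have ring_mem : ∀ w l, ring w l = collar P (cyc i ⌊pos w l⌋) (Int.fract (pos w l)) (σ * lev l) :=
    fun w l => collarCurve_eq P i _ _
  have fr_mem : ∀ v : ℝ, Int.fract v ∈ Icc (0 : ℝ) 1 := fun v =>
    ⟨Int.fract_nonneg v, (Int.fract_lt_one v).le⟩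
  have ray_ring : ∀ w w' x l, 0 < x → l ∈ Icc (0 : ℝ) 1 → ray w x ≠ ring w' l := by
    intro w w' x l hx hl
    rw [ring_mem]
    exact ray_off w x hx.le _ _ (fr_mem _) _ ⟨hδ.le.trans (lev_mem l hl).1, (lev_mem l hl).2⟩
      (Or.inl hx)
  have ray_inj : ∀ w w' x x', ray w x = ray w' x' → w = w' ∧ x = x' := by
    intro w w' x x' e
    have h1 := ray_height w x
    rw [e, ray_height] at h1
    have hx : x = x' := (mul_right_cancel₀ hcg (by linarith)).symm
    subst hx
    exact ⟨(ring_inj w w' 1 1 (by norm_num) (by norm_num) (add_right_cancel e)).1, rfl⟩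
  -- the exterior curves avoid the inflated polygon
  have ext_off : ∀ w, (∀ l ∈ Icc (0 : ℝ) 1, ring w l ∉ polygonInterior (offset P (σ * δ))) ∧
      ∀ x, 0 ≤ x → ray w x ∉ polygonInterior (offset P (σ * δ)) := by
    intro w
    -- Without its starting point, which is the origin of the string, the exterior curve with its
    -- full ray is connected, unbounded and off the boundary of the inflated polygon. It therefore
    -- avoids the interior.
    have hpre : IsPreconnected (ring w '' Ioc 0 1 ∪ ray w '' Ici 0) := by
      refine (isPreconnected_Ioc.image _ (ring_cont w).continuousOn).union (ring w 1)
        ⟨1, by norm_num, rfl⟩ ⟨0, by simp, by simp [ray]⟩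
        (isPreconnected_Ici.image _ (ray_cont w).continuousOn)
    have hoff : ring w '' Ioc 0 1 ∪ ray w '' Ici 0 ⊆ ((offset P (σ * δ)).boundary ℝ)ᶜ := by
      rintro _ (⟨l, hl, rfl⟩ | ⟨x, hx, rfl⟩)
      · rw [ring_mem]
        refine h.collar_notMem_offset hP (fr_mem _) (lev_abs l ⟨hl.1.le, hl.2⟩)
          (h.abs_lt ⟨hδ.le, hδδ.trans hδη⟩) fun e => ?_
        have e' : lev l = δ := mul_left_cancel₀ h.sign_ne_zero e
        have : 0 < l * (δ₁ - δ) := mul_pos hl.1 (by linarith)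
        simp only [lev] at e'
        linarith
      · intro hc
        obtain ⟨j, s, hs, e⟩ := (mem_boundary_offset_iff P _ _).1 hc
        exact ray_off w x hx j s hs δ ⟨hδ.le, hδδ.le⟩ (Or.inr hδδ) e.symm
    have hub : ¬ Bornology.IsBounded (ring w '' Ioc 0 1 ∪ ray w '' Ici 0) :=
      not_isBounded_ray hg0 (y := ring w 1) fun x hx => Or.inr ⟨x, hx.le, rfl⟩
    refine ⟨fun l hl => ?_, fun x hx =>
      notMem_polygonInterior_of_unbounded hpre hoff hub (Or.inr ⟨x, hx, rfl⟩)⟩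
    rcases eq_or_lt_of_le hl.1 with rfl | hl0
    · rw [ring0]
      exact fun hc => hc.1 (hStr w).1
    · exact notMem_polygonInterior_of_unbounded hpre hoff hub (Or.inl ⟨l, ⟨hl0, hl.2⟩, rfl⟩)
  -- a big disc
  have hbd : Bornology.IsBounded (⋃ w, ((Str w).carrier ∪ ring w '' Icc 0 1)) :=
    (isCompact_iUnion fun w => (Str w).isCompact_carrier.union
      (isCompact_Icc.image (ring_cont w))).isBounded
  obtain ⟨R, hR, hbd⟩ := hbd.exists_pos_norm_lt
  have hR1 : ∀ w, ∀ x ∈ (Str w).carrier, ‖x‖ < R := fun w x hx => hbd x (mem_iUnion.2 ⟨w, Or.inl hx⟩)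
  have hR2 : ∀ w, ∀ l ∈ Icc (0 : ℝ) 1, ‖ring w l‖ < R := fun w l hl =>
    hbd _ (mem_iUnion.2 ⟨w, Or.inr ⟨l, hl, rfl⟩⟩)
  have hX : ∀ w, ∃ X : ℝ, 0 < X ∧ ‖ray w X‖ = R ∧ ∀ x, 0 ≤ x → x < X → ‖ray w x‖ < R := by
    intro w
    have he : ‖ring w 1‖ < R := hR2 w 1 (by norm_num)
    have hex : ∃ Y : ℝ, 0 ≤ Y ∧ R ≤ ‖ray w Y‖ := by
      by_contra! hc
      exact not_isBounded_ray hg0 (y := ring w 1) (S := Metric.ball 0 R)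
        (fun x hx => mem_ball_zero_iff.2 (hc x hx.le)) Metric.isBounded_ball
    obtain ⟨Y, hY, hYR⟩ := hex
    have hr0 : ray w 0 = ring w 1 := by simp [ray]
    obtain ⟨X, hX, hXR⟩ := intermediate_value_Icc hY (ray_cont w).norm.continuousOn
      (show R ∈ Icc _ _ from ⟨by rw [hr0]; exact he.le, hYR⟩)
    have hXR : ‖ray w X‖ = R := hXR
    have hX0 : 0 < X := by
      refine lt_of_le_of_ne hX.1 ?_
      rintro rfl
      rw [hr0] at hXR
      exact he.ne hXR
    refine ⟨X, hX0, hXR, fun x hx hxX => ?_⟩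
    -- By convexity, everything before a point of norm `R` on a ray that starts inside the disc has
    -- norm less than `R`.
    have e : ray w x = (1 - x / X) • ring w 1 + (x / X) • ray w X := by
      have : x • g = ((x / X) * X) • g := by rw [div_mul_cancel₀ _ hX0.ne']
      simp only [ray, this]; module
    have hq1 : x / X < 1 := (div_lt_one hX0).2 hxX
    have hq0 : 0 ≤ x / X := div_nonneg hx hX0.le
    calc ‖ray w x‖ ≤ ‖(1 - x / X) • ring w 1‖ + ‖(x / X) • ray w X‖ := by
          rw [e]; exact norm_add_le _ _
      _ = (1 - x / X) * ‖ring w 1‖ + x / X * R := by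
          rw [norm_smul, norm_smul, Real.norm_of_nonneg hq0,
            Real.norm_of_nonneg (by linarith), hXR]
      _ < (1 - x / X) * R + x / X * R := by
          have := mul_lt_mul_of_pos_left he (show 0 < 1 - x / X by linarith)
          linarith
      _ = R := by ring_nf
  choose X hX0 hXR hXlt using hX
  -- assembling the curves
  let f₁ : ι → C(unitInterval, Plane) := fun w => ⟨fun t => ray w ((1 - t) * X w),
    (ray_cont w).comp (by fun_prop)⟩
  let f₂ : ι → C(unitInterval, Plane) := fun w => ⟨fun t => ring w (1 - t),
    (ring_cont w).comp (by fun_prop)⟩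
  have hf₁ : ∀ w (t : unitInterval), f₁ w t = ray w ((1 - t) * X w) := fun _ _ => rfl
  have hf₂ : ∀ w (t : unitInterval), f₂ w t = ring w (1 - t) := fun _ _ => rfl
  have t01 : ∀ t : unitInterval, 1 - (t : ℝ) ∈ Icc (0 : ℝ) 1 := fun t =>
    ⟨by linarith [t.2.2], by linarith [t.2.1]⟩
  have tX : ∀ w (t : unitInterval), 0 ≤ (1 - (t : ℝ)) * X w := fun w t =>
    mul_nonneg (t01 t).1 (hX0 w).le
  have ray_zero : ∀ w, ray w 0 = ring w 1 := fun w => by simp [ray]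
  -- The curve starts on the circle, as the definition requires. It follows the ray inwards, then
  -- the collar curve backwards down to height `δ`, and finally the string from its origin.
  have hcurve : ∀ w, ∃ γ : C(unitInterval, Plane), Function.Injective γ ∧ γ 0 = ray w (X w) ∧
      range γ = (range (f₁ w) ∪ range (f₂ w)) ∪ (Str w).carrier := by
    intro w
    obtain ⟨f₃, hf₃, hf₃0, hf₃r⟩ := (Str w).exists_path
    obtain ⟨k, hk, hk0, hk1, hkr⟩ := exists_concat (f₁ w) (f₂ w)
      (by
        intro s t hst
        have := (ray_inj w w _ _ hst).2
        have := mul_right_cancel₀ (hX0 w).ne' this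
        exact Subtype.ext (by linarith))
      (by
        intro s t hst
        have := (ring_inj w w _ _ (t01 s) (t01 t) hst).2
        exact Subtype.ext (by linarith))
      (by rw [hf₁, hf₂]; simp [ray_zero])
      (by
        rintro _ ⟨⟨s, rfl⟩, t, ht⟩
        rw [hf₁, hf₂] at ht
        rcases eq_or_lt_of_le (tX w s) with h0 | h0
        · rw [mem_singleton_iff, hf₁, hf₁, ← h0]; simp
        · exact absurd ht.symm (ray_ring w w _ _ h0 (t01 t)))
    obtain ⟨γ, hγ, hγ0, -, hγr⟩ := exists_concat k f₃ hk hf₃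
      (by rw [hk1, hf₃0, hf₂]; simp [ring0])
      (by
        rw [hkr, hf₃r]
        rintro x ⟨hx, hx'⟩
        rw [mem_singleton_iff, hk1, hf₂]
        simp only [Set.Icc.coe_one, sub_self, ring0]
        by_contra hne
        have hint := (hStr w).2 ⟨hx', hne⟩
        rcases hx with ⟨t, rfl⟩ | ⟨t, rfl⟩
        · exact (ext_off w).2 _ (tX w t) hint
        · exact (ext_off w).1 _ (t01 t) hint)
    refine ⟨γ, hγ, ?_, by rw [hγr, hkr, hf₃r]⟩
    rw [hγ0, hk0, hf₁]; simp
  choose γ hγ hγ0 hγr using hcurve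
  have ext_disj : ∀ w w', w ≠ w' → ∀ x ∈ range (f₁ w) ∪ range (f₂ w),
      x ∉ range (f₁ w') ∪ range (f₂ w') := by
    have aux : ∀ w w' x l, 0 ≤ x → l ∈ Icc (0 : ℝ) 1 → ray w x = ring w' l → w = w' := by
      intro w w' x l hx hl e
      rcases eq_or_lt_of_le hx with rfl | h0
      · rw [ray_zero] at e
        exact (ring_inj w w' 1 l (by norm_num) hl e).1
      · exact absurd e (ray_ring w w' x l h0 hl)
    rintro w w' hne _ (⟨s, rfl⟩ | ⟨s, rfl⟩) (⟨t, ht⟩ | ⟨t, ht⟩)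
    · exact hne (ray_inj w' w _ _ ht).1.symm
    · exact hne (aux w w' _ _ (tX w s) (t01 t) ht.symm)
    · exact hne (aux w' w _ _ (tX w' t) (t01 s) ht).symm
    · exact hne (ring_inj w' w _ _ (t01 t) (t01 s) ht).1.symm
  have ext_str : ∀ w w', w ≠ w' → ∀ x ∈ range (f₁ w) ∪ range (f₂ w), x ∉ (Str w').carrier := by
    intro w w' hne x hx hx'
    by_cases ho : x = (Str w').origin
    · refine ext_disj w w' hne x hx (Or.inr ⟨1, ?_⟩)
      rw [hf₂, ho, ← ring0]; simp
    · have hint := (hStr w').2 ⟨hx', ho⟩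
      rcases hx with ⟨t, rfl⟩ | ⟨t, rfl⟩
      · exact (ext_off w).2 _ (tX w t) hint
      · exact (ext_off w).1 _ (t01 t) hint
  refine isOuterstring_of_curves hR γ hγ (fun w => by rw [hγ0, hXR]) (fun w t ht => ?_)
    fun w w' hne => ?_
  · have hm : γ w t ∈ (range (f₁ w) ∪ range (f₂ w)) ∪ (Str w).carrier := by
      rw [← hγr]; exact mem_range_self t
    rcases hm with (⟨s, hs⟩ | ⟨s, hs⟩) | hm
    · rw [← hs, hf₁]
      refine hXlt w _ (tX w s) (lt_of_le_of_ne (mul_le_of_le_one_left (hX0 w).le (t01 s).2)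
        fun e => ht (hγ w ?_))
      rw [← hs, hf₁, e, hγ0]
    · rw [← hs, hf₂]
      exact hR2 w _ (t01 s)
    · exact hR1 w _ hm
  · rw [hG w w' hne, hγr, hγr]
    constructor
    · rintro ⟨x, hx, hx'⟩
      exact ⟨x, Or.inr hx, Or.inr hx'⟩
    · rintro ⟨x, hx | hx, hx' | hx'⟩
      · exact absurd hx' (ext_disj w w' hne x hx)
      · exact absurd hx' (ext_str w w' hne x hx)
      · exact absurd hx (ext_str w' w hne.symm x hx')
      · exact ⟨x, hx, hx'⟩

end Exterior

end PolygonVisibility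
end
open PolygonVisibility

/-! ### Assembly of the theorem -/

theorem mainTheorem8 {n : ℕ} (P : Polygon Plane n) (hP : IsSimplePolygon P)
    (F : Finset Plane) (hF : (F : Set Plane) ⊆ region P) :
    (∀ ε : ℝ, 0 < ε → ∃ δ₀ : ℝ, 0 < δ₀ ∧ ∀ δ : ℝ, 0 < δ → δ < δ₀ →
      IsSimplePolygon (inflate P δ) ∧
      region P ⊆ polygonInterior (inflate P δ) ∧
      ∃ Str : F → PolygonalString,
        -- each string lies in the inflated polygon and meets its boundary only in its origin
        (∀ w, (Str w).origin ∈ (inflate P δ).boundary ℝ ∧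
          (Str w).carrier \ {(Str w).origin} ⊆ polygonInterior (inflate P δ)) ∧
        -- different points have different origins
        (Function.Injective fun w => (Str w).origin) ∧
        -- the string of `w` follows the boundary of `Vis P w` up to `ε`
        (∀ w : F, (Str w).carrier ⊆ Metric.thickening ε (frontier (Vis P w)) ∧
          frontier (Vis P w) ⊆ Metric.thickening ε (Str w).carrier) ∧
        -- strings intersect exactly when the visibility regions do
        (∀ w w' : F, ((Str w).carrier ∩ (Str w').carrier).Nonempty ↔
          (Vis P w ∩ Vis P w').Nonempty) ∧
        (∃ φ : VIG P F ≃g SIG (Set.range Str), ∀ w, (φ w : PolygonalString) = Str w) ∧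
        IsOuterstring (SIG (Set.range Str))) ∧
    IsOuterstring (VIG P F) := by
  obtain ⟨η, σ, h⟩ := hP.exists_outerSide
  -- This does not depend on `ε`, so it is proved once from the strings for `ε = 1` and a single
  -- small `δ`. For the string graphs at other scales it is transported along the isomorphism.
  have hout : IsOuterstring (VIG P F) := by
    obtain ⟨δ₁, hδ₁, hG⟩ := h.exists_isOuterstring hP
    obtain ⟨δ₀, hδ₀, hStr⟩ := h.exists_strings hP hF one_pos
    obtain ⟨δ, hδ, hδ'⟩ := exists_between (lt_min hδ₁ hδ₀)
    obtain ⟨hδ1, hδ0⟩ := lt_min_iff.1 hδ'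
    obtain ⟨Str, h1, h2, -, h4⟩ := hStr δ hδ hδ0
    refine hG δ hδ hδ1 Str h1 h2 (VIG P F) fun w w' hne => ?_
    rw [h4]
    exact ⟨fun hadj => hadj.2, fun hV => ⟨hne, hV⟩⟩
  refine ⟨fun ε hε => ?_, hout⟩
  obtain ⟨δ₀, hδ₀, hStr⟩ := h.exists_strings hP hF hε
  refine ⟨min δ₀ η, lt_min hδ₀ h.pos, fun δ hδ hδ' => ?_⟩
  obtain ⟨hδ0, hδη⟩ := lt_min_iff.1 hδ'
  obtain ⟨Str, h1, h2, h3, h4⟩ := hStr δ hδ hδ0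
  -- Different origins make the strings different, so the set of strings has exactly one vertex for
  -- each point of `F`.
  have hinj : Function.Injective Str := fun w w' hww => h2 (congrArg PolygonalString.origin hww)
  let φ : VIG P F ≃g SIG (Set.range Str) :=
    { toEquiv := Equiv.ofInjective Str hinj
      map_rel_iff' := fun {w w'} => by
        change ((Equiv.ofInjective Str hinj w ≠ Equiv.ofInjective Str hinj w') ∧
          ((Str w).carrier ∩ (Str w').carrier).Nonempty) ↔
          (w ≠ w' ∧ (Vis P w ∩ Vis P w').Nonempty)
        rw [h4, (Equiv.ofInjective Str hinj).injective.ne_iff] }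
  rw [h.inflate_eq hP]
  exact ⟨h.isSimplePolygon_offset hP (h.abs_lt ⟨hδ.le, hδη⟩), h.region_subset hP ⟨hδ, hδη⟩,
    Str, h1, h2, h3, h4, ⟨φ, fun w => rfl⟩, hout.of_iso φ.symm⟩
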